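/- Let $\Omega = 8\pi e^{\gamma}$, where $\gamma$ is Euler's constant. For a number field $L$ of degree $n$ and discriminant $D$, its root discriminant is $\mathrm{rd}(L)=|D|^{1/n}$. Call a Galois number field $L\subset\mathbb{C}$ nonsolvable if $\mathrm{Gal}(L/\mathbb{Q})$ is not solvable, and minimal nonsolvable if moreover it contains no strictly smaller nonsolvable Galois number field. Let $K_1, K_2\subset\mathbb{C}$ be the splitting fields of $$f_1 = x^5-x^4-x^3+3x^2-x-19,\qquad f_2 = x^6-2x^5+4x^4-8x^3+2x^2+24x-20,$$ let $K_3=\mathbb{Q}(\sqrt{-3})$, and let $K=K_1K_2K_3$. Then: 1. $\mathrm{Gal}(K_1/\mathbb{Q})\cong S_5$ and $\mathrm{Gal}(K_2/\mathbb{Q})\cong S_6$; the fields $K_1$ and $K_2$ are distinct minimal nonsolvable Galois number fields, each of root discriminant at most $\Omega$. 2. The compositum $K_1K_2$ is Galois over $\mathbb{Q}$ with $\mathrm{Gal}(K_1K_2/\mathbb{Q})\cong S_5\times S_6$, so $[K_1K_2:\mathbb{Q}]=86400$, and $\mathrm{rd}(K_1K_2)=2^{39/16}\,3^{1/2}\,7^{4/5}$.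 3. The field $K$ is Galois over $\mathbb{Q}$, nonsolvable, of degree $[K:\mathbb{Q}]=172800$, and $\mathrm{rd}(K)=2^{39/16}\,3^{1/2}\,7^{4/5}$. 4. $2^{39/16}\,3^{1/2}\,7^{4/5}<\Omega$, and $2^{39/16}\,3^{1/2}\,7^{4/5}\approx 44.50$ to the nearest hundredth. In particular, there are two distinct minimal nonsolvable Galois number fields of root discriminant at most $\Omega$ whose compositum still has root discriminant less than $\Omega$. -/

import Mathlib

open Polynomial

/-- The splitting field of a rational polynomial, as a subfield of `ℂ`. -/
noncomputable def splittingFieldInC (f : ℚ[X]) : IntermediateField ℚ ℂ :=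
  IntermediateField.adjoin ℚ (f.rootSet ℂ)

theorem finiteDimensional_splittingFieldInC (f : ℚ[X]) :
    FiniteDimensional ℚ (splittingFieldInC f) := by
  have : Finite (f.rootSet ℂ) := inferInstance
  refine IntermediateField.finiteDimensional_adjoin fun x hx => ?_
  rw [Polynomial.mem_rootSet] at hx
  exact isAlgebraic_iff_isIntegral.1 ⟨f, hx⟩

instance numberField_splittingFieldInC (f : ℚ[X]) : NumberField (splittingFieldInC f) where
  to_charZero := inferInstance
  to_finiteDimensional := finiteDimensional_splittingFieldInC f

/-- The compositum of two number fields in `ℂ` is a number field. -/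
instance numberField_compositum (K L : IntermediateField ℚ ℂ) [NumberField K] [NumberField L] :
    NumberField (K ⊔ L : IntermediateField ℚ ℂ) where
  to_charZero := inferInstance
  to_finiteDimensional :=
    have : FiniteDimensional ℚ K := NumberField.to_finiteDimensional
    have : FiniteDimensional ℚ L := NumberField.to_finiteDimensional
    IntermediateField.finiteDimensional_sup K L

/-- The Serre-Odlyzko constant `Ω = 8 π e ^ γ`. -/
noncomputable def serreOdlyzko : ℝ :=
  8 * Real.pi * Real.exp Real.eulerMascheroniConstant

/-- The set of nonsolvable Galois number fields `K ⊂ ℂ` of root discriminant at most `B`. -/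
def nonsolvableFields (B : ℝ) : Set (IntermediateField ℚ ℂ) :=
  {K | IsGalois ℚ K ∧ ¬ Group.IsSolvable Gal(K/ℚ) ∧
    ∃ _ : NumberField K, NumberField.rootDiscr K ≤ B}

/-- The fields in `nonsolvableFields B` which are minimal: they contain no strictly smaller
nonsolvable Galois number field. -/
def minimalNonsolvableFields (B : ℝ) : Set (IntermediateField ℚ ℂ) :=
  {K | K ∈ nonsolvableFields B ∧
    ∀ L : IntermediateField ℚ ℂ, L ≤ K → IsGalois ℚ L → ¬ Group.IsSolvable Gal(L/ℚ) → L = K}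

/-- The splitting field of `x^5 - x^4 - x^3 + 3x^2 - x - 19`. -/
noncomputable abbrev fieldK₁ : IntermediateField ℚ ℂ :=
  splittingFieldInC (X ^ 5 - X ^ 4 - X ^ 3 + 3 * X ^ 2 - X - 19)

/-- The splitting field of `x^6 - 2x^5 + 4x^4 - 8x^3 + 2x^2 + 24x - 20`. -/
noncomputable abbrev fieldK₂ : IntermediateField ℚ ℂ :=
  splittingFieldInC (X ^ 6 - 2 * X ^ 5 + 4 * X ^ 4 - 8 * X ^ 3 + 2 * X ^ 2 + 24 * X - 20)

/-- The field `ℚ(√-3)`, the splitting field of `x^2 + 3`. -/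
noncomputable abbrev fieldK₃ : IntermediateField ℚ ℂ :=
  splittingFieldInC (X ^ 2 + 3)

open WithZero in
/-- A subgroup `I` of the Galois group acting on a valued field like an inertia group: it preserves
the valuation, acts trivially on the residue field, and the extension of the fixed field of `I` is
totally ramified. -/
structure IsTotallyRamified {F M : Type*} [Field F] [Field M] [Algebra F M]
    (v : Valuation M ℤᵐ⁰) (I : Subgroup Gal(M/F)) : Prop where
  map_apply : ∀ σ ∈ I, ∀ x, v (σ x) = v x
  map_apply_sub_lt : ∀ σ ∈ I, ∀ x, v x ≤ 1 → v (σ x - x) < 1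
  exists_eq_exp : ∀ x, x ≠ 0 → (∀ σ ∈ I, σ x = x) → ∃ k : ℤ, v x = exp (k * Nat.card I)

open WithZero in
theorem Valuation.ne_zero_of_map_eq_exp {M : Type*} [Field M] {v : Valuation M ℤᵐ⁰} {x : M} {k : ℤ}
    (h : v x = exp k) : x ≠ 0 := by
  rintro rfl
  rw [map_zero] at h
  exact exp_ne_zero h.symm

namespace IsTotallyRamified

open WithZero

variable {F M : Type*} [Field F] [Field M] [Algebra F M] {v : Valuation M ℤᵐ⁰}
  {I : Subgroup Gal(M/F)} {π : M}

theorem le_map_sum (h : IsTotallyRamified v I) (hπ : v π = exp (-1))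
    (a : Fin (Nat.card I) → M) (ha : ∀ i, ∀ σ ∈ I, σ (a i) = a i) (i : Fin (Nat.card I)) :
    v (a i * π ^ (i : ℕ)) ≤ v (∑ j, a j * π ^ (j : ℕ)) := by
  classical
  obtain ⟨m, -, hm⟩ := Finset.exists_max_image Finset.univ (fun j ↦ v (a j * π ^ (j : ℕ)))
    ⟨i, Finset.mem_univ i⟩
  refine (hm i (Finset.mem_univ i)).trans ?_
  rcases eq_or_ne (a m) 0 with h0 | h0
  · simp [h0]
  refine (Valuation.map_sum_eq_of_lt v (f := fun j : Fin (Nat.card I) ↦ a j * π ^ (j : ℕ))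
    (Finset.mem_univ m) ?_).ge
  · intro j hj
    have hjm : j ≠ m := fun h' ↦ (Finset.mem_sdiff.1 hj).2 (Finset.mem_singleton.2 h')
    refine lt_of_le_of_ne (hm j (Finset.mem_univ j)) fun heq ↦ hjm ?_
    have hj0 : a j ≠ 0 := by
      rintro h'
      rw [h', zero_mul, map_zero, eq_comm, map_mul, map_pow, hπ, mul_eq_zero] at heq
      rcases heq with heq | heq
      · exact h0 (by simpa using heq)
      · exact pow_ne_zero _ exp_ne_zero heq
    obtain ⟨k, hk⟩ := h.exists_eq_exp _ h0 (ha m)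
    obtain ⟨l, hl⟩ := h.exists_eq_exp _ hj0 (ha j)
    rw [map_mul, map_mul, map_pow, map_pow, hπ, hk, hl, ← exp_nsmul, ← exp_nsmul, ← exp_add,
      ← exp_add, exp_inj] at heq
    have hjlt := j.2
    have hmlt := m.2
    simp only [smul_neg, nsmul_eq_mul, mul_one] at heq
    have : ((j : ℕ) : ℤ) = ((m : ℕ) : ℤ) := by
      have h1 : (((j : ℕ) : ℤ) - (m : ℕ)) = (l - k) * (Nat.card I : ℤ) := by linarith
      have h2 : l - k = 0 := by
        by_contra hne
        rcases lt_or_gt_of_ne hne with h3 | h3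
        · have : (l - k) * (Nat.card I : ℤ) ≤ -1 * (Nat.card I : ℤ) := by gcongr; omega
          omega
        · have : 1 * (Nat.card I : ℤ) ≤ (l - k) * (Nat.card I : ℤ) := by gcongr; omega
          omega
      rw [h2] at h1
      omega
    exact Fin.ext (by exact_mod_cast this)

theorem map_apply_sub_le_of_sq (h : IsTotallyRamified v I) (hπ : v π = exp (-1)) {σ : Gal(M/F)}
    (hσ : σ ∈ I) (h2 : v 2 < 1) (hsq : σ (σ π) = π) : v (σ π - π) ≤ exp (-2) := by
  have hπ0 : π ≠ 0 := Valuation.ne_zero_of_map_eq_exp hπ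
  set u := σ π / π with hu
  have hvu : v u = 1 := by
    rw [hu, map_div₀, h.map_apply _ hσ, div_self]
    simpa using hπ0
  have h1 : u * σ u = 1 := by
    rw [hu, map_div₀, hsq]
    have : σ π ≠ 0 := by simpa using hπ0
    field_simp
  have h3 : v (u - 1) < 1 := by
    have h4 : (u - 1) ^ 2 = - (u * (σ u - u)) - 2 * (u - 1) := by linear_combination h1
    have h5 : v ((u - 1) ^ 2) < 1 := by
      rw [h4]
      refine Valuation.map_sub_lt v ?_ ?_
      · rw [Valuation.map_neg, map_mul, hvu, one_mul]
        exact h.map_apply_sub_lt σ hσ u hvu.le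
      · rw [map_mul]
        exact mul_lt_one_of_nonneg_of_lt_one_left zero_le h2
          (Valuation.map_sub_le v hvu.le (map_one v).le)
    rw [map_pow] at h5
    exact (pow_lt_one_iff two_ne_zero).1 h5
  have h6 : σ π - π = (u - 1) * π := by rw [hu]; field_simp
  rw [h6, map_mul, hπ]
  have h7 : v (u - 1) ≤ exp (-1) := by
    rw [← lt_mul_exp_iff_le exp_ne_zero, ← exp_add]
    simpa using h3
  calc v (u - 1) * exp (-1) ≤ exp (-1) * exp (-1) := by gcongr
    _ = exp (-2) := by rw [← exp_add]; norm_num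

theorem map_apply_sub_lt_of_lt (h : IsTotallyRamified v I) (hπ : v π = exp (-1)) {σ : Gal(M/F)}
    (hσ : σ ∈ I) (hlt : v (σ π - π) < v π) {x : M} (hx : x ≠ 0) : v (σ x - x) < v x := by
  have hπ0 : π ≠ 0 := Valuation.ne_zero_of_map_eq_exp hπ
  have hx0 : v x ≠ 0 := by simpa using hx
  obtain ⟨m, hm⟩ : ∃ m : ℤ, v x = v π ^ m :=
    ⟨-log (v x), by rw [hπ, ← exp_zsmul]; simp [exp_log hx0]⟩
  have hzp : ∀ u : Mˣ, v ((u : M) - 1) < 1 → ∀ n : ℤ, v ((u ^ n : Mˣ) - 1 : M) < 1 := by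
    intro u hu
    have hvu : v (u : M) = 1 := by
      have := Valuation.map_one_add_of_lt (v := v) hu
      simpa using this
    have hnat : ∀ n : ℕ, v ((u : M) ^ n - 1 : M) < 1 := by
      intro n
      induction n with
      | zero => simp
      | succ n ih =>
        have : (u : M) ^ (n + 1) - 1 = u * (u ^ n - 1) + (u - 1) := by ring
        rw [this]
        refine Valuation.map_add_lt v ?_ hu
        rwa [map_mul, hvu, one_mul]
    intro n
    obtain ⟨k, rfl | rfl⟩ := n.eq_nat_or_neg
    · simpa using hnat k
    · have h1 : ((u ^ (-(k : ℤ)) : Mˣ) : M) - 1 = -(((u : M) ^ k)⁻¹ * ((u : M) ^ k - 1)) := by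
        have : (u : M) ^ k ≠ 0 := pow_ne_zero _ u.ne_zero
        rw [zpow_neg, zpow_natCast, Units.val_inv_eq_inv_val, Units.val_pow_eq_pow_val]
        field_simp
        ring
      rw [h1, Valuation.map_neg, map_mul, map_inv₀, map_pow, hvu, one_pow, inv_one, one_mul]
      exact hnat k
  set w := x / π ^ m with hw
  have hvw : v w = 1 := by
    rw [hw, map_div₀, map_zpow₀, ← hm, div_self hx0]
  have hσπ0 : σ π ≠ 0 := by simpa using hπ0
  set u : Mˣ := Units.mk0 (σ π / π) (div_ne_zero hσπ0 hπ0) with hu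
  have hu1 : v ((u : M) - 1) < 1 := by
    have h1 : σ π - π = ((u : M) - 1) * π := by simp only [hu, Units.val_mk0]; field_simp
    rw [h1, map_mul] at hlt
    by_contra! h2
    exact absurd hlt (not_lt.2 (le_mul_of_one_le_left' h2))
  have h2 := hzp u hu1 m
  have h3 : σ x - x = (σ w * (((u ^ m : Mˣ) : M) - 1) + (σ w - w)) * π ^ m := by
    simp only [hw, hu, map_div₀, map_zpow₀, Units.val_zpow_eq_zpow_val, Units.val_mk0, div_zpow]
    have := zpow_ne_zero m hπ0
    have := zpow_ne_zero m hσπ0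
    field_simp
    ring
  rw [h3, map_mul, map_zpow₀, ← hm]
  have h4 : v (σ w * (((u ^ m : Mˣ) : M) - 1) + (σ w - w)) < 1 := by
    refine Valuation.map_add_lt v ?_ (h.map_apply_sub_lt σ hσ w hvw.le)
    rw [map_mul, h.map_apply σ hσ, hvw, one_mul]
    exact h2
  calc _ < 1 * v x := mul_lt_mul_of_pos_right h4 (zero_lt_iff.2 hx0)
    _ = v x := one_mul _

variable [FiniteDimensional F M]

theorem exists_eq_sum (h : IsTotallyRamified v I) (hπ : v π = exp (-1)) (x : M) :
    ∃ a : Fin (Nat.card I) → M, (∀ i, ∀ σ ∈ I, σ (a i) = a i) ∧ x = ∑ j, a j * π ^ (j : ℕ) := by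
  set T := IntermediateField.fixedField I
  have hfix : ∀ t : T, ∀ σ ∈ I, σ (t : M) = t := fun t σ hσ ↦ t.2 ⟨σ, hσ⟩
  have hπ0 : π ≠ 0 := Valuation.ne_zero_of_map_eq_exp hπ
  have hli : LinearIndependent T (fun j : Fin (Nat.card I) ↦ π ^ (j : ℕ)) := by
    rw [Fintype.linearIndependent_iff]
    intro g hg i
    have := h.le_map_sum hπ (fun j ↦ (g j : M)) (fun j ↦ hfix (g j)) i
    have h0 : ∑ j, (g j : M) * π ^ (j : ℕ) = 0 := by
      simpa [Algebra.smul_def] using hg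
    rw [h0, map_zero, le_zero_iff, map_eq_zero, mul_eq_zero] at this
    exact Subtype.ext (this.resolve_right (pow_ne_zero _ hπ0))
  have : Nonempty (Fin (Nat.card I)) := ⟨⟨0, Nat.card_pos⟩⟩
  let b := basisOfLinearIndependentOfCardEqFinrank hli (by
    rw [Fintype.card_fin, IntermediateField.finrank_fixedField_eq_card])
  refine ⟨fun j ↦ (b.repr x j : M), fun j ↦ hfix _, ?_⟩
  conv_lhs => rw [← b.sum_repr x]
  simp [b, Algebra.smul_def]

theorem eq_one_of_apply_eq (h : IsTotallyRamified v I) (hπ : v π = exp (-1)) {σ : Gal(M/F)}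
    (hσ : σ ∈ I) (hσπ : σ π = π) : σ = 1 := by
  ext x
  obtain ⟨a, ha, rfl⟩ := h.exists_eq_sum hπ x
  simp [hσπ, ha _ σ hσ]

theorem exists_eq_sum_of_le_one (h : IsTotallyRamified v I) (hπ : v π = exp (-1)) {y : M}
    (hy : v y ≤ 1) : ∃ a : Fin (Nat.card I) → M, (∀ i, ∀ σ ∈ I, σ (a i) = a i) ∧
      (∀ i, v (a i) ≤ 1) ∧ y = ∑ j, a j * π ^ (j : ℕ) := by
  obtain ⟨a, ha, rfl⟩ := h.exists_eq_sum hπ y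
  have hle : ∀ i, v (a i) ≤ 1 := by
    intro i
    have h1 := (h.le_map_sum hπ a ha i).trans hy
    rcases eq_or_ne (a i) 0 with h0 | h0
    · simp [h0]
    obtain ⟨k, hk⟩ := h.exists_eq_exp _ h0 (ha i)
    rw [map_mul, map_pow, hπ, hk, ← exp_nsmul, ← exp_add, ← exp_zero, exp_le_exp] at h1
    rw [hk, ← exp_zero, exp_le_exp]
    have hi := i.2
    simp only [smul_neg, nsmul_eq_mul, mul_one] at h1
    have : k < 1 := by
      by_contra! hk1
      have : 1 * (Nat.card I : ℤ) ≤ k * (Nat.card I : ℤ) := by gcongr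
      omega
    exact mul_nonpos_of_nonpos_of_nonneg (by omega) (by positivity)
  exact ⟨a, ha, hle, rfl⟩

theorem exists_polynomial (h : IsTotallyRamified v I) (hπ : v π = exp (-1)) {y : M}
    (hy : v y ≤ 1) : ∃ g : v.integer[X], ∀ σ ∈ I, aeval (σ π) g = σ y := by
  obtain ⟨a, ha, hle, rfl⟩ := h.exists_eq_sum_of_le_one hπ hy
  refine ⟨∑ j, C (⟨a j, hle j⟩ : v.integer) * X ^ (j : ℕ), fun σ hσ ↦ ?_⟩
  simp only [map_sum, map_mul, aeval_C, map_pow, aeval_X, ha _ σ hσ]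
  rfl

open Classical in
theorem le_prod_coset (h : IsTotallyRamified v I) (hπ : v π = exp (-1)) {y : M}
    (hy : v y ≤ 1) (σ : I) :
    v (σ.1 y - y) ≤ ∏ τ : I with τ.1 y = σ.1 y, v (τ.1 π - π) := by
  obtain ⟨g, hg⟩ := h.exists_polynomial hπ hy
  have hπ1 : v π ≤ 1 := by rw [hπ, ← exp_zero, exp_le_exp]; norm_num
  let r : I → v.integer := fun τ ↦ ⟨τ.1 π, by
    rw [Valuation.mem_integer_iff, h.map_apply _ τ.2]; exact hπ1⟩
  have hr : Function.Injective r := by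
    intro τ τ' heq
    have h1 : τ.1 π = τ'.1 π := congrArg Subtype.val heq
    have h2 : τ'.1⁻¹ * τ.1 = 1 := by
      refine h.eq_one_of_apply_eq hπ (I.mul_mem (I.inv_mem τ'.2) τ.2) ?_
      rw [AlgEquiv.mul_apply, h1, ← AlgEquiv.mul_apply, inv_mul_cancel, AlgEquiv.one_apply]
    exact Subtype.ext (inv_mul_eq_one.mp h2).symm
  let s : v.integer := ⟨σ.1 y, by rw [Valuation.mem_integer_iff, h.map_apply _ σ.2]; exact hy⟩
  have hdvd : ∏ τ : I with τ.1 y = σ.1 y, (X - C (r τ)) ∣ g - C s := by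
    refine Finset.prod_dvd_of_isRelPrime ?_ ?_
    · intro τ _ τ' _ hne
      have hne' : r τ ≠ r τ' := hr.ne hne
      rw [Function.onFun]
      refine ((prime_X_sub_C (r τ)).irreducible.isRelPrime_iff_not_dvd).2 ?_
      rw [dvd_iff_isRoot]
      simpa [sub_eq_zero] using hne'
    · intro τ hτ
      rw [dvd_iff_isRoot, IsRoot, eval_sub, eval_C, sub_eq_zero]
      refine Subtype.ext ?_
      have h1 := hg τ.1 τ.2
      have h2 : ((eval (r τ) g : v.integer) : M) = aeval (τ.1 π) g := by
        rw [show τ.1 π = algebraMap v.integer M (r τ) from rfl, aeval_algebraMap_apply]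
        simp [aeval_def]
        rfl
      rw [h2, h1]
      exact (Finset.mem_filter.1 hτ).2
  obtain ⟨q, hq⟩ := hdvd
  have h1 := congrArg (aeval (π : M)) hq
  have h2 : aeval π g = y := by simpa using hg 1 I.one_mem
  rw [map_sub, h2, aeval_C, map_mul, map_prod] at h1
  have hs : algebraMap v.integer M s = σ.1 y := rfl
  rw [Valuation.map_sub_swap, ← hs, h1, map_mul, map_prod]
  have hq1 : v (aeval π q) ≤ 1 := by
    rw [show π = algebraMap v.integer M ⟨π, hπ1⟩ from rfl, aeval_algebraMap_apply]
    exact (aeval _ q : v.integer).2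
  refine (mul_le_of_le_one_right' hq1).trans (le_of_eq ?_)
  refine Finset.prod_congr rfl fun τ _ ↦ ?_
  rw [map_sub, aeval_X, aeval_C, Valuation.map_sub_swap]
  rfl

open Classical in
theorem prod_coset_le (h : IsTotallyRamified v I) (hπ : v π = exp (-1)) {y : M} (σ : I)
    (hσ : ∀ c, v c ≤ 1 → (∀ τ ∈ I, τ y = y → τ c = c) → v (σ.1 c - c) ≤ v (σ.1 y - y)) :
    ∏ τ : I with τ.1 y = σ.1 y, v (τ.1 π - π) ≤ v (σ.1 y - y) := by
  have hπ1 : v π ≤ 1 := by rw [hπ, ← exp_zero, exp_le_exp]; norm_num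
  set Φ : M[X] := ∏ τ : I with τ.1 y = y, (X - C (τ.1 π)) with hΦ
  have hint : ∀ i, v (Φ.coeff i) ≤ 1 := by
    have hmem : ∀ τ : I, τ.1 π ∈ v.integer := fun τ ↦ by
      rw [Valuation.mem_integer_iff, h.map_apply _ τ.2]; exact hπ1
    have : Φ = (∏ τ ∈ Finset.univ.filter (fun τ : I ↦ τ.1 y = y),
        (X - C (⟨τ.1 π, hmem τ⟩ : v.integer))).map
        v.integer.subtype := by
      rw [Polynomial.map_prod]
      simp [hΦ]
    intro i
    rw [this, coeff_map]
    exact (coeff _ _ : v.integer).2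
  have hfix : ∀ τ ∈ I, τ y = y → ∀ i, τ (Φ.coeff i) = Φ.coeff i := by
    intro τ hτ hτy i
    have : Φ.map (τ : M →+* M) = Φ := by
      rw [hΦ, Polynomial.map_prod]
      refine Finset.prod_bij' (fun ρ _ ↦ ⟨τ, hτ⟩ * ρ) (fun ρ _ ↦ ⟨τ, hτ⟩⁻¹ * ρ) ?_ ?_ ?_ ?_ ?_
      · intro ρ hρ
        simp only [Finset.mem_filter, Finset.mem_univ, true_and] at hρ ⊢
        rw [Subgroup.coe_mul, AlgEquiv.mul_apply, hρ, hτy]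
      · intro ρ hρ
        simp only [Finset.mem_filter, Finset.mem_univ, true_and] at hρ ⊢
        rw [Subgroup.coe_mul, AlgEquiv.mul_apply, hρ, Subgroup.coe_inv]
        conv_lhs => rw [← hτy]
        rw [← AlgEquiv.mul_apply, inv_mul_cancel, AlgEquiv.one_apply]
      · intro ρ _; simp
      · intro ρ _; simp
      · intro ρ _; simp
    conv_rhs => rw [← this, coeff_map]
    rfl
  have hmap : Φ.map (σ.1 : M →+* M) = ∏ τ : I with τ.1 y = σ.1 y, (X - C (τ.1 π)) := by
    rw [hΦ, Polynomial.map_prod]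
    refine Finset.prod_bij' (fun ρ _ ↦ σ * ρ) (fun ρ _ ↦ σ⁻¹ * ρ) ?_ ?_ ?_ ?_ ?_
    · intro ρ hρ
      simp only [Finset.mem_filter, Finset.mem_univ, true_and] at hρ ⊢
      rw [Subgroup.coe_mul, AlgEquiv.mul_apply, hρ]
    · intro ρ hρ
      simp only [Finset.mem_filter, Finset.mem_univ, true_and] at hρ ⊢
      rw [Subgroup.coe_mul, AlgEquiv.mul_apply, hρ, ← AlgEquiv.mul_apply, Subgroup.coe_inv,
        inv_mul_cancel, AlgEquiv.one_apply]
    · intro ρ _; simp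
    · intro ρ _; simp
    · intro ρ _; simp
  have h0 : Φ.eval π = 0 := by
    rw [hΦ, eval_prod]
    refine Finset.prod_eq_zero (i := 1) (by simp) (by simp)
  have hev : (Φ.map (σ.1 : M →+* M) - Φ).eval π = ∏ τ : I with τ.1 y = σ.1 y, (π - τ.1 π) := by
    rw [eval_sub, h0, sub_zero, hmap, eval_prod]
    simp
  calc _ = v ((Φ.map (σ.1 : M →+* M) - Φ).eval π) := by
        rw [hev, map_prod]
        exact Finset.prod_congr rfl fun τ _ ↦ Valuation.map_sub_swap ..
    _ ≤ _ := by
        rw [eval_eq_sum_range]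
        refine Valuation.map_sum_le v fun i _ ↦ ?_
        rw [map_mul, map_pow, coeff_sub, coeff_map]
        refine (mul_le_of_le_one_right' (pow_le_one' hπ1 i)).trans ?_
        exact hσ _ (hint i) fun τ hτ hτy ↦ hfix τ hτ hτy i

theorem map_apply_sub_eq_of_pow (h : IsTotallyRamified v I) (hπ : v π = exp (-1)) {σ : Gal(M/F)}
    (hσ : σ ∈ I) {n : ℕ} (hn : v n = 1) (hpow : σ ^ n = 1) (hne : σ ≠ 1) :
    v (σ π - π) = exp (-1) := by
  have hle : v (σ π - π) ≤ v π := by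
    refine Valuation.map_sub_le v (h.map_apply σ hσ π).le le_rfl
  rw [← hπ]
  refine hle.antisymm (not_lt.1 fun hlt ↦ ?_)
  set w := σ π - π with hw
  have hw0 : w ≠ 0 := fun h0 ↦ hne (h.eq_one_of_apply_eq hπ hσ (sub_eq_zero.1 h0))
  have hstep : ∀ k : ℕ, v ((σ ^ k) w - w) < v w := by
    intro k
    induction k with
    | zero => simpa [zero_lt_iff] using hw0
    | succ k ih =>
      have h1 : (σ ^ (k + 1)) w - w = σ ((σ ^ k) w - w) + (σ w - w) := by
        rw [pow_succ', AlgEquiv.mul_apply, map_sub σ]; ring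
      rw [h1]
      refine Valuation.map_add_lt v ?_ (h.map_apply_sub_lt_of_lt hπ hσ hlt hw0)
      rwa [h.map_apply σ hσ]
  have hsum : ∀ k : ℕ, (σ ^ k) π - π = ∑ i ∈ Finset.range k, (σ ^ i) w := by
    intro k
    induction k with
    | zero => simp
    | succ k ih =>
      rw [Finset.sum_range_succ, ← ih, hw, map_sub, pow_succ, AlgEquiv.mul_apply]
      abel
  have h2 := hsum n
  rw [hpow, AlgEquiv.one_apply, sub_self] at h2
  have h3 : (n : M) * w = -∑ i ∈ Finset.range n, ((σ ^ i) w - w) := by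
    rw [Finset.sum_sub_distrib, ← h2]
    simp
  have h4 : v ((n : M) * w) < v w := by
    rw [h3, Valuation.map_neg]
    exact Valuation.map_sum_lt v (by simpa using hw0) fun i _ ↦ hstep i
  rw [map_mul, hn, one_mul] at h4
  exact lt_irrefl _ h4

theorem isCyclic (h : IsTotallyRamified v I) (hπ : v π = exp (-1))
    (htame : ∀ σ ∈ I, σ ≠ 1 → v (σ π - π) = exp (-1)) : IsCyclic I := by
  have hπ0 : π ≠ 0 := Valuation.ne_zero_of_map_eq_exp hπ
  have hvπ0 : v π ≠ 0 := by simpa using hπ0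
  have hmem : ∀ σ : I, σ.1 π / π ∈ v.valuationSubring := fun σ ↦ by
    rw [Valuation.mem_valuationSubring_iff, map_div₀, h.map_apply _ σ.2, div_self hvπ0]
  have hres : ∀ a b : v.valuationSubring, v ((a : M) - b) < 1 ↔
      IsLocalRing.residue v.valuationSubring a = IsLocalRing.residue v.valuationSubring b := by
    intro a b
    rw [← sub_eq_zero, ← map_sub, IsLocalRing.residue_eq_zero_iff,
      v.isEquiv_valuation_valuationSubring.lt_one_iff_lt_one, ValuationSubring.valuation_lt_one_iff]
    rfl
  let f : I →* IsLocalRing.ResidueField v.valuationSubring :=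
    { toFun := fun σ ↦ IsLocalRing.residue _ ⟨σ.1 π / π, hmem σ⟩
      map_one' := by
        rw [← map_one (IsLocalRing.residue _), ← hres]
        simp [hπ0]
      map_mul' := by
        intro σ τ
        rw [← map_mul, ← hres]
        have h1 : ((σ * τ : I) : Gal(M/F)) π / π - (σ.1 π / π) * (τ.1 π / π) =
            (σ.1 π / π) * (σ.1 (τ.1 π / π) - τ.1 π / π) := by
          have : σ.1 π ≠ 0 := by simpa using hπ0
          rw [map_div₀, Subgroup.coe_mul, AlgEquiv.mul_apply]
          field_simp
        have h2 := h.map_apply_sub_lt σ.1 σ.2 _ (hmem τ)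
        change v (((σ * τ : I) : Gal(M/F)) π / π - (σ.1 π / π) * (τ.1 π / π)) < 1
        rw [h1, map_mul]
        exact mul_lt_one_of_nonneg_of_lt_one_right (hmem σ) zero_le h2 }
  refine isCyclic_of_injective_ringHom f ((injective_iff_map_eq_one f).2 fun σ hσ ↦ ?_)
  by_contra hne
  have h1 := htame σ.1 σ.2 fun h1 ↦ hne (Subtype.ext h1)
  have h2 : v (σ.1 π / π - 1) < 1 := by
    have := (hres ⟨σ.1 π / π, hmem σ⟩ 1).2 (by simpa [f] using hσ)
    simpa using this
  have h3 : σ.1 π - π = (σ.1 π / π - 1) * π := by field_simp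
  rw [h3, map_mul, hπ] at h1
  have : v (σ.1 π / π - 1) = 1 := by
    simpa using h1
  exact absurd this h2.ne

end IsTotallyRamified

namespace IsDedekindDomain.HeightOneSpectrum

open NumberField WithZero Pointwise

variable {M : Type*} [Field M] [NumberField M] (w : HeightOneSpectrum (𝓞 M))

theorem valuation_apply_of_mem_stabilizer {σ : Gal(M/ℚ)}
    (hσ : σ ∈ MulAction.stabilizer Gal(M/ℚ) w.asIdeal) (x : M) :
    w.valuation M (σ x) = w.valuation M x := by
  have hint : ∀ y : 𝓞 M, w.intValuation (σ • y) = w.intValuation y := by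
    intro y
    rcases eq_or_ne y 0 with rfl | hy
    · simp
    have key : ∀ n : ℕ, σ • y ∈ w.asIdeal ^ n ↔ y ∈ w.asIdeal ^ n := by
      intro n
      conv_lhs => rw [← MulAction.mem_stabilizer_iff.1 hσ, ← smul_pow']
      exact Ideal.smul_mem_pointwise_smul_iff
    have hy' : σ • y ≠ 0 := (smul_ne_zero_iff_ne σ).2 hy
    refine le_antisymm ?_ ?_
    · rw [w.intValuation_if_neg hy, w.intValuation_le_pow_iff_mem, key,
        ← w.intValuation_le_pow_iff_mem, w.intValuation_if_neg hy]
    · rw [w.intValuation_if_neg hy', w.intValuation_le_pow_iff_mem, ← key,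
        ← w.intValuation_le_pow_iff_mem, w.intValuation_if_neg hy']
  obtain ⟨a, b, hb, rfl⟩ := IsFractionRing.div_surjective (A := 𝓞 M) x
  have h1 : ∀ c : 𝓞 M, σ (algebraMap (𝓞 M) M c) = algebraMap (𝓞 M) M (σ • c) := fun c ↦ rfl
  simp only [map_div₀, h1, valuation_of_algebraMap, hint]

theorem valuation_apply_of_mem_inertia {σ : Gal(M/ℚ)}
    (hσ : σ ∈ w.asIdeal.inertia Gal(M/ℚ)) (x : M) :
    w.valuation M (σ x) = w.valuation M x :=
  w.valuation_apply_of_mem_stabilizer (Ideal.inertia_le_stabilizer w.asIdeal hσ) x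

theorem valuation_apply_sub_pow_lt {σ : Gal(M/ℚ)} {n : ℕ}
    (hst : σ ∈ MulAction.stabilizer Gal(M/ℚ) w.asIdeal)
    (hσ : ∀ y : 𝓞 M, σ • y - y ^ n ∈ w.asIdeal) (x : M) (hx : w.valuation M x ≤ 1) :
    w.valuation M (σ x - x ^ n) < 1 := by
  obtain ⟨a, b, hb⟩ := w.exists_primeCompl_mul_eq_of_integer x hx
  have hvb : w.valuation M (algebraMap (𝓞 M) M b) = 1 :=
    w.valuation_eq_one_iff_notMem.2 b.2
  have hb0 : algebraMap (𝓞 M) M b ≠ 0 := fun h0 ↦ by simp [h0] at hvb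
  have hσb : w.valuation M (σ (algebraMap (𝓞 M) M b)) = 1 := by
    rw [w.valuation_apply_of_mem_stabilizer hst, hvb]
  have hσb0 : σ (algebraMap (𝓞 M) M b) ≠ 0 := by simpa using hb0
  have hlt : ∀ c : 𝓞 M, w.valuation M (σ (algebraMap (𝓞 M) M c) - algebraMap (𝓞 M) M c ^ n) < 1 := by
    intro c
    have : σ (algebraMap (𝓞 M) M c) - algebraMap (𝓞 M) M c ^ n =
        algebraMap (𝓞 M) M (σ • c - c ^ n) := by
      rw [map_sub, map_pow]; rfl
    rw [this, valuation_lt_one_iff_mem]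
    exact hσ c
  have h1 : σ x - x ^ n = ((σ (algebraMap (𝓞 M) M a) - algebraMap (𝓞 M) M a ^ n) -
      x ^ n * (σ (algebraMap (𝓞 M) M b) - algebraMap (𝓞 M) M b ^ n)) /
        σ (algebraMap (𝓞 M) M b) := by
    rw [← hb, map_mul]
    field_simp
    ring
  rw [h1, map_div₀, hσb, div_one]
  refine Valuation.map_sub_lt _ (hlt a) ?_
  rw [map_mul, map_pow]
  exact mul_lt_one_of_nonneg_of_lt_one_right (pow_le_one' hx n) zero_le (hlt b)

theorem valuation_apply_sub_lt_of_mem_inertia {σ : Gal(M/ℚ)}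
    (hσ : σ ∈ w.asIdeal.inertia Gal(M/ℚ)) (x : M) (hx : w.valuation M x ≤ 1) :
    w.valuation M (σ x - x) < 1 := by
  have := w.valuation_apply_sub_pow_lt (n := 1) (Ideal.inertia_le_stabilizer w.asIdeal hσ)
    (fun y ↦ by simpa using hσ y) x hx
  simpa using this

variable [IsGalois ℚ M]

/-- The inertia field of a prime ideal. -/
noncomputable abbrev inertiaField : IntermediateField ℚ M :=
  FixedPoints.intermediateField (w.asIdeal.inertia Gal(M/ℚ))

instance : NumberField w.inertiaField := NumberField.of_intermediateField _

instance : IsGaloisGroup (w.asIdeal.inertia Gal(M/ℚ)) w.inertiaField M :=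
  IsGaloisGroup.subgroup Gal(M/ℚ) ℚ M _

instance : IsGaloisGroup (w.asIdeal.inertia Gal(M/ℚ)) (𝓞 w.inertiaField) (𝓞 M) :=
  IsGaloisGroup.of_isFractionRing _ _ _ w.inertiaField M

/-- The prime of the inertia field below a given prime. -/
noncomputable def inertiaFieldPrime : HeightOneSpectrum (𝓞 w.inertiaField) where
  asIdeal := w.asIdeal.under (𝓞 w.inertiaField)
  isPrime := inferInstance
  ne_bot := mt Ideal.eq_bot_of_comap_eq_bot w.ne_bot

instance : w.asIdeal.LiesOver w.inertiaFieldPrime.asIdeal := ⟨rfl⟩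

theorem ramificationIdx_inertiaField :
    w.asIdeal.ramificationIdx (𝓞 w.inertiaField) =
      Nat.card (w.asIdeal.inertia Gal(M/ℚ)) := by
  have h1 := Ideal.card_inertia_eq_ramificationIdxIn
    (G := w.asIdeal.inertia Gal(M/ℚ)) w.inertiaFieldPrime.asIdeal w.asIdeal
  rw [Ideal.ramificationIdxIn_eq_ramificationIdx w.inertiaFieldPrime.asIdeal w.asIdeal
    (w.asIdeal.inertia Gal(M/ℚ))] at h1
  have h2 : Ideal.inertia (w.asIdeal.inertia Gal(M/ℚ)) w.asIdeal = ⊤ :=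
    (Subgroup.eq_top_iff' _).2 fun σ x ↦ σ.2 x
  rw [← h1, h2, Subgroup.card_top]

theorem ramificationIdx_int :
    w.asIdeal.ramificationIdx ℤ = Nat.card (w.asIdeal.inertia Gal(M/ℚ)) := by
  have : NeZero (w.asIdeal.under ℤ) := ⟨mt Ideal.eq_bot_of_comap_eq_bot w.ne_bot⟩
  have := Ideal.card_inertia_eq_ramificationIdxIn (G := Gal(M/ℚ)) (w.asIdeal.under ℤ) w.asIdeal
  rw [this, Ideal.ramificationIdxIn_eq_ramificationIdx (w.asIdeal.under ℤ) w.asIdeal Gal(M/ℚ)]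

theorem valuation_algebraMap_inertiaField (x : w.inertiaField) :
    w.valuation M (x : M) = w.inertiaFieldPrime.valuation w.inertiaField x ^
      Nat.card (w.asIdeal.inertia Gal(M/ℚ)) := by
  rw [← ramificationIdx_inertiaField, ← Ideal.ramificationIdx'_eq_ramificationIdx
    w.inertiaFieldPrime.asIdeal w.asIdeal w.inertiaFieldPrime.ne_bot, valuation_liesOver M]
  rfl

theorem isTotallyRamified :
    IsTotallyRamified (w.valuation M) (w.asIdeal.inertia Gal(M/ℚ)) where
  map_apply σ hσ x := w.valuation_apply_of_mem_inertia hσ x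
  map_apply_sub_lt σ hσ x hx := w.valuation_apply_sub_lt_of_mem_inertia hσ x hx
  exists_eq_exp x hx0 hx := by
    have h1 := w.valuation_algebraMap_inertiaField ⟨x, fun σ ↦ hx σ.1 σ.2⟩
    have h2 : w.inertiaFieldPrime.valuation w.inertiaField ⟨x, fun σ ↦ hx σ.1 σ.2⟩ ≠ 0 := by
      rw [Valuation.ne_zero_iff]
      exact fun h0 ↦ hx0 (congrArg Subtype.val h0)
    refine ⟨log (w.inertiaFieldPrime.valuation w.inertiaField ⟨x, fun σ ↦ hx σ.1 σ.2⟩), ?_⟩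
    rw [mul_comm, ← nsmul_eq_mul, exp_nsmul, exp_log h2]
    exact h1

theorem ramificationIdx_inertiaFieldPrime :
    w.inertiaFieldPrime.asIdeal.ramificationIdx ℤ = 1 := by
  have h1 := Ideal.ramificationIdx_tower (R := ℤ) w.inertiaFieldPrime.asIdeal w.asIdeal
  rw [ramificationIdx_int, ramificationIdx_inertiaField] at h1
  exact (Nat.eq_of_mul_eq_mul_right (Nat.card_pos (α := w.asIdeal.inertia Gal(M/ℚ)))
    ((one_mul _).trans h1)).symm

theorem not_dvd_differentIdeal_inertiaField :
    ¬ w.inertiaFieldPrime.asIdeal ∣ differentIdeal ℤ (𝓞 w.inertiaField) := by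
  have : NeZero (w.inertiaFieldPrime.asIdeal.under ℤ) :=
    ⟨mt Ideal.eq_bot_of_comap_eq_bot w.inertiaFieldPrime.ne_bot⟩
  rw [not_dvd_differentIdeal_iff, ← Ideal.ramificationIdx_eq_one_iff]
  exact w.ramificationIdx_inertiaFieldPrime

theorem valuation_natCast_eq_exp {p : ℕ} (hp : p.Prime) (hpw : w.valuation M p < 1) :
    w.valuation M p = exp (-(Nat.card (w.asIdeal.inertia Gal(M/ℚ)) : ℤ)) := by
  have hpM : (p : 𝓞 M) ∈ w.asIdeal := by
    rw [← w.valuation_lt_one_iff_mem (K := M)]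
    simpa using hpw
  let v₀ : HeightOneSpectrum ℤ :=
    { asIdeal := w.asIdeal.under ℤ
      isPrime := inferInstance
      ne_bot := mt Ideal.eq_bot_of_comap_eq_bot w.ne_bot }
  have hlies : w.asIdeal.LiesOver v₀.asIdeal := ⟨rfl⟩
  have hpZ : Prime (p : ℤ) := Nat.prime_iff_prime_int.1 hp
  have h0 : v₀.asIdeal = Ideal.span {(p : ℤ)} := by
    have hmax : (Ideal.span {(p : ℤ)}).IsMaximal :=
      PrincipalIdealRing.isMaximal_of_irreducible hpZ.irreducible
    refine (hmax.eq_of_le v₀.isPrime.ne_top ?_).symm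
    rw [Ideal.span_singleton_le_iff_mem]
    change algebraMap ℤ (𝓞 M) p ∈ w.asIdeal
    simpa using hpM
  have h1 := v₀.intValuation_liesOver w (p : ℤ)
  rw [Ideal.ramificationIdx'_eq_ramificationIdx _ _ v₀.ne_bot, ramificationIdx_int,
    v₀.intValuation_singleton hpZ.ne_zero h0, ← exp_nsmul] at h1
  have h2 : w.valuation M p = w.intValuation (algebraMap ℤ (𝓞 M) p) := by
    rw [← w.valuation_of_algebraMap (K := M)]
    simp
  rw [h2, ← h1]
  simp

open Classical in
theorem map_minpoly_inertiaField {π : M} (hπ : w.valuation M π = exp (-1)) :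
    (minpoly w.inertiaField π).map (algebraMap w.inertiaField M) =
      ∏ σ : w.asIdeal.inertia Gal(M/ℚ), (X - C (σ.1 π)) := by
  have hI := w.isTotallyRamified
  have hint : IsIntegral w.inertiaField π := Algebra.IsIntegral.isIntegral π
  refine eq_of_monic_of_dvd_of_natDegree_le ?_ ((minpoly.monic hint).map (algebraMap w.inertiaField M))
    ?_ ?_
  · exact monic_prod_of_monic _ _ fun σ _ ↦ monic_X_sub_C _
  · refine Finset.prod_dvd_of_isRelPrime ?_ ?_
    · intro τ _ τ' _ hne
      rw [Function.onFun]
      refine ((prime_X_sub_C _).irreducible.isRelPrime_iff_not_dvd).2 ?_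
      rw [dvd_iff_isRoot]
      simp only [IsRoot.def, eval_sub, eval_X, eval_C, sub_eq_zero]
      intro heq
      have h2 : τ'.1⁻¹ * τ.1 = 1 := by
        refine hI.eq_one_of_apply_eq hπ (mul_mem (inv_mem τ'.2) τ.2) ?_
        rw [AlgEquiv.mul_apply, heq, ← AlgEquiv.mul_apply, inv_mul_cancel, AlgEquiv.one_apply]
      exact hne (Subtype.ext (inv_mul_eq_one.mp h2).symm)
    · intro τ _
      rw [dvd_iff_isRoot, IsRoot.def, eval_map_algebraMap]
      let τ' : M ≃ₐ[w.inertiaField] M := 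
        { τ.1 with commutes' := fun x ↦ x.2 τ }
      change aeval (τ' π) _ = 0
      rw [aeval_algEquiv, AlgHom.comp_apply, minpoly.aeval, map_zero]
  · rw [natDegree_map, natDegree_prod_of_monic _ _ fun σ _ ↦ monic_X_sub_C _]
    simp only [natDegree_X_sub_C, Finset.sum_const, Finset.card_univ, smul_eq_mul, mul_one]
    refine (minpoly.natDegree_le π).trans (le_of_eq ?_)
    rw [← Nat.card_eq_fintype_card]
    exact IntermediateField.finrank_fixedField_eq_card _

open Classical in
theorem pow_dvd_differentIdeal_iff {π : 𝓞 M} (hπ : w.valuation M (π : M) = exp (-1)) (n : ℕ) :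
    w.asIdeal ^ n ∣ differentIdeal ℤ (𝓞 M) ↔
      ∏ σ : w.asIdeal.inertia Gal(M/ℚ) with σ ≠ 1, w.valuation M (σ.1 (π : M) - π) ≤
        exp (-(n : ℤ)) := by
  have hI := w.isTotallyRamified
  set T := w.inertiaField
  have hprime : Prime w.asIdeal := w.prime
  have hadj : Algebra.adjoin T {algebraMap (𝓞 M) M π} = ⊤ := by
    rw [eq_top_iff]
    rintro x -
    obtain ⟨a, ha, rfl⟩ := hI.exists_eq_sum hπ x
    refine sum_mem fun i _ ↦ mul_mem ?_ (pow_mem (Algebra.self_mem_adjoin_singleton _ _) _)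
    exact (Algebra.adjoin T {algebraMap (𝓞 M) M π}).algebraMap_mem ⟨a i, fun σ ↦ ha i σ.1 σ.2⟩
  have hcond : ¬ w.asIdeal ∣ conductor (𝓞 T) π := by
    rw [Ideal.dvd_iff_le]
    have hex : ∀ z : 𝓞 M, ∃ s : w.inertiaFieldPrime.asIdeal.primeCompl,
        s.1 • z ∈ Algebra.adjoin (𝓞 T) {π} := by
      intro z
      obtain ⟨a, ha, hle, hz⟩ := hI.exists_eq_sum_of_le_one hπ (w.valuation_le_one z)
      replace hz : algebraMap (𝓞 M) M z = ∑ j, a j * algebraMap (𝓞 M) M π ^ (j : ℕ) := hz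
      let a' : Fin _ → T := fun i ↦ ⟨a i, fun σ ↦ ha i σ.1 σ.2⟩
      have hle' : ∀ i, w.inertiaFieldPrime.valuation T (a' i) ≤ 1 := by
        intro i
        have := w.valuation_algebraMap_inertiaField (a' i)
        rw [← pow_le_one_iff (Nat.card_pos (α := w.asIdeal.inertia Gal(M/ℚ))).ne']
        exact this ▸ hle i
      choose m d hmd using fun i ↦
        w.inertiaFieldPrime.exists_primeCompl_mul_eq_of_integer (a' i) (hle' i)
      have hmd' : ∀ i, (a i) * algebraMap (𝓞 T) M (d i) = algebraMap (𝓞 T) M (m i) := by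
        intro i
        have := congrArg (algebraMap T M) (hmd i)
        rwa [map_mul, ← IsScalarTower.algebraMap_apply, ← IsScalarTower.algebraMap_apply] at this
      refine ⟨∏ i, d i, ?_⟩
      have : (∏ i, d i).1 • z = ∑ i, ((∏ j ∈ Finset.univ.erase i, d j).1 * m i) • π ^ (i : ℕ) := by
        apply FaithfulSMul.algebraMap_injective (𝓞 M) M
        rw [Algebra.smul_def, map_mul, map_sum, hz, Finset.mul_sum]
        refine Finset.sum_congr rfl fun i _ ↦ ?_
        rw [Algebra.smul_def, map_mul, map_pow, ← IsScalarTower.algebraMap_apply,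
          ← IsScalarTower.algebraMap_apply, map_mul, ← hmd',
          ← Finset.prod_erase_mul Finset.univ d (Finset.mem_univ i), Submonoid.coe_mul, map_mul]
        ring
      rw [this]
      exact sum_mem fun i _ ↦ Subalgebra.smul_mem _
        (pow_mem (Algebra.self_mem_adjoin_singleton _ _) _) _
    obtain ⟨S, hS⟩ := (inferInstance : Module.Finite (𝓞 T) (𝓞 M)).fg_top
    choose s hs using hex
    intro hle
    set c : w.inertiaFieldPrime.asIdeal.primeCompl := ∏ z ∈ S, s z with hc
    have hmem : algebraMap (𝓞 T) (𝓞 M) c ∈ conductor (𝓞 T) π := by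
      intro b
      rw [← Algebra.smul_def]
      have hb : b ∈ Submodule.span (𝓞 T) (S : Set (𝓞 M)) := hS ▸ Submodule.mem_top
      induction hb using Submodule.span_induction with
      | mem z hz =>
        rw [hc, ← Finset.prod_erase_mul S s hz, Submonoid.coe_mul, mul_smul]
        exact Subalgebra.smul_mem _ (hs z) _
      | zero => simp
      | add x y _ _ hx hy => rw [smul_add]; exact add_mem hx hy
      | smul r x _ hx => rw [smul_comm]; exact Subalgebra.smul_mem _ hx _
    exact c.2 (hle hmem)
  have h1 : w.asIdeal ^ n ∣ differentIdeal ℤ (𝓞 M) ↔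
      w.asIdeal ^ n ∣ differentIdeal (𝓞 T) (𝓞 M) := by
    rw [differentIdeal_eq_differentIdeal_mul_differentIdeal ℤ (𝓞 T) (𝓞 M)]
    refine ⟨fun h ↦ hprime.pow_dvd_of_dvd_mul_right n ?_ h, fun h ↦ h.mul_right _⟩
    rw [Ideal.dvd_iff_le, Ideal.map_le_iff_le_comap]
    have := w.not_dvd_differentIdeal_inertiaField
    rwa [Ideal.dvd_iff_le] at this
  have h2 : w.asIdeal ^ n ∣ differentIdeal (𝓞 T) (𝓞 M) ↔
      w.asIdeal ^ n ∣ Ideal.span {aeval π (derivative (minpoly (𝓞 T) π))} := by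
    rw [← conductor_mul_differentIdeal (𝓞 T) T M π hadj]
    exact ⟨fun h ↦ h.mul_left _, fun h ↦ hprime.pow_dvd_of_dvd_mul_left n hcond h⟩
  have h3 : algebraMap (𝓞 M) M (aeval π (derivative (minpoly (𝓞 T) π))) =
      ∏ σ : w.asIdeal.inertia Gal(M/ℚ) with σ ≠ 1, ((π : M) - σ.1 (π : M)) := by
    have h4 : algebraMap (𝓞 M) M (aeval π (derivative (minpoly (𝓞 T) π))) =
        eval (π : M) (derivative ((minpoly T (π : M)).map (algebraMap T M))) := by
      rw [derivative_map, eval_map_algebraMap,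
        minpoly.isIntegrallyClosed_eq_field_fractions T M
          (Algebra.IsIntegral.isIntegral (R := 𝓞 T) π), derivative_map, aeval_map_algebraMap,
        aeval_algebraMap_apply]
    rw [h4, w.map_minpoly_inertiaField hπ, ← Finset.mul_prod_erase _ _ (Finset.mem_univ 1)]
    simp only [derivative_mul, derivative_sub, derivative_X, derivative_C, sub_zero, one_mul,
      eval_add, eval_mul, eval_sub, eval_X, eval_C, OneMemClass.coe_one, AlgEquiv.one_apply,
      sub_self, zero_mul, add_zero, eval_prod]
    refine Finset.prod_congr ?_ fun _ _ ↦ rfl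
    ext σ
    simp
  have h5 : w.valuation M (algebraMap (𝓞 M) M (aeval π (derivative (minpoly (𝓞 T) π)))) =
      w.intValuation (aeval π (derivative (minpoly (𝓞 T) π))) := w.valuation_of_algebraMap _
  rw [h1, h2, ← w.intValuation_le_pow_iff_dvd, ← h5, h3, map_prod]
  simp_rw [Valuation.map_sub_swap _ (π : M)]

end IsDedekindDomain.HeightOneSpectrum

namespace Valuation

open WithZero IsLocalRing

variable {M : Type*} [Field M] (v : Valuation M ℤᵐ⁰)

open Classical in
/-- The reduction of `x` modulo the maximal ideal of the valuation ring, with the value `0` if `x`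
is not in the valuation ring. -/
noncomputable def res (x : M) : ResidueField v.valuationSubring :=
  if h : v x ≤ 1 then residue v.valuationSubring ⟨x, h⟩ else 0

variable {v} {x y : M}

theorem res_of_le (h : v x ≤ 1) : v.res x = residue v.valuationSubring ⟨x, h⟩ := dif_pos h

theorem residue_eq_zero_iff_lt (a : v.valuationSubring) :
    residue v.valuationSubring a = 0 ↔ v (a : M) < 1 := by
  rw [residue_eq_zero_iff, v.isEquiv_valuation_valuationSubring.lt_one_iff_lt_one,
    ValuationSubring.valuation_lt_one_iff]

theorem res_eq_zero_iff (hx : v x ≤ 1) : v.res x = 0 ↔ v x < 1 := by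
  rw [res_of_le hx, residue_eq_zero_iff_lt]

theorem res_add (hx : v x ≤ 1) (hy : v y ≤ 1) : v.res (x + y) = v.res x + v.res y := by
  rw [res_of_le hx, res_of_le hy, res_of_le (v.map_add_le hx hy), ← map_add]
  rfl

theorem res_sub (hx : v x ≤ 1) (hy : v y ≤ 1) : v.res (x - y) = v.res x - v.res y := by
  rw [res_of_le hx, res_of_le hy, res_of_le (v.map_sub_le hx hy), ← RingHom.map_sub]
  rfl

theorem map_mul_le_one (hx : v x ≤ 1) (hy : v y ≤ 1) : v (x * y) ≤ 1 := by
  rw [map_mul]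
  exact mul_le_one' hx hy

theorem map_pow_le_one (hx : v x ≤ 1) (n : ℕ) : v (x ^ n) ≤ 1 := by
  rw [map_pow]
  exact pow_le_one' hx n

theorem res_pow (hx : v x ≤ 1) (n : ℕ) : v.res (x ^ n) = v.res x ^ n := by
  rw [res_of_le hx, res_of_le (map_pow_le_one hx n), ← map_pow]
  rfl

theorem res_one : v.res 1 = 1 := by
  rw [res_of_le (map_one v).le]
  exact map_one _

theorem map_intCast_le_one (n : ℤ) : v (n : M) ≤ 1 :=
  intCast_mem v.valuationSubring n

theorem map_natCast_le_one (n : ℕ) : v (n : M) ≤ 1 := by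
  simpa using map_intCast_le_one (v := v) n

theorem map_ofNat_le_one (n : ℕ) [n.AtLeastTwo] : v (ofNat(n) : M) ≤ 1 :=
  map_natCast_le_one n

theorem res_intCast (n : ℤ) : v.res (n : M) = n := by
  rw [res_of_le (map_intCast_le_one n)]
  exact map_intCast (residue v.valuationSubring) n

theorem res_eq_res_iff (hx : v x ≤ 1) (hy : v y ≤ 1) : v.res x = v.res y ↔ v (x - y) < 1 := by
  rw [← sub_eq_zero, ← res_sub hx hy, res_eq_zero_iff (v.map_sub_le hx hy)]

theorem le_exp_sub_one_of_lt {k : ℤ} {z : ℤᵐ⁰} (h : z < exp k) : z ≤ exp (k - 1) := by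
  rw [← lt_mul_exp_iff_le exp_ne_zero, ← exp_add]
  simpa using h

section Roots

variable {f : ℤ[X]} {n : ℕ} {r : Fin n → M}

theorem map_root_le_one (hf : f.Monic) {x : M} (hx : aeval x f = 0) : v x ≤ 1 := by
  have hint : IsIntegral v.valuationSubring x := by
    refine ⟨f.map (Int.castRingHom _), hf.map _, ?_⟩
    rw [eval₂_map]
    convert! hx using 1
  obtain ⟨y, rfl⟩ := IsIntegrallyClosed.isIntegral_iff.1 hint
  exact y.2

theorem map_aeval_le_one {x : M} (hx : v x ≤ 1) (g : ℤ[X]) : v (aeval x g) ≤ 1 := by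
  rw [aeval_eq_sum_range]
  refine v.map_sum_le fun i _ ↦ ?_
  rw [zsmul_eq_mul]
  exact map_mul_le_one (map_intCast_le_one _) (map_pow_le_one hx i)

theorem res_aeval {x : M} (hx : v x ≤ 1) (g : ℤ[X]) : v.res (aeval x g) = aeval (v.res x) g := by
  have : aeval x g = ((aeval (⟨x, hx⟩ : v.valuationSubring) g : v.valuationSubring) : M) :=
    (aeval_algebraMap_apply M (⟨x, hx⟩ : v.valuationSubring) g)
  rw [res_of_le (map_aeval_le_one hx g), res_of_le hx]
  have h2 := (aeval_algHom_apply (residue v.valuationSubring).toIntAlgHom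
    (⟨x, hx⟩ : v.valuationSubring) g)
  change residue _ _ = aeval ((residue v.valuationSubring).toIntAlgHom _) g
  exact (congrArg _ (Subtype.ext this)).trans h2.symm

variable (hr : f.map (Int.castRingHom M) = ∏ i, (X - C (r i)))
include hr

theorem aeval_eq_zero_of_eq_prod (i : Fin n) : aeval (r i) f = 0 := by
  rw [← eval_map_algebraMap, algebraMap_int_eq, hr, eval_prod]
  exact Finset.prod_eq_zero (Finset.mem_univ i) (by simp)

theorem exists_eq_of_aeval_eq_zero {x : M} (hx : aeval x f = 0) : ∃ i, x = r i := by
  rw [← eval_map_algebraMap, algebraMap_int_eq, hr, eval_prod, Finset.prod_eq_zero_iff] at hx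
  obtain ⟨i, -, hi⟩ := hx
  exact ⟨i, by simpa [sub_eq_zero] using hi⟩

theorem aeval_eq_prod (x : M) : aeval x f = ∏ i, (x - r i) := by
  rw [← eval_map_algebraMap, algebraMap_int_eq, hr, eval_prod]
  simp

theorem aeval_derivative_eq_prod (i : Fin n) :
    aeval (r i) (derivative f) = ∏ j ∈ Finset.univ.erase i, (r i - r j) := by
  rw [← eval_map_algebraMap, algebraMap_int_eq, ← derivative_map, hr,
    ← Finset.mul_prod_erase _ _ (Finset.mem_univ i)]
  simp [derivative_mul, eval_prod]

variable (hf : f.Monic)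
include hf

theorem map_root_le_one' (i : Fin n) : v (r i) ≤ 1 :=
  map_root_le_one hf (aeval_eq_zero_of_eq_prod hr i)

theorem map_res_eq_prod :
    f.map (Int.castRingHom (ResidueField v.valuationSubring)) = ∏ i, (X - C (v.res (r i))) := by
  have h1 : f.map (Int.castRingHom v.valuationSubring) =
      ∏ i, (X - C (⟨r i, map_root_le_one' hr hf i⟩ : v.valuationSubring)) := by
    apply map_injective v.valuationSubring.subtype Subtype.val_injective
    rw [map_map, Polynomial.map_prod]
    convert hr using 1
    · congr 1
    · simp
  have h2 := congrArg (Polynomial.map (residue v.valuationSubring)) h1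
  rw [map_map, Polynomial.map_prod] at h2
  convert h2 using 1
  · congr 1
  · refine Finset.prod_congr rfl fun i _ ↦ ?_
    simp [res_of_le (map_root_le_one' hr hf i)]

theorem map_aeval_derivative_lt_one {i j : Fin n} (hij : i ≠ j) (hlt : v (r i - r j) < 1) :
    v (aeval (r i) (derivative f)) < 1 := by
  rw [aeval_derivative_eq_prod hr, ← Finset.mul_prod_erase _ _
    (Finset.mem_erase.2 ⟨hij.symm, Finset.mem_univ j⟩), map_mul, map_prod]
  refine mul_lt_one_of_nonneg_of_lt_one_left zero_le hlt ?_
  exact Finset.prod_le_one' fun l _ ↦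
    v.map_sub_le (map_root_le_one' hr hf i) (map_root_le_one' hr hf l)

theorem map_aeval_derivative_derivative_lt_one {i j l : Fin n} (hij : i ≠ j) (hil : i ≠ l)
    (hjl : j ≠ l) (hlt : v (r i - r j) < 1) (hlt' : v (r i - r l) < 1) :
    v (aeval (r i) (derivative (derivative f))) < 1 := by
  have hle := map_root_le_one' (v := v) hr hf
  rw [← res_eq_zero_iff (map_aeval_le_one (hle i) _), res_aeval (hle i)]
  rw [← res_eq_res_iff (hle i) (hle _)] at hlt hlt'
  have hcast : algebraMap ℤ (ResidueField v.valuationSubring) = Int.castRingHom _ :=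
    RingHom.ext_int _ _
  rw [← eval_map_algebraMap, hcast, ← derivative_map, ← derivative_map,
    map_res_eq_prod hr hf, ← Finset.mul_prod_erase _ _ (Finset.mem_univ i),
    ← Finset.mul_prod_erase _ _ (Finset.mem_erase.2 ⟨hij.symm, Finset.mem_univ j⟩),
    ← Finset.mul_prod_erase _ _ (Finset.mem_erase.2 ⟨hjl.symm,
      Finset.mem_erase.2 ⟨hil.symm, Finset.mem_univ l⟩⟩), ← hlt, ← hlt']
  simp [derivative_mul]

end Roots

end Valuation

/-- The quintic `f₁` with integral coefficients. -/
noncomputable def quintic : ℤ[X] := X ^ 5 - X ^ 4 - X ^ 3 + 3 * X ^ 2 - X - 19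

/-- The sextic `f₂` with integral coefficients. -/
noncomputable def sextic : ℤ[X] :=
  X ^ 6 - 2 * X ^ 5 + 4 * X ^ 4 - 8 * X ^ 3 + 2 * X ^ 2 + 24 * X - 20

theorem monic_quintic : quintic.Monic := by
  unfold quintic; monicity!

theorem monic_sextic : sextic.Monic := by
  unfold sextic; monicity!

section aeval

variable {R : Type*} [CommRing R] [Algebra ℤ R] (x : R)

theorem aeval_quintic : aeval x quintic = x ^ 5 - x ^ 4 - x ^ 3 + 3 * x ^ 2 - x - 19 := by
  simp [quintic, map_ofNat]

theorem aeval_derivative_quintic :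
    aeval x (derivative quintic) = 5 * x ^ 4 - 4 * x ^ 3 - 3 * x ^ 2 + 6 * x - 1 := by
  simp [quintic, map_ofNat]
  ring

theorem aeval_derivative_derivative_quintic :
    aeval x (derivative (derivative quintic)) = 20 * x ^ 3 - 12 * x ^ 2 - 6 * x + 6 := by
  simp [quintic, map_ofNat]
  ring

theorem aeval_sextic : aeval x sextic =
    x ^ 6 - 2 * x ^ 5 + 4 * x ^ 4 - 8 * x ^ 3 + 2 * x ^ 2 + 24 * x - 20 := by
  simp [sextic, map_ofNat]

theorem aeval_derivative_sextic : aeval x (derivative sextic) =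
    6 * x ^ 5 - 10 * x ^ 4 + 16 * x ^ 3 - 24 * x ^ 2 + 4 * x + 24 := by
  simp [sextic, map_ofNat]
  ring

theorem aeval_derivative_derivative_sextic : aeval x (derivative (derivative sextic)) =
    30 * x ^ 4 - 40 * x ^ 3 + 48 * x ^ 2 - 48 * x + 4 := by
  simp [sextic, map_ofNat]
  ring

variable {x}

theorem mul_aeval_derivative_quintic (hx : aeval x quintic = 0) :
    (-22 * x ^ 4 + 69 * x ^ 3 - 26 * x ^ 2 + 586 * x - 37) * aeval x (derivative quintic) =
      61236 := by
  rw [aeval_quintic] at hx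
  rw [aeval_derivative_quintic]
  linear_combination -(110 * x ^ 3 - 323 * x ^ 2 + 127 * x - 3221) * hx

theorem mul_aeval_derivative_sextic (hx : aeval x sextic = 0) :
    (101 * x ^ 5 - 96 * x ^ 4 + 302 * x ^ 3 - 516 * x ^ 2 - 362 * x + 1832) *
      aeval x (derivative sextic) = 21168 := by
  rw [aeval_sextic] at hx
  rw [aeval_derivative_sextic]
  linear_combination -(-606 * x ^ 4 + 374 * x ^ 3 - 1216 * x ^ 2 + 1300 * x + 1140) * hx

end aeval

namespace Valuation

open WithZero

variable {M : Type*} [Field M] {v : Valuation M ℤᵐ⁰}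

theorem map_natCast_eq_one_of_coprime {p n : ℕ} (hp : v (p : M) < 1) (h : p.Coprime n) :
    v (n : M) = 1 := by
  refine le_antisymm (map_natCast_le_one n) (not_lt.1 fun hn ↦ ?_)
  obtain ⟨a, b, hab⟩ := Nat.isCoprime_iff_coprime.2 h
  have h1 : (1 : M) = a * p + b * n := by
    have := congrArg (Int.cast (R := M)) hab
    push_cast at this
    exact this.symm
  have h2 : v (1 : M) < 1 := by
    rw [h1]
    refine v.map_add_lt ?_ ?_
    · rw [map_mul]
      exact mul_lt_one_of_nonneg_of_lt_one_right (map_intCast_le_one a) zero_le hp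
    · rw [map_mul]
      exact mul_lt_one_of_nonneg_of_lt_one_right (map_intCast_le_one b) zero_le hn
  simp at h2

end Valuation

namespace IsTotallyRamified

open WithZero Valuation

variable {F M : Type*} [Field F] [Field M] [Algebra F M] {v : Valuation M ℤᵐ⁰}
  {I : Subgroup Gal(M/F)} {π : M}

theorem dvd_mul_ncard_orbit [FiniteDimensional F M] (h : IsTotallyRamified v I) {y : M} {m : ℤ}
    (hy : v y = exp (-m)) : (Nat.card I : ℤ) ∣ m * (MulAction.orbit I y).ncard := by
  classical
  have hfin : (MulAction.orbit I y).Finite :=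
    Set.finite_range fun σ : I ↦ σ • y
  have hmem : ∀ x ∈ hfin.toFinset, v x = exp (-m) := by
    intro x hx
    obtain ⟨σ, rfl⟩ := hfin.mem_toFinset.1 hx
    rw [← hy]
    exact h.map_apply σ.1 σ.2 y
  obtain ⟨k, hk⟩ := h.exists_eq_exp (∏ x ∈ hfin.toFinset, x)
    (Finset.prod_ne_zero_iff.2 fun x hx ↦ ne_zero_of_map_eq_exp (hmem x hx)) (by
      intro σ hσ
      rw [map_prod]
      refine Finset.prod_nbij σ ?_ σ.injective.injOn ?_ fun _ _ ↦ rfl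
      · intro x hx
        rw [hfin.mem_toFinset] at *
        exact (MulAction.mem_orbit_of_mem_orbit (⟨σ, hσ⟩ : I) hx)
      · intro x hx
        rw [Finset.mem_coe, hfin.mem_toFinset] at hx
        refine ⟨σ⁻¹ x, ?_, ?_⟩
        · rw [Finset.mem_coe, hfin.mem_toFinset]
          exact (MulAction.mem_orbit_of_mem_orbit (⟨σ, hσ⟩⁻¹ : I) hx)
        · exact σ.apply_symm_apply x)
  rw [map_prod, Finset.prod_congr rfl hmem, Finset.prod_const, ← exp_nsmul, exp_inj] at hk
  rw [Set.ncard_eq_toFinset_card _ hfin]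
  refine ⟨-k, ?_⟩
  simp only [nsmul_eq_mul] at hk
  linear_combination -hk

open Classical in
theorem prod_eq_of_tame [FiniteDimensional F M]
    (htame : ∀ σ ∈ I, σ ≠ 1 → v (σ π - π) = exp (-1)) :
    ∏ σ : I with σ ≠ 1, v (σ.1 π - π) = exp (-(Nat.card I - 1 : ℤ)) := by
  rw [Finset.prod_congr rfl (g := fun _ ↦ (exp (-1) : ℤᵐ⁰)) fun σ hσ ↦ htame σ.1 σ.2 (by
    simpa using hσ), Finset.prod_const, ← exp_nsmul, Finset.filter_ne' Finset.univ (1 : I),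
    Finset.card_erase_of_mem (Finset.mem_univ _), Finset.card_univ, ← Nat.card_eq_fintype_card]
  have : 0 < Nat.card I := Nat.card_pos
  congr 1
  rw [nsmul_eq_mul]
  push_cast [show 1 ≤ Nat.card I by omega]
  ring

theorem apply_eq_of_sq_eq (h : IsTotallyRamified v I) (h2 : v 2 = 1) {x : M} {n : ℤ}
    (hx : x ^ 2 = n) (hn : v (n : M) = 1) {σ : Gal(M/F)} (hσ : σ ∈ I) : σ x = x := by
  have h1 : (σ x - x) * (σ x + x) = 0 := by
    have : σ x ^ 2 = n := by rw [← map_pow, hx, map_intCast]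
    linear_combination this - hx
  rcases mul_eq_zero.1 h1 with h1 | h1
  · exact sub_eq_zero.1 h1
  · have hvx : v x = 1 := by
      have : v x ^ 2 = 1 := by rw [← map_pow, hx, hn]
      exact (pow_eq_one_iff_of_nonneg zero_le two_ne_zero).1 this
    have h3 := h.map_apply_sub_lt σ hσ x hvx.le
    rw [eq_neg_of_add_eq_zero_left h1, show -x - x = -(2 * x) by ring, Valuation.map_neg, map_mul, h2, hvx]
      at h3
    simp at h3

end IsTotallyRamified

/-- `α` and `β` are the roots of `f₁` and `f₂` in `M`, and an automorphism of `M` over `F` is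
determined by its action on these roots and on the square roots of `-3` in `M`. -/
structure IsRootData (F : Type*) {M : Type*} [Field F] [Field M] [Algebra F M] (α : Fin 5 → M)
    (β : Fin 6 → M) : Prop where
  map_quintic : quintic.map (Int.castRingHom M) = ∏ i, (X - C (α i))
  map_sextic : sextic.map (Int.castRingHom M) = ∏ i, (X - C (β i))
  eq_one : ∀ σ : Gal(M/F), (∀ i, σ (α i) = α i) → (∀ i, σ (β i) = β i) →
    (∀ x : M, x ^ 2 = -3 → σ x = x) → σ = 1

section perm

variable {F M : Type*} [Field F] [Field M] [Algebra F M] {f : ℤ[X]} {n : ℕ} {r : Fin n → M}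

theorem exists_apply_root_eq (hr : f.map (Int.castRingHom M) = ∏ i, (X - C (r i))) (σ : Gal(M/F))
    (i : Fin n) : ∃ j, σ (r i) = r j := by
  refine Valuation.exists_eq_of_aeval_eq_zero hr ?_
  have := aeval_algHom_apply (σ.toRingEquiv.toRingHom.toIntAlgHom) (r i) f
  rw [Valuation.aeval_eq_zero_of_eq_prod hr, map_zero] at this
  exact this

open Classical in
/-- The permutation of the roots `r i` induced by an automorphism. -/
noncomputable def rootPerm (hr : f.map (Int.castRingHom M) = ∏ i, (X - C (r i)))
    (hinj : Function.Injective r) : Gal(M/F) →* Equiv.Perm (Fin n) :=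
  MonoidHom.toHomPerm
    { toFun σ i := (exists_apply_root_eq hr σ i).choose
      map_one' := funext fun i ↦ hinj (exists_apply_root_eq hr (1 : Gal(M/F)) i).choose_spec.symm
      map_mul' σ τ := funext fun i ↦ hinj <| by
        rw [← (exists_apply_root_eq hr (σ * τ) i).choose_spec, AlgEquiv.mul_apply,
          (exists_apply_root_eq hr τ i).choose_spec]
        exact (exists_apply_root_eq hr σ _).choose_spec }

theorem apply_rootPerm (hr : f.map (Int.castRingHom M) = ∏ i, (X - C (r i)))
    (hinj : Function.Injective r) (σ : Gal(M/F)) (i : Fin n) :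
    r (rootPerm hr hinj σ i) = σ (r i) :=
  (exists_apply_root_eq hr σ i).choose_spec.symm

theorem apply_eq_of_rootPerm_eq_one (hr : f.map (Int.castRingHom M) = ∏ i, (X - C (r i)))
    (hinj : Function.Injective r) {σ : Gal(M/F)} (h : rootPerm hr hinj σ = 1) (i : Fin n) :
    σ (r i) = r i := by
  rw [← apply_rootPerm hr hinj, h, Equiv.Perm.one_apply]

theorem injective_of_aeval_derivative_ne_zero
    (hr : f.map (Int.castRingHom M) = ∏ i, (X - C (r i)))
    (h : ∀ i, aeval (r i) (derivative f) ≠ 0) : Function.Injective r := by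
  intro i j hij
  by_contra hne
  refine h i ?_
  rw [Valuation.aeval_derivative_eq_prod hr]
  exact Finset.prod_eq_zero (Finset.mem_erase.2 ⟨Ne.symm hne, Finset.mem_univ j⟩) (by simp [hij])

end perm

namespace IsRootData

open WithZero Valuation

variable {F M : Type*} [Field F] [Field M] [Algebra F M] {α : Fin 5 → M} {β : Fin 6 → M}

section

variable (H : IsRootData F α β)
include H

theorem aeval_α (i : Fin 5) : aeval (α i) quintic = 0 := aeval_eq_zero_of_eq_prod H.map_quintic i

theorem aeval_β (i : Fin 6) : aeval (β i) sextic = 0 := aeval_eq_zero_of_eq_prod H.map_sextic i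

theorem map_α_le_one (v : Valuation M ℤᵐ⁰) (i : Fin 5) : v (α i) ≤ 1 :=
  map_root_le_one monic_quintic (H.aeval_α i)

theorem map_β_le_one (v : Valuation M ℤᵐ⁰) (i : Fin 6) : v (β i) ≤ 1 :=
  map_root_le_one monic_sextic (H.aeval_β i)

theorem injective_α [CharZero M] : Function.Injective α :=
  injective_of_aeval_derivative_ne_zero H.map_quintic fun i h0 ↦ by
    have := mul_aeval_derivative_quintic (H.aeval_α i)
    rw [h0, mul_zero] at this
    norm_num at this

theorem injective_β [CharZero M] : Function.Injective β :=
  injective_of_aeval_derivative_ne_zero H.map_sextic fun i h0 ↦ by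
    have := mul_aeval_derivative_sextic (H.aeval_β i)
    rw [h0, mul_zero] at this
    norm_num at this

theorem map_aeval_derivative_quintic_eq_one {v : Valuation M ℤᵐ⁰} (h : v 61236 = 1) (i : Fin 5) :
    v (aeval (α i) (derivative quintic)) = 1 := by
  have h1 := congrArg v (mul_aeval_derivative_quintic (H.aeval_α i))
  have h2 : v (-22 * (α i) ^ 4 + 69 * (α i) ^ 3 - 26 * (α i) ^ 2 + 586 * (α i) - 37) ≤ 1 := by
    convert map_aeval_le_one (H.map_α_le_one v i) (-22 * X ^ 4 + 69 * X ^ 3 - 26 * X ^ 2 + 586 * X - 37 : ℤ[X])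
    simp [map_ofNat]
  rw [map_mul, h] at h1
  exact le_antisymm (map_aeval_le_one (H.map_α_le_one v i) _)
    (h1.ge.trans (mul_le_of_le_one_left' h2))

theorem map_aeval_derivative_sextic_eq_one {v : Valuation M ℤᵐ⁰} (h : v 21168 = 1) (i : Fin 6) :
    v (aeval (β i) (derivative sextic)) = 1 := by
  have h1 := congrArg v (mul_aeval_derivative_sextic (H.aeval_β i))
  have h2 : v (101 * (β i) ^ 5 - 96 * (β i) ^ 4 + 302 * (β i) ^ 3 - 516 * (β i) ^ 2 -
      362 * (β i) + 1832) ≤ 1 := by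
    convert map_aeval_le_one (H.map_β_le_one v i) (101 * X ^ 5 - 96 * X ^ 4 + 302 * X ^ 3 - 516 * X ^ 2 - 362 * X + 1832 : ℤ[X])
    simp [map_ofNat]
  rw [map_mul, h] at h1
  exact le_antisymm (map_aeval_le_one (H.map_β_le_one v i) _)
    (h1.ge.trans (mul_le_of_le_one_left' h2))

end

variable {v : Valuation M ℤᵐ⁰} {I : Subgroup Gal(M/F)} {π : M}

theorem eq_one_of_unramified (H : IsRootData F α β) (h : IsTotallyRamified v I)
    (h2 : v 2 = 1) (h3 : v 3 = 1) (h7 : v 7 = 1) {σ : Gal(M/F)} (hσ : σ ∈ I) : σ = 1 := by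
  have e1 : v 61236 = 1 := by
    rw [show (61236 : M) = 2 ^ 2 * 3 ^ 7 * 7 by norm_num]; simp [h2, h3, h7]
  have e2 : v 21168 = 1 := by
    rw [show (21168 : M) = 2 ^ 4 * 3 ^ 3 * 7 ^ 2 by norm_num]; simp [h2, h3, h7]
  refine H.eq_one σ (fun i ↦ ?_) (fun i ↦ ?_) (fun x hx ↦ ?_)
  · by_contra hne
    obtain ⟨j, hj⟩ := exists_apply_root_eq H.map_quintic σ i
    have hlt := h.map_apply_sub_lt σ hσ _ (H.map_α_le_one v i)
    rw [hj, v.map_sub_swap] at hlt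
    have := map_aeval_derivative_lt_one H.map_quintic monic_quintic (i := i) (j := j)
      (by rintro rfl; exact hne hj) hlt
    rw [H.map_aeval_derivative_quintic_eq_one e1] at this
    exact lt_irrefl _ this
  · by_contra hne
    obtain ⟨j, hj⟩ := exists_apply_root_eq H.map_sextic σ i
    have hlt := h.map_apply_sub_lt σ hσ _ (H.map_β_le_one v i)
    rw [hj, v.map_sub_swap] at hlt
    have := map_aeval_derivative_lt_one H.map_sextic monic_sextic (i := i) (j := j)
      (by rintro rfl; exact hne hj) hlt
    rw [H.map_aeval_derivative_sextic_eq_one e2] at this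
    exact lt_irrefl _ this
  · exact h.apply_eq_of_sq_eq h2 (n := -3) (by rw [hx]; norm_num) (by simpa using h3) hσ

end IsRootData

namespace IsRootData
open WithZero Valuation

variable {F M : Type*} [Field F] [Field M] [Algebra F M] {α : Fin 5 → M} {β : Fin 6 → M}

theorem sum_pow_α (H : IsRootData F α β) (k : ℕ) :
    ∑ i, α i ^ (k + 5) = ∑ i, α i ^ (k + 4) + ∑ i, α i ^ (k + 3) - 3 * ∑ i, α i ^ (k + 2) +
      ∑ i, α i ^ (k + 1) + 19 * ∑ i, α i ^ k := by
  rw [Finset.mul_sum, Finset.mul_sum, ← Finset.sum_add_distrib, ← Finset.sum_sub_distrib,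
    ← Finset.sum_add_distrib, ← Finset.sum_add_distrib]
  refine Finset.sum_congr rfl fun i _ ↦ ?_
  have := H.aeval_α i
  rw [aeval_quintic] at this
  linear_combination α i ^ k * this

theorem elementary_α (H : IsRootData F α β) :
    α 0 + α 1 + α 2 + α 3 + α 4 = 1 ∧
    α 0 * α 1 + α 0 * α 2 + α 0 * α 3 + α 0 * α 4 + α 1 * α 2 + α 1 * α 3 + α 1 * α 4 +
      α 2 * α 3 + α 2 * α 4 + α 3 * α 4 = -1 ∧
    α 0 * α 1 * α 2 + α 0 * α 1 * α 3 + α 0 * α 1 * α 4 + α 0 * α 2 * α 3 + α 0 * α 2 * α 4 +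
      α 0 * α 3 * α 4 + α 1 * α 2 * α 3 + α 1 * α 2 * α 4 + α 1 * α 3 * α 4 +
      α 2 * α 3 * α 4 = -3 ∧
    α 0 * α 1 * α 2 * α 3 + α 0 * α 1 * α 2 * α 4 + α 0 * α 1 * α 3 * α 4 +
      α 0 * α 2 * α 3 * α 4 + α 1 * α 2 * α 3 * α 4 = -1 := by
  have h := H.map_quintic
  have key : ∀ k, (quintic.map (Int.castRingHom M)).coeff k = _ := fun k ↦ congrArg (coeff · k) h
  rw [Fin.prod_univ_five] at h
  have e : (X - C (α 0)) * (X - C (α 1)) * (X - C (α 2)) * (X - C (α 3)) * (X - C (α 4)) =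
    X ^ 5 - C (α 0 + α 1 + α 2 + α 3 + α 4) * X ^ 4 +
    C (α 0 * α 1 + α 0 * α 2 + α 0 * α 3 + α 0 * α 4 + α 1 * α 2 + α 1 * α 3 + α 1 * α 4 +
      α 2 * α 3 + α 2 * α 4 + α 3 * α 4) * X ^ 3 -
    C (α 0 * α 1 * α 2 + α 0 * α 1 * α 3 + α 0 * α 1 * α 4 + α 0 * α 2 * α 3 + α 0 * α 2 * α 4 +
      α 0 * α 3 * α 4 + α 1 * α 2 * α 3 + α 1 * α 2 * α 4 + α 1 * α 3 * α 4 +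
      α 2 * α 3 * α 4) * X ^ 2 +
    C (α 0 * α 1 * α 2 * α 3 + α 0 * α 1 * α 2 * α 4 + α 0 * α 1 * α 3 * α 4 +
      α 0 * α 2 * α 3 * α 4 + α 1 * α 2 * α 3 * α 4) * X ^ 1 -
    C (α 0 * α 1 * α 2 * α 3 * α 4) * X ^ 0 := by
    simp only [map_add, map_mul]
    ring
  rw [e] at h
  have h4 := congrArg (coeff · 4) h
  have h3 := congrArg (coeff · 3) h
  have h2 := congrArg (coeff · 2) h
  have h1 := congrArg (coeff · 1) h
  simp only [coeff_map, quintic, coeff_add, coeff_sub, coeff_C_mul_X_pow, coeff_X_pow, coeff_X,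
    coeff_ofNat_mul, coeff_ofNat_succ] at h4 h3 h2 h1
  norm_num at h4 h3 h2 h1
  refine ⟨?_, ?_, ?_, ?_⟩
  · linear_combination h4
  · linear_combination -h3
  · linear_combination h2
  · linear_combination -h1

theorem sq_prod_sub_α (H : IsRootData F α β) :
    (∏ i, ∏ j > i, (α j - α i)) ^ 2 = 336063168 := by
  obtain ⟨e1, e2, e3, e4⟩ := H.elementary_α
  have p0 : ∑ i, α i ^ 0 = 5 := by simp
  have p1 : ∑ i, α i ^ 1 = 1 := by
    rw [Fin.sum_univ_five]; linear_combination e1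
  have p2 : ∑ i, α i ^ 2 = 3 := by
    rw [Fin.sum_univ_five] at *
    linear_combination (α 0 + α 1 + α 2 + α 3 + α 4) * e1 + p1 - 2 * e2
  have p3 : ∑ i, α i ^ 3 = -5 := by
    rw [Fin.sum_univ_five] at *
    linear_combination (α 0 ^ 2 + α 1 ^ 2 + α 2 ^ 2 + α 3 ^ 2 + α 4 ^ 2) * e1 + p2 -
      (α 0 + α 1 + α 2 + α 3 + α 4) * e2 + p1 + 3 * e3
  have p4 : ∑ i, α i ^ 4 = -1 := by
    rw [Fin.sum_univ_five] at *
    linear_combination (α 0 ^ 3 + α 1 ^ 3 + α 2 ^ 3 + α 3 ^ 3 + α 4 ^ 3) * e1 + p3 -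
      (α 0 ^ 2 + α 1 ^ 2 + α 2 ^ 2 + α 3 ^ 2 + α 4 ^ 2) * e2 + p2 +
      (α 0 + α 1 + α 2 + α 3 + α 4) * e3 - 3 * p1 - 4 * e4
  have p5 : ∑ i, α i ^ 5 = 81 := by rw [H.sum_pow_α 0, p4, p3, p2, p1, p0]; norm_num
  have p6 : ∑ i, α i ^ 6 = 117 := by rw [H.sum_pow_α 1, p5, p4, p3, p2, p1]; norm_num
  have p7 : ∑ i, α i ^ 7 = 253 := by rw [H.sum_pow_α 2, p6, p5, p4, p3, p2]; norm_num
  have p8 : ∑ i, α i ^ 8 = 31 := by rw [H.sum_pow_α 3, p7, p6, p5, p4, p3]; norm_num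
  have hmat : (Matrix.vandermonde α).transpose * Matrix.vandermonde α =
      ((!![5, 1, 3, -5, -1; 1, 3, -5, -1, 81; 3, -5, -1, 81, 117; -5, -1, 81, 117, 253;
        -1, 81, 117, 253, 31] : Matrix (Fin 5) (Fin 5) ℤ)).map (Int.castRingHom M) := by
    ext a b
    rw [Matrix.mul_apply]
    simp only [Matrix.transpose_apply, Matrix.vandermonde_apply, ← pow_add]
    fin_cases a <;> fin_cases b <;> simp_all
  rw [← Matrix.det_vandermonde, sq]
  nth_rewrite 1 [← Matrix.det_transpose]
  rw [← Matrix.det_mul, hmat, ← RingHom.mapMatrix_apply, ← RingHom.map_det]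
  have : Matrix.det (!![5, 1, 3, -5, -1; 1, 3, -5, -1, 81; 3, -5, -1, 81, 117;
      -5, -1, 81, 117, 253; -1, 81, 117, 253, 31] : Matrix (Fin 5) (Fin 5) ℤ) = 336063168 := by
    simp [Matrix.det_succ_row_zero, Fin.sum_univ_succ, Fin.succAbove]
  rw [this]
  simp

variable {v : Valuation M ℤᵐ⁰} {I : Subgroup Gal(M/F)} {π : M}

theorem not_aeval_derivative_quintic_lt_one (H : IsRootData F α β) (h3 : v 3 < 1) (i : Fin 5) :
    ¬(v (aeval (α i) (derivative quintic)) < 1 ∧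
      v (aeval (α i) (derivative (derivative quintic))) < 1) := by
  have hle := H.map_α_le_one v i
  rintro ⟨h', h''⟩
  have h3 : v.res 3 = 0 := (res_eq_zero_iff h3.le).2 h3
  rw [show (3 : M) = ((3 : ℤ) : M) by norm_num, res_intCast] at h3
  rw [← res_eq_zero_iff (map_aeval_le_one hle _), res_aeval hle] at h' h''
  rw [aeval_derivative_quintic] at h'
  rw [aeval_derivative_derivative_quintic] at h''
  push_cast at h3
  have : (1 : IsLocalRing.ResidueField v.valuationSubring) = 0 := by
    generalize v.res (α i) = x at *
    linear_combination -h' + (x + 1) * h'' - (5 * x ^ 4 + 4 * x ^ 3 - 5 * x ^ 2 - 2 * x + 2) * h3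
  exact one_ne_zero this

theorem not_aeval_derivative_sextic_lt_one (H : IsRootData F α β) (h3 : v 3 < 1) (i : Fin 6) :
    ¬(v (aeval (β i) (derivative sextic)) < 1 ∧
      v (aeval (β i) (derivative (derivative sextic))) < 1) := by
  have hle := H.map_β_le_one v i
  rintro ⟨h', h''⟩
  have h3 : v.res 3 = 0 := (res_eq_zero_iff h3.le).2 h3
  rw [show (3 : M) = ((3 : ℤ) : M) by norm_num, res_intCast] at h3
  rw [← res_eq_zero_iff (map_aeval_le_one hle _), res_aeval hle] at h' h''
  rw [aeval_derivative_sextic] at h'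
  rw [aeval_derivative_derivative_sextic] at h''
  push_cast at h3
  have : (1 : IsLocalRing.ResidueField v.valuationSubring) = 0 := by
    generalize v.res (β i) = x at *
    linear_combination h'' - 2 * (h' - x * h'') +
      (15 + 16 * x - 8 * x ^ 3 + 10 * x ^ 4 - 16 * x ^ 5) * h3
  exact one_ne_zero this

end IsRootData

namespace IsTotallyRamified

open WithZero Valuation

variable {F M : Type*} [Field F] [Field M] [Algebra F M] {v : Valuation M ℤᵐ⁰}
  {I : Subgroup Gal(M/F)} {π : M}

theorem sq_apply_root (h : IsTotallyRamified v I) {f : ℤ[X]} {n : ℕ} {r : Fin n → M}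
    (hr : f.map (Int.castRingHom M) = ∏ i, (X - C (r i))) (hf : f.Monic)
    (hne : ∀ i, ¬(v (aeval (r i) (derivative f)) < 1 ∧
      v (aeval (r i) (derivative (derivative f))) < 1))
    {σ : Gal(M/F)} (hσ : σ ∈ I) (i : Fin n) : σ (σ (r i)) = r i := by
  by_contra hi
  obtain ⟨j, hj⟩ := exists_apply_root_eq hr σ i
  obtain ⟨l, hl⟩ := exists_apply_root_eq hr σ j
  have hij : i ≠ j := by
    rintro rfl
    exact hi (by rw [hj, hj])
  have hil : i ≠ l := by
    rintro rfl
    exact hi (by rw [hj, hl])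
  have hjl : j ≠ l := by
    rintro rfl
    refine hi (by rw [hj, hl]; exact σ.injective (hl.trans hj.symm))
  have h1 : v (r j - r i) < 1 := hj ▸ h.map_apply_sub_lt σ hσ _ (map_root_le_one' hr hf i)
  have h2 : v (r l - r j) < 1 := hl ▸ h.map_apply_sub_lt σ hσ _ (map_root_le_one' hr hf j)
  have h3 : v (r l - r i) < 1 := by
    have := v.map_add_lt h2 h1
    rwa [sub_add_sub_cancel] at this
  rw [v.map_sub_swap] at h1 h3
  exact hne i ⟨map_aeval_derivative_lt_one hr hf hij h1,
    map_aeval_derivative_derivative_lt_one hr hf hij hil hjl h1 h3⟩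

end IsTotallyRamified

namespace IsRootData

open WithZero Valuation

variable {F M : Type*} [Field F] [Field M] [Algebra F M]
  {α : Fin 5 → M} {β : Fin 6 → M} {v : Valuation M ℤᵐ⁰} {I : Subgroup Gal(M/F)} {π : M}

theorem exists_prod_sub_α_eq_exp [CharZero M] (H : IsRootData F α β) :
    ∃ k : ℤ, v (∏ i, ∏ j > i, (α j - α i)) = exp k := by
  have h0 : ∏ i, ∏ j > i, (α j - α i) ≠ 0 := by
    intro h0
    have := H.sq_prod_sub_α
    rw [h0] at this
    norm_num at this
  exact ⟨log (v _), (exp_log ((v.ne_zero_iff).2 h0)).symm⟩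

theorem map_apply_sub_eq_of_three [FiniteDimensional F M] (H : IsRootData F α β) (h : IsTotallyRamified v I)
    (hπ : v π = exp (-1)) (h2 : v 2 = 1) (h3 : v 3 < 1) {σ : Gal(M/F)} (hσ : σ ∈ I)
    (hσ1 : σ ≠ 1) : σ ^ 2 = 1 ∧ v (σ π - π) = exp (-1) := by
  have hsq : σ ^ 2 = 1 := by
    refine H.eq_one _ (fun i ↦ ?_) (fun i ↦ ?_) (fun x hx ↦ ?_)
    · exact h.sq_apply_root H.map_quintic monic_quintic
        (H.not_aeval_derivative_quintic_lt_one h3) hσ i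
    · exact h.sq_apply_root H.map_sextic monic_sextic
        (H.not_aeval_derivative_sextic_lt_one h3) hσ i
    · have h1 : (σ x - x) * (σ x + x) = 0 := by
        have : σ x ^ 2 = -3 := by rw [← map_pow, hx]; simp [map_ofNat]
        linear_combination this - hx
      rw [sq, AlgEquiv.mul_apply]
      rcases mul_eq_zero.1 h1 with h1 | h1
      · rw [sub_eq_zero.1 h1, sub_eq_zero.1 h1]
      · rw [eq_neg_of_add_eq_zero_left h1, _root_.map_neg, eq_neg_of_add_eq_zero_left h1, neg_neg]
  exact ⟨hsq, h.map_apply_sub_eq_of_pow hπ hσ (n := 2) (by exact_mod_cast h2) hsq hσ1⟩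

theorem card_eq_two_of_three [FiniteDimensional F M] [CharZero M] (H : IsRootData F α β) (h : IsTotallyRamified v I)
    (hπ : v π = exp (-1)) (h2 : v 2 = 1) (h7 : v 7 = 1)
    (h3 : v 3 = exp (-(Nat.card I : ℤ))) : Nat.card I = 2 := by
  have hpos : 0 < Nat.card I := Nat.card_pos
  have h3' : v 3 < 1 := by
    rw [h3, ← exp_zero, exp_lt_exp]
    omega
  have : IsCyclic I := h.isCyclic hπ fun σ hσ hσ1 ↦
    (H.map_apply_sub_eq_of_three h hπ h2 h3' hσ hσ1).2
  obtain ⟨g, hg⟩ := IsCyclic.exists_ofOrder_eq_natCard (α := I)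
  have hg2 : g ^ 2 = 1 := by
    by_cases h1 : g = 1
    · simp [h1]
    · exact Subtype.ext (H.map_apply_sub_eq_of_three h hπ h2 h3' g.2
        (fun h0 ↦ h1 (Subtype.ext h0))).1
  have hle : Nat.card I ≤ 2 := hg ▸ Nat.le_of_dvd two_pos (orderOf_dvd_of_pow_eq_one hg2)
  obtain ⟨k, hk⟩ := H.exists_prod_sub_α_eq_exp (v := v)
  have h4 := congrArg v H.sq_prod_sub_α
  rw [map_pow, hk, show (336063168 : M) = 2 ^ 6 * 3 ^ 7 * 7 ^ 4 by norm_num, map_mul, map_mul,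
    map_pow, map_pow, map_pow, h2, h3, h7, ← exp_nsmul, ← exp_nsmul, one_pow, one_pow, one_mul,
    mul_one, exp_inj] at h4
  simp only [nsmul_eq_mul] at h4
  omega

end IsRootData

namespace IsRootData

open WithZero Valuation

variable {F M : Type*} [Field F] [Field M] [Algebra F M]
  {α : Fin 5 → M} {β : Fin 6 → M} {v : Valuation M ℤᵐ⁰} {I : Subgroup Gal(M/F)} {π : M}

theorem map_α_sub_three_pow (H : IsRootData F α β) (h7 : v 7 < 1) (i : Fin 5) :
    v (α i - 3) ^ 5 = v 7 := by
  have hle := H.map_α_le_one v i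
  have h0 := H.aeval_α i
  rw [aeval_quintic] at h0
  have h20 : v 20 = 1 := map_natCast_eq_one_of_coprime (p := 7) (n := 20) (by simpa) (by norm_num)
  have hle' : v (α i - 3) ≤ 1 := v.map_sub_le hle (map_ofNat_le_one 3)
  have h1 : (α i - 3) ^ 5 = -(7 * (20 + (α i - 3) * aeval (α i - 3)
      (2 * X ^ 3 + 11 * X ^ 2 + 30 * X + 41 : ℤ[X]))) := by
    simp only [map_add, map_mul, map_pow, map_ofNat, aeval_X]
    linear_combination h0
  have h2 : v (α i - 3) < 1 := by
    rw [← pow_lt_one_iff_of_nonneg zero_le (n := 5) (by norm_num), ← map_pow, h1,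
      Valuation.map_neg, map_mul]
    refine mul_lt_one_of_nonneg_of_lt_one_left zero_le h7 (v.map_add_le h20.le ?_)
    exact map_mul_le_one hle' (map_aeval_le_one hle' _)
  rw [← map_pow, h1, Valuation.map_neg, map_mul, v.map_add_eq_of_lt_left, h20, mul_one]
  rw [h20, map_mul]
  exact mul_lt_one_of_nonneg_of_lt_one_left zero_le h2 (map_aeval_le_one hle' _)

theorem map_β_sub_five (H : IsRootData F α β) (h7 : v 7 < 1) (h70 : v 7 ≠ 0) (i : Fin 6) :
    v (β i - 5) ^ 5 = v 7 ∨ v (β i - 5) = v 7 := by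
  have hle := H.map_β_le_one v i
  have h0 := H.aeval_β i
  rw [aeval_sextic] at h0
  have h225 : v 225 = 1 :=
    map_natCast_eq_one_of_coprime (p := 7) (n := 225) (by simpa) (by norm_num)
  have h1992 : v 1992 = 1 :=
    map_natCast_eq_one_of_coprime (p := 7) (n := 1992) (by simpa) (by norm_num)
  generalize ht : β i - 5 = t
  have hle' : v t ≤ 1 := ht ▸ v.map_sub_le hle (map_ofNat_le_one 5)
  have hβ : β i = t + 5 := by rw [← ht]; ring
  rw [hβ] at h0
  set g := aeval t (4 * X ^ 3 + 47 * X ^ 2 + 296 * X + 1051 : ℤ[X]) with hg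
  have hvg : v g ≤ 1 := map_aeval_le_one hle' _
  have h1 : t * (t ^ 5 + 7 * (1992 + t * g)) = -(7 ^ 2 * 225) := by
    simp only [map_add, map_mul, map_pow, map_ofNat, aeval_X] at hg
    rw [hg]
    linear_combination h0
  have h2 : v t < 1 := by
    have h6 : t ^ 6 = -(7 * (7 * 225 + t * (1992 + t * g))) := by linear_combination h1
    rw [← pow_lt_one_iff_of_nonneg zero_le (n := 6) (by norm_num), ← map_pow, h6,
      Valuation.map_neg, map_mul]
    refine mul_lt_one_of_nonneg_of_lt_one_left zero_le h7 (v.map_add_le ?_ ?_)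
    · exact map_mul_le_one h7.le h225.le
    · exact map_mul_le_one hle' (v.map_add_le h1992.le (map_mul_le_one hle' hvg))
  have hu : v (7 * (1992 + t * g)) = v 7 := by
    rw [map_mul, v.map_add_eq_of_lt_left, h1992, mul_one]
    rw [h1992, map_mul]
    exact mul_lt_one_of_nonneg_of_lt_one_left zero_le h2 hvg
  have h3 := congrArg v h1
  rw [Valuation.map_neg, map_mul, map_mul, h225, mul_one, map_pow] at h3
  rcases lt_trichotomy (v (t ^ 5)) (v (7 * (1992 + t * g))) with h4 | h4 | h4
  · right
    rw [v.map_add_eq_of_lt_right h4, hu, sq] at h3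
    exact mul_right_cancel₀ h70 h3
  · left
    rw [← map_pow, h4, hu]
  · exfalso
    rw [v.map_add_eq_of_lt_left h4] at h3
    rw [hu] at h4
    have h5 : v t < v 7 := by
      by_contra! h5
      exact (mul_lt_mul_of_le_of_lt_of_pos_of_nonneg h5 h4 (zero_lt_iff.2 h70) zero_le).ne
        (by rw [← sq, h3])
    have h6 : v (t ^ 5) ≤ v t := by
      rw [map_pow, pow_succ]
      exact mul_le_of_le_one_left' (pow_le_one' hle' 4)
    exact (h4.trans_le h6).not_gt h5

theorem exists_pow_eq_one (H : IsRootData F α β) [CharZero M] (h : IsTotallyRamified v I)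
    (h2 : v 2 = 1) (h3 : v 3 = 1) {σ : Gal(M/F)} (hσ : σ ∈ I) : σ ^ 86400 = 1 := by
  refine H.eq_one _ (apply_eq_of_rootPerm_eq_one H.map_quintic H.injective_α ?_)
    (apply_eq_of_rootPerm_eq_one H.map_sextic H.injective_β ?_) (fun x hx ↦ ?_)
  · rw [map_pow, show 86400 = Fintype.card (Equiv.Perm (Fin 5)) * 720 by
      rw [Fintype.card_perm]; rfl, pow_mul, pow_card_eq_one, one_pow]
  · rw [map_pow, show 86400 = Fintype.card (Equiv.Perm (Fin 6)) * 120 by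
      rw [Fintype.card_perm]; rfl, pow_mul, pow_card_eq_one, one_pow]
  · exact h.apply_eq_of_sq_eq h2 (n := -3) (by rw [hx]; norm_num) (by simpa using h3)
      (pow_mem hσ _)

variable [FiniteDimensional F M]

theorem pow_five_apply (h : IsTotallyRamified v I) (hcomm : ∀ a b : I, a * b = b * a)
    (h7 : v 7 = exp (-(Nat.card I : ℤ))) {y : M} (hy : v y ^ 5 = v 7) {s : Finset M}
    (hs : ∀ σ ∈ I, σ y ∈ s) (hcard : s.card < 10) {σ : Gal(M/F)} (hσ : σ ∈ I) :
    (σ ^ 5) y = y := by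
  have hpos : 0 < Nat.card I := Nat.card_pos
  have hy0 : v y ≠ 0 := by
    intro h0
    rw [h0, h7, zero_pow (by norm_num)] at hy
    exact exp_ne_zero hy.symm
  rw [← exp_log hy0, ← exp_nsmul, h7, exp_inj, nsmul_eq_mul] at hy
  push_cast at hy
  obtain ⟨k, hk⟩ := h.dvd_mul_ncard_orbit (y := y) (m := -log (v y)) (by rw [neg_neg, exp_log hy0])
  have hk' : ((MulAction.orbit I y).ncard : ℤ) = 5 * k := by
    have hne : (Nat.card I : ℤ) ≠ 0 := by exact_mod_cast hpos.ne'
    apply mul_left_cancel₀ hne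
    linear_combination 5 * hk + (MulAction.orbit I y).ncard * hy
  have hle : (MulAction.orbit I y).ncard ≤ s.card := by
    rw [← Set.ncard_coe_finset]
    refine Set.ncard_le_ncard ?_ s.finite_toSet
    rintro _ ⟨τ, rfl⟩
    exact hs τ.1 τ.2
  have hpos' : 0 < (MulAction.orbit I y).ncard :=
    (Set.ncard_pos (s.finite_toSet.subset (by
      rintro _ ⟨τ, rfl⟩
      exact hs τ.1 τ.2))).2 (MulAction.nonempty_orbit y)
  have h5 : (MulAction.stabilizer I y).index = 5 := by
    rw [MulAction.index_stabilizer]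
    omega
  have : (MulAction.stabilizer I y).Normal :=
    ⟨fun n hn g ↦ by rwa [hcomm g n, mul_inv_cancel_right]⟩
  have hmem := (MulAction.stabilizer I y).pow_index_mem ⟨σ, hσ⟩
  rw [h5] at hmem
  exact hmem

theorem map_apply_sub_eq_of_seven (H : IsRootData F α β) [CharZero M] (h : IsTotallyRamified v I)
    (hπ : v π = exp (-1)) (h2 : v 2 = 1) (h3 : v 3 = 1) (h5 : v 5 = 1) {σ : Gal(M/F)}
    (hσ : σ ∈ I) (hσ1 : σ ≠ 1) : v (σ π - π) = exp (-1) := by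
  refine h.map_apply_sub_eq_of_pow hπ hσ (n := 86400) ?_ (H.exists_pow_eq_one h h2 h3 hσ) hσ1
  rw [show ((86400 : ℕ) : M) = 2 ^ 7 * 3 ^ 3 * 5 ^ 2 by norm_num]
  simp [h2, h3, h5]

theorem exists_map_α_sub_three (H : IsRootData F α β)
    (h7 : v 7 = exp (-(Nat.card I : ℤ))) :
    ∃ m : ℤ, 0 < m ∧ (Nat.card I : ℤ) = 5 * m ∧ ∀ i, v (α i - 3) = exp (-m) := by
  have hpos : 0 < Nat.card I := Nat.card_pos
  have h7' : v 7 < 1 := by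
    rw [h7, ← exp_zero, exp_lt_exp]
    omega
  have key : ∀ i, 5 * log (v (α i - 3)) = -(Nat.card I : ℤ) ∧ v (α i - 3) ≠ 0 := by
    intro i
    have := H.map_α_sub_three_pow h7' i
    have hy0 : v (α i - 3) ≠ 0 := by
      intro h0
      rw [h0, h7, zero_pow (by norm_num)] at this
      exact exp_ne_zero this.symm
    rw [← exp_log hy0, ← exp_nsmul, h7, exp_inj, nsmul_eq_mul] at this
    exact ⟨by exact_mod_cast this, hy0⟩
  refine ⟨-log (v (α 0 - 3)), ?_, ?_, fun i ↦ ?_⟩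
  · have := key 0
    omega
  · have := key 0
    omega
  · rw [← exp_log (key i).2, exp_inj]
    have := key 0
    have := key i
    omega

theorem pow_five_eq_one (H : IsRootData F α β) [CharZero M] (h : IsTotallyRamified v I)
    (hcomm : ∀ a b : I, a * b = b * a) (h2 : v 2 = 1) (h3 : v 3 = 1)
    (h7 : v 7 = exp (-(Nat.card I : ℤ))) {σ : Gal(M/F)} (hσ : σ ∈ I) : σ ^ 5 = 1 := by
  classical
  obtain ⟨m, hm, hem, hα⟩ := H.exists_map_α_sub_three h7
  have h7' : v 7 < 1 := by
    rw [h7, ← exp_zero, exp_lt_exp]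
    omega
  have hfix : ∀ i, v (β i - 5) ^ 5 = v 7 → (σ ^ 5) (β i) = β i := by
    intro i hi
    have := pow_five_apply h hcomm h7 hi (s := Finset.univ.image fun i ↦ β i - 5) (fun τ _ ↦ by
      obtain ⟨j, hj⟩ := exists_apply_root_eq H.map_sextic τ i
      rw [_root_.map_sub, hj, map_ofNat]
      exact Finset.mem_image_of_mem (fun i ↦ β i - 5) (Finset.mem_univ j))
      (Finset.card_image_le.trans_lt (by simp)) hσ
    rwa [_root_.map_sub, map_ofNat, sub_left_inj] at this
  have hle : ∀ i, v (β i - 5) ≤ exp (-m) := by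
    intro i
    rcases H.map_β_sub_five h7' (by rw [h7]; exact exp_ne_zero) i with hi | hi
    · rw [← pow_le_pow_iff_left₀ zero_le zero_le (n := 5) (by norm_num), hi, h7, ← exp_nsmul,
        exp_le_exp]
      simp only [nsmul_eq_mul]
      push_cast
      omega
    · rw [hi, h7, exp_le_exp]
      omega
  refine H.eq_one _ (fun i ↦ ?_) (fun i ↦ ?_) (fun x hx ↦ ?_)
  · have := pow_five_apply h hcomm h7 (H.map_α_sub_three_pow h7' i)
      (s := Finset.univ.image fun i ↦ α i - 3) (fun τ _ ↦ by
        obtain ⟨j, hj⟩ := exists_apply_root_eq H.map_quintic τ i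
        rw [_root_.map_sub, hj, map_ofNat]
        exact Finset.mem_image_of_mem (fun i ↦ α i - 3) (Finset.mem_univ j))
      (Finset.card_image_le.trans_lt (by simp)) hσ
    rwa [_root_.map_sub, map_ofNat, sub_left_inj] at this
  · by_contra hne
    obtain ⟨j, hj⟩ := exists_apply_root_eq H.map_sextic (σ ^ 5) i
    have hij : j ≠ i := by
      rintro rfl
      exact hne hj
    have hi : v (β i - 5) = v 7 :=
      (H.map_β_sub_five h7' (by rw [h7]; exact exp_ne_zero) i).resolve_left fun hi ↦
        hne (hfix i hi)
    have hj' : v (β j - 5) = v 7 := by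
      rw [← hi, ← h.map_apply (σ ^ 5) (pow_mem hσ 5) (β i - 5),
        _root_.map_sub (σ ^ 5), hj, map_ofNat]
    have hprod : ∏ l, v (β l - 5) = v 7 ^ 2 := by
      have := congrArg v (aeval_eq_prod H.map_sextic (5 : M))
      have h5 : v 5 = 1 := map_natCast_eq_one_of_coprime (p := 7) (n := 5) (by simpa) (by norm_num)
      rw [aeval_sextic, show (5 ^ 6 - 2 * 5 ^ 5 + 4 * 5 ^ 4 - 8 * 5 ^ 3 + 2 * 5 ^ 2 + 24 * 5 - 20 : M)
        = 3 ^ 2 * 5 ^ 2 * 7 ^ 2 by norm_num, map_mul, map_mul, map_pow, map_pow, h3, h5, one_pow,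
        one_mul, one_mul, map_pow, map_prod] at this
      rw [this]
      exact Finset.prod_congr rfl fun l _ ↦ v.map_sub_swap _ _
    rw [← Finset.mul_prod_erase _ _ (Finset.mem_univ i), ← Finset.mul_prod_erase _ _
      (Finset.mem_erase.2 ⟨hij, Finset.mem_univ j⟩), hi, hj', ← mul_assoc, ← sq] at hprod
    have h70 : v 7 ^ 2 ≠ 0 := pow_ne_zero 2 (by rw [h7]; exact exp_ne_zero)
    have h1 := mul_left_cancel₀ h70 (hprod.trans (mul_one _).symm)
    refine ((Finset.prod_le_pow_card _ _ _ fun l _ ↦ hle l).trans_lt ?_).ne h1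
    rw [Finset.card_erase_of_mem (Finset.mem_erase.2 ⟨hij, Finset.mem_univ j⟩),
      Finset.card_erase_of_mem (Finset.mem_univ i), Finset.card_univ, Fintype.card_fin,
      ← exp_nsmul, ← exp_zero, exp_lt_exp]
    simp only [nsmul_eq_mul]
    push_cast
    omega
  · exact h.apply_eq_of_sq_eq h2 (n := -3) (by rw [hx]; norm_num) (by simpa using h3)
      (pow_mem hσ _)

theorem card_eq_five_of_seven (H : IsRootData F α β) [CharZero M] (h : IsTotallyRamified v I)
    (hπ : v π = exp (-1)) (h2 : v 2 = 1) (h3 : v 3 = 1) (h5 : v 5 = 1)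
    (h7 : v 7 = exp (-(Nat.card I : ℤ))) : Nat.card I = 5 := by
  have : IsCyclic I := h.isCyclic hπ fun σ hσ hσ1 ↦
    H.map_apply_sub_eq_of_seven h hπ h2 h3 h5 hσ hσ1
  obtain ⟨g, hg⟩ := IsCyclic.exists_ofOrder_eq_natCard (α := I)
  obtain ⟨m, hm, hem, hα⟩ := H.exists_map_α_sub_three h7
  have hg5 : g ^ 5 = 1 := Subtype.ext <|
    H.pow_five_eq_one h (IsCyclic.commGroup (α := I)).mul_comm h2 h3 h7 g.2
  have hle : Nat.card I ≤ 5 := hg ▸ Nat.le_of_dvd (by norm_num) (orderOf_dvd_of_pow_eq_one hg5)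
  omega

end IsRootData

namespace Valuation

open WithZero

variable {M : Type*} [Field M]

/-- The additive valuation of `x` is at least `a`. -/
def OrdGE (v : Valuation M ℤᵐ⁰) (a : ℤ) (x : M) : Prop := v x ≤ exp (-a)

namespace OrdGE

variable {v : Valuation M ℤᵐ⁰} {a b : ℤ} {x y : M}

theorem of_eq (h : v x = exp (-a)) : v.OrdGE a x := h.le

theorem mono (h : v.OrdGE a x) (hab : b ≤ a) : v.OrdGE b x :=
  h.trans (exp_le_exp.2 (neg_le_neg hab))

theorem add (hx : v.OrdGE a x) (hy : v.OrdGE a y) : v.OrdGE a (x + y) := v.map_add_le hx hy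

theorem neg (hx : v.OrdGE a x) : v.OrdGE a (-x) := by rwa [OrdGE, Valuation.map_neg]

theorem mul (hx : v.OrdGE a x) (hy : v.OrdGE b y) : v.OrdGE (a + b) (x * y) := by
  rw [OrdGE, map_mul, neg_add, exp_add]
  exact mul_le_mul' hx hy

theorem pow (hx : v.OrdGE a x) (n : ℕ) : v.OrdGE (n * a) (x ^ n) := by
  rw [OrdGE, map_pow, ← mul_neg, ← nsmul_eq_mul, exp_nsmul]
  exact pow_le_pow_left' hx n

theorem zero : v.OrdGE a 0 := by simp [OrdGE]

theorem intCast (n : ℤ) : v.OrdGE 0 (n : M) := by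
  rw [OrdGE, neg_zero, exp_zero]
  exact map_intCast_le_one n

theorem lt_one (hx : v.OrdGE a x) (ha : 0 < a) : v x < 1 := by
  refine hx.trans_lt ?_
  rw [← exp_zero, exp_lt_exp]
  omega

theorem sum_monomials {x y z w : M} {p q r s N : ℤ} (hx : v.OrdGE p x) (hy : v.OrdGE q y)
    (hz : v.OrdGE r z) (hw : v.OrdGE s w) (l : List (ℤ × ℕ × ℕ × ℕ × ℕ))
    (hl : ∀ t ∈ l, N ≤ t.2.1 * p + t.2.2.1 * q + t.2.2.2.1 * r + t.2.2.2.2 * s) :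
    v.OrdGE N
      (l.map fun t ↦ t.1 * x ^ t.2.1 * y ^ t.2.2.1 * z ^ t.2.2.2.1 * w ^ t.2.2.2.2).sum := by
  induction l with
  | nil => exact zero
  | cons t l ih =>
    rw [List.map_cons, List.sum_cons]
    refine add ?_ (ih fun t ht ↦ hl t (List.mem_cons_of_mem _ ht))
    refine (((((intCast t.1).mul (hx.pow _)).mul (hy.pow _)).mul (hz.pow _)).mul
      (hw.pow _)).mono ?_
    rw [zero_add]
    exact hl t List.mem_cons_self

end OrdGE

variable {v : Valuation M ℤᵐ⁰} {a b : ℤ} {x y : M}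

theorem ordGE_iff_of_eq (hx : v x = exp (-b)) : v.OrdGE a x ↔ a ≤ b := by
  rw [OrdGE, hx, exp_le_exp, neg_le_neg_iff]

theorem map_add_eq_exp (hx : v x = exp (-a)) (hy : v.OrdGE b y) (hab : a < b) :
    v (x + y) = exp (-a) := by
  rw [v.map_add_eq_of_lt_left, hx]
  rw [hx]
  refine hy.trans_lt ?_
  rw [exp_lt_exp]
  omega

theorem le_of_ordGE_of_add_eq_zero (hx : v x = exp (-a)) (hy : v.OrdGE b y) (hxy : x + y = 0) :
    b ≤ a := by
  by_contra! hab
  have := map_add_eq_exp hx hy hab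
  rw [hxy, map_zero] at this
  exact exp_ne_zero this.symm

theorem map_pow_eq_exp (hx : v x = exp (-a)) (n : ℕ) : v (x ^ n) = exp (-(n * a)) := by
  rw [map_pow, hx, ← exp_nsmul, nsmul_eq_mul, mul_neg]

theorem map_mul_eq_exp (hx : v x = exp (-a)) (hy : v y = exp (-b)) :
    v (x * y) = exp (-(a + b)) := by
  rw [map_mul, hx, hy, ← exp_add, neg_add]

theorem exists_map_eq_exp (hx : x ≠ 0) : ∃ a : ℤ, v x = exp (-a) :=
  ⟨-log (v x), by rw [neg_neg, exp_log (v.ne_zero_iff.2 hx)]⟩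

theorem map_eq_exp_zero (hx : v x = 1) : v x = exp (-(0 : ℤ)) := by rw [hx, neg_zero, exp_zero]

/-- The slopes of the Newton polygon of `f₂` at a prime above `2`. -/
theorem map_root_sextic {e : ℤ} (he : 0 < e) (h2 : v 2 = exp (-e)) (h5 : v 5 = 1) {x : M}
    (hx : aeval x sextic = 0) :
    ∃ a : ℤ, v x = exp (-a) ∧ (4 * a = e ∨ 2 * a = e) := by
  have hle : v x ≤ 1 := map_root_le_one monic_sextic hx
  have hx' : v.OrdGE 0 x := by rwa [OrdGE, neg_zero, exp_zero]
  rw [aeval_sextic] at hx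
  have hx0 : x ≠ 0 := by
    rintro rfl
    have h20 : (2 : M) ^ 2 * 5 = 0 := by linear_combination -hx
    have := map_mul_eq_exp (map_pow_eq_exp h2 2) (map_eq_exp_zero h5)
    rw [h20, map_zero] at this
    exact exp_ne_zero this.symm
  obtain ⟨a, ha⟩ := exists_map_eq_exp (v := v) hx0
  refine ⟨a, ha, ?_⟩
  have h2' := OrdGE.of_eq h2
  have hxa := OrdGE.of_eq ha
  have h1 : v.OrdGE 0 (1 : M) := by simp [OrdGE]
  have ha0 : 0 < a := by
    have h6 : v.OrdGE e (-(x ^ 6)) := by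
      have := OrdGE.sum_monomials (N := e) h2' hx' h1 h1 [(-1, 1, 5, 0, 0), (1, 2, 4, 0, 0),
        (-1, 3, 3, 0, 0), (1, 1, 2, 0, 0), (3, 3, 1, 0, 0), (-5, 2, 0, 0, 0)] (by simp; omega)
      convert this using 1
      simp
      linear_combination -hx
    have h6' := h6.neg
    rw [neg_neg, ordGE_iff_of_eq (map_pow_eq_exp ha 6)] at h6'
    push_cast at h6'
    omega
  have c1 : ¬ 4 * a < e := by
    intro hlt
    have := OrdGE.sum_monomials (N := 6 * a + 1) h2' hxa h1 h1 [(-1, 1, 5, 0, 0), (1, 2, 4, 0, 0),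
        (-1, 3, 3, 0, 0), (1, 1, 2, 0, 0), (3, 3, 1, 0, 0), (-5, 2, 0, 0, 0)] (by simp; omega)
    have := le_of_ordGE_of_add_eq_zero (map_pow_eq_exp ha 6) this (by
      simp
      linear_combination hx)
    push_cast at this
    omega
  have c2 : ¬ (e < 4 * a ∧ 2 * a < e) := by
    rintro ⟨hlt, hlt'⟩
    have := OrdGE.sum_monomials (N := e + 2 * a + 1) h2' hxa h1 h1 [(-1, 1, 5, 0, 0),
      (1, 2, 4, 0, 0), (-1, 3, 3, 0, 0), (1, 0, 6, 0, 0), (3, 3, 1, 0, 0), (-5, 2, 0, 0, 0)]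
      (by simp; omega)
    have := le_of_ordGE_of_add_eq_zero (map_mul_eq_exp h2 (map_pow_eq_exp ha 2)) this (by
      simp
      linear_combination hx)
    push_cast at this
    omega
  have c3 : ¬ (e < 2 * a) := by
    rintro hlt
    have := OrdGE.sum_monomials (N := 2 * e + 1) h2' hxa h1 h1 [(1, 1, 5, 0, 0),
      (-1, 2, 4, 0, 0), (1, 3, 3, 0, 0), (-1, 0, 6, 0, 0), (-3, 3, 1, 0, 0), (-1, 1, 2, 0, 0)]
      (by simp; omega)
    have := le_of_ordGE_of_add_eq_zero (map_mul_eq_exp (map_eq_exp_zero h5) (map_pow_eq_exp h2 2))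
      this (by
        simp
        linear_combination -hx)
    push_cast at this
    omega
  omega

variable {n : ℤ}

/-- Two distinct roots of `f₂` of valuation `n`, where `4 * n` is the valuation of `2`, differ by
`κ * x ^ 2` with `κ ^ 3 + κ + 1` in the maximal ideal. -/
theorem map_sub_root_sextic (hn : 0 < n) (h2 : v 2 = exp (-(4 * n))) (h3 : v 3 = 1) (h5 : v 5 = 1)
    {x y : M} (hx : aeval x sextic = 0) (hy : aeval y sextic = 0) (hvx : v x = exp (-n))
    (hvy : v y = exp (-n)) (hxy : y ≠ x) :
    v (y - x) = exp (-(2 * n)) ∧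
      v (((y - x) / x ^ 2) ^ 3 + (y - x) / x ^ 2 + 1) < 1 := by
  rw [aeval_sextic] at hx hy
  have h2' := OrdGE.of_eq h2
  have hx' := OrdGE.of_eq hvx
  have hy' := OrdGE.of_eq hvy
  have h1 : v.OrdGE 0 (1 : M) := by simp [OrdGE]
  have hx0 : x ≠ 0 := ne_zero_of_map_eq_exp hvx
  -- the order of `x ^ 4 + 2`
  have key : ∀ z : M, v z = exp (-n) →
      z ^ 6 - 2 * z ^ 5 + 4 * z ^ 4 - 8 * z ^ 3 + 2 * z ^ 2 + 24 * z - 20 = 0 →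
      v.OrdGE (9 * n) (z ^ 2 * (z ^ 4 + 2) - 20) ∧ v.OrdGE (6 * n) (z ^ 4 + 2) := by
    intro z hvz hz
    have hz' := OrdGE.of_eq hvz
    have hη : v.OrdGE (9 * n) (z ^ 2 * (z ^ 4 + 2) - 20) := by
      have := OrdGE.sum_monomials (N := 9 * n) h2' hz' h1 h1 [(1, 1, 5, 0, 0), (-1, 2, 4, 0, 0),
        (1, 3, 3, 0, 0), (-3, 3, 1, 0, 0)] (by simp; omega)
      convert this using 1
      simp
      linear_combination hz
    refine ⟨hη, ?_⟩
    have h8 : v.OrdGE (8 * n) (z ^ 2 * (z ^ 4 + 2)) := by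
      have h20 := OrdGE.sum_monomials (N := 8 * n) h2' hz' h1 h1 [(5, 2, 0, 0, 0)] (by simp; omega)
      have := (hη.mono (b := 8 * n) (by omega)).add h20
      convert this using 1
      simp
      ring
    by_cases h0 : z ^ 4 + 2 = 0
    · rw [h0]
      exact OrdGE.zero
    obtain ⟨a, ha⟩ := exists_map_eq_exp (v := v) h0
    rw [ordGE_iff_of_eq (map_mul_eq_exp (map_pow_eq_exp hvz 2) ha)] at h8
    rw [ordGE_iff_of_eq ha]
    push_cast at h8
    omega
  obtain ⟨hη, hε⟩ := key x hvx hx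
  obtain ⟨-, hε'⟩ := key y hvy hy
  generalize hεx : x ^ 4 + 2 = ε at hη hε
  generalize hεy : y ^ 4 + 2 = ε' at hε'
  obtain ⟨d, hd⟩ := exists_map_eq_exp (v := v) (sub_ne_zero.2 hxy)
  have hd' := OrdGE.of_eq hd
  have hdn : n < d := by
    have h4 : v.OrdGE (6 * n) ((y - x) ^ 4) := by
      have := (OrdGE.sum_monomials (N := 6 * n) h2' hx' hy' hε [(-1, 0, 0, 0, 1), (1, 1, 4, 0, 0),
        (-1, 2, 1, 3, 0), (3, 1, 2, 2, 0), (-1, 2, 3, 1, 0)] (by simp; omega)).add hε'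
      convert this using 1
      simp
      linear_combination -hεx + hεy
    rw [ordGE_iff_of_eq (map_pow_eq_exp hd 4)] at h4
    push_cast at h4
    omega
  generalize hδ : y - x = δ at hd hd'
  obtain rfl : y = x + δ := by rw [← hδ]; ring
  have hδ0 : δ ≠ 0 := ne_zero_of_map_eq_exp hd
  have hrel : 6 * x ^ 5 - 10 * x ^ 4 + 16 * x ^ 3 - 24 * x ^ 2 + 4 * x + 24 +
      (15 * x ^ 4 - 20 * x ^ 3 + 24 * x ^ 2 - 24 * x + 2) * δ +
      (20 * x ^ 3 - 20 * x ^ 2 + 16 * x - 8) * δ ^ 2 + (15 * x ^ 2 - 10 * x + 4) * δ ^ 3 +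
      (6 * x - 2) * δ ^ 4 + δ ^ 5 = 0 := by
    apply mul_left_cancel₀ hδ0
    linear_combination hy - hx
  have hd2 : d = 2 * n := by
    rcases lt_trichotomy d (2 * n) with hlt | heq | hgt
    · exfalso
      have := OrdGE.sum_monomials (N := 2 * n + 3 * d + 1) h2' hx' hd' hε
        [(3, 1, 5, 0, 0), (-5, 1, 4, 0, 0), (1, 4, 3, 0, 0), (-3, 3, 2, 0, 0), (1, 2, 1, 0, 0),
        (3, 3, 0, 0, 0), (1, 0, 0, 1, 1), (7, 1, 4, 1, 0), (-5, 2, 3, 1, 0), (3, 3, 2, 1, 0),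
        (-3, 3, 1, 1, 0), (5, 2, 3, 2, 0), (-5, 2, 2, 2, 0), (1, 4, 1, 2, 0), (-1, 3, 0, 2, 0),
        (-5, 1, 1, 3, 0), (1, 2, 0, 3, 0), (3, 1, 1, 4, 0), (-1, 1, 0, 4, 0), (1, 0, 0, 5, 0)]
        (by simp; omega)
      have := le_of_ordGE_of_add_eq_zero (map_mul_eq_exp (map_mul_eq_exp
        (map_mul_eq_exp (map_eq_exp_zero h3) (map_eq_exp_zero h5)) (map_pow_eq_exp hvx 2))
        (map_pow_eq_exp hd 3)) this (by
          simp
          linear_combination hrel - δ * hεx)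
      push_cast at this
      omega
    · exact heq
    · exfalso
      have := OrdGE.sum_monomials (N := 8 * n + 1) h2' hx' hd' hε
        [(3, 1, 5, 0, 0), (1, 4, 3, 0, 0), (-3, 3, 2, 0, 0), (1, 2, 1, 0, 0),
        (3, 3, 0, 0, 0), (1, 0, 0, 1, 1), (7, 1, 4, 1, 0), (-5, 2, 3, 1, 0), (3, 3, 2, 1, 0),
        (-3, 3, 1, 1, 0), (5, 2, 3, 2, 0), (-5, 2, 2, 2, 0), (1, 4, 1, 2, 0), (-1, 3, 0, 2, 0),
        (15, 0, 2, 3, 0),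
        (-5, 1, 1, 3, 0), (1, 2, 0, 3, 0), (3, 1, 1, 4, 0), (-1, 1, 0, 4, 0), (1, 0, 0, 5, 0)]
        (by simp; omega)
      have := le_of_ordGE_of_add_eq_zero (map_mul_eq_exp
        (map_mul_eq_exp h2 (map_eq_exp_zero h5)) (map_pow_eq_exp hvx 4)) this.neg (by
          simp
          linear_combination -hrel + δ * hεx)
      push_cast at this
      omega
  subst hd2
  refine ⟨by rw [hd], ?_⟩
  have hmain : v.OrdGE (9 * n) (5 * x ^ 8 * ((δ / x ^ 2) ^ 3 + δ / x ^ 2 + 1)) := by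
    have hκ : v.OrdGE 0 (δ / x ^ 2) := by
      rw [OrdGE, map_div₀, hd, map_pow_eq_exp hvx 2, ← exp_sub]
      simp
    generalize hκδ : δ / x ^ 2 = κ at hκ
    have hδx : δ = κ * x ^ 2 := by rw [← hκδ]; field_simp
    have m1 := OrdGE.sum_monomials (N := 9 * n) h2' hx' hd' hε
      [(-3, 1, 5, 0, 0), (-1, 4, 3, 0, 0), (3, 3, 2, 0, 0), (-1, 2, 1, 0, 0),
        (-3, 3, 0, 0, 0), (5, 0, 4, 0, 1), (-7, 1, 4, 1, 0), (5, 2, 3, 1, 0), (-3, 3, 2, 1, 0),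
        (3, 3, 1, 1, 0), (-5, 2, 3, 2, 0), (5, 2, 2, 2, 0), (-1, 4, 1, 2, 0), (1, 3, 0, 2, 0),
        (-5, 1, 2, 3, 0), (5, 1, 1, 3, 0), (-1, 2, 0, 3, 0), (-3, 1, 1, 4, 0), (1, 1, 0, 4, 0),
        (-1, 0, 0, 5, 0)] (by simp; omega)
    have m2 := OrdGE.sum_monomials (N := 9 * n) h2' hκ h1 hε [(-5, 2, 1, 0, 1), (5, 0, 1, 0, 2)]
      (by simp; omega)
    have m3 := (hκ.mul hη).neg
    rw [zero_add] at m3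
    convert (m1.add m2).add m3 using 1
    simp
    rw [← hεx] at *
    rw [hδx] at hrel ⊢
    linear_combination hrel
  rw [OrdGE, map_mul, map_mul, h5, one_mul, map_pow_eq_exp hvx 8] at hmain
  have h9 : exp (-(9 * n)) < exp (-(((8 : ℕ) : ℤ) * n)) := by
    rw [exp_lt_exp]
    push_cast
    omega
  by_contra! hge
  exact ((le_mul_of_one_le_right' hge).trans hmain).not_gt h9

end Valuation

section

open WithZero Valuation IsLocalRing

theorem IsRootData.comp {F M : Type*} [Field F] [Field M] [Algebra F M]
  {α : Fin 5 → M} {β : Fin 6 → M} (H : IsRootData F α β) (e : Equiv.Perm (Fin 5))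
    (e' : Equiv.Perm (Fin 6)) : IsRootData F (α ∘ e) (β ∘ e') where
  map_quintic := by
    rw [H.map_quintic]
    exact (Equiv.prod_comp e fun i ↦ X - C (α i)).symm
  map_sextic := by
    rw [H.map_sextic]
    exact (Equiv.prod_comp e' fun i ↦ X - C (β i)).symm
  eq_one σ h1 h2 h3 := H.eq_one σ (fun i ↦ by simpa using h1 (e.symm i))
    (fun i ↦ by simpa using h2 (e'.symm i)) h3

/-- Roots of `(X + 1) (X ^ 2 + X + 1) ^ 2` in characteristic two. -/
theorem exists_perm_of_map_quintic {k : Type*} [Field k] (h2 : (2 : k) = 0) {g : Fin 5 → k}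
    (hg : quintic.map (Int.castRingHom k) = ∏ i, (X - C (g i))) :
    ∃ (ω : k) (e : Equiv.Perm (Fin 5)), ω ^ 2 + ω + 1 = 0 ∧
      g ∘ e = ![ω, ω, ω + 1, ω + 1, 1] := by
  classical
  have hev : ∀ x : k, ∏ i, (x - g i) = (x + 1) * (x ^ 2 + x + 1) ^ 2 := by
    intro x
    have := congrArg (eval x) hg
    rw [eval_prod] at this
    simp only [quintic, Polynomial.map_sub, Polynomial.map_add, Polynomial.map_mul,
      Polynomial.map_pow, map_X, Polynomial.map_ofNat, eval_sub, eval_add, eval_mul, eval_pow,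
      eval_X, eval_ofNat, eval_C] at this
    linear_combination -this - (2 * x ^ 4 + 3 * x ^ 3 + x ^ 2 + 2 * x + 10) * h2
  have h2' : (2 : k[X]) = 0 := by rw [← C_ofNat, h2, C_0]
  obtain ⟨i, hi⟩ : ∃ i, g i ^ 2 + g i + 1 = 0 := by
    by_contra! hne
    have h1 : ∀ i, g i = 1 := by
      intro i
      have := hev (g i)
      rw [Finset.prod_eq_zero (Finset.mem_univ i) (sub_self _)] at this
      rcases mul_eq_zero.1 this.symm with h | h
      · linear_combination h - h2
      · exact absurd (eq_zero_of_pow_eq_zero h) (hne i)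
    simp only [h1, Fin.prod_univ_five] at hg
    have := congrArg (coeff · 3) hg
    have e : (X - C (1 : k)) * (X - C 1) * (X - C 1) * (X - C 1) * (X - C 1) =
      X ^ 5 - 5 * X ^ 4 + 10 * X ^ 3 - 10 * X ^ 2 + 5 * X - 1 := by rw [C_1]; ring
    rw [e] at this
    simp [quintic, coeff_X, coeff_one] at this
    apply one_ne_zero (α := k)
    linear_combination -this - 5 * h2
  generalize g i = ω at hi
  have hω1 : ω ≠ 1 := by
    rintro rfl
    exact one_ne_zero (α := k) (by linear_combination hi - h2)
  have hω0 : ω ≠ 0 := by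
    rintro rfl
    exact one_ne_zero (α := k) (by linear_combination hi)
  have hpoly : ∏ i, (X - C (g i)) = (X - C 1) * (X - C ω) ^ 2 * (X - C (ω + 1)) ^ 2 := by
    rw [← hg]
    have hi' : C ω ^ 2 + C ω + 1 = 0 := by
      rw [← C_pow, ← C_add, ← C_1, ← C_add, hi, C_0]
    have : (X - C ω) * (X - C (ω + 1)) = X ^ 2 + X + 1 := by
      rw [C_add, C_1]
      linear_combination hi' - (C ω * X + X + 1) * h2'
    rw [mul_assoc, ← mul_pow, this, C_1]
    simp only [quintic, Polynomial.map_sub, Polynomial.map_add, Polynomial.map_mul,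
      Polynomial.map_pow, map_X, Polynomial.map_ofNat]
    linear_combination -(X ^ 4 + X ^ 3 - 2 * X ^ 2 + 9) * h2'
  have hroots : Finset.univ.val.map g = {1, ω, ω, ω + 1, ω + 1} := by
    rw [← roots_multiset_prod_X_sub_C (Finset.univ.val.map g), Multiset.map_map]
    refine (congrArg roots (hpoly.trans ?_)).trans
      (roots_multiset_prod_X_sub_C {1, ω, ω, ω + 1, ω + 1})
    simp
    ring
  have hcount : ∀ x, (Finset.univ.filter fun i ↦ g i = x).card =
      Multiset.count x {1, ω, ω, ω + 1, ω + 1} := by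
    intro x
    rw [← hroots, Multiset.count_map, Finset.card_def, Finset.filter_val]
    simp only [eq_comm]
  have c1 : (Finset.univ.filter fun i ↦ g i = 1).card = 1 := by
    rw [hcount]
    simp [hω1.symm, hω0]
  have c2 : (Finset.univ.filter fun i ↦ g i = ω).card = 2 := by
    rw [hcount]
    simp [hω1]
  have c3 : (Finset.univ.filter fun i ↦ g i = ω + 1).card = 2 := by
    rw [hcount]
    simp [hω0]
  obtain ⟨a4, h4⟩ := Finset.card_eq_one.1 c1
  obtain ⟨a0, a1, h01, h01'⟩ := Finset.card_eq_two.1 c2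
  obtain ⟨a2, a3, h23, h23'⟩ := Finset.card_eq_two.1 c3
  have m0 : g a0 = ω := by simpa using h01'.ge (Finset.mem_insert_self _ _)
  have m1 : g a1 = ω := by simpa using h01'.ge (by simp)
  have m2 : g a2 = ω + 1 := by simpa using h23'.ge (by simp)
  have m3 : g a3 = ω + 1 := by simpa using h23'.ge (by simp)
  have m4 : g a4 = 1 := by simpa using h4.ge (by simp)
  have hinj : Function.Injective ![a0, a1, a2, a3, a4] := by
    have hne : ∀ a b, g a ≠ g b → a ≠ b := fun a b h hab ↦ h (by rw [hab])
    have e1 : ω ≠ ω + 1 := by simp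
    have e2 : ω + 1 ≠ 1 := by simpa using hω0
    have := hne a0 a2 (by rwa [m0, m2])
    have := hne a0 a3 (by rwa [m0, m3])
    have := hne a0 a4 (by rwa [m0, m4])
    have := hne a1 a2 (by rwa [m1, m2])
    have := hne a1 a3 (by rwa [m1, m3])
    have := hne a1 a4 (by rwa [m1, m4])
    have := hne a2 a4 (by rwa [m2, m4])
    have := hne a3 a4 (by rwa [m3, m4])
    intro i j hij
    fin_cases i <;> fin_cases j <;> simp_all
  refine ⟨ω, Equiv.ofBijective _ (Finite.injective_iff_bijective.1 hinj), hi, ?_⟩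
  funext i
  fin_cases i <;> simp [*]

/-- Root data together with a labelling of the roots adapted to a prime above `2`. -/
structure IsDyadic (F : Type*) {M : Type*} [Field F] [Field M] [Algebra F M]
    (v : Valuation M ℤᵐ⁰) (α : Fin 5 → M) (β : Fin 6 → M) (n : ℤ)
    (ω : ResidueField v.valuationSubring) : Prop extends IsRootData F α β where
  pos : 0 < n
  map_two : v 2 = exp (-(4 * n))
  map_three : v 3 = 1
  map_five : v 5 = 1
  map_seven : v 7 = 1
  map_β : ∀ i, v (β i) = exp (-(![1, 1, 1, 1, 2, 2] i * n))
  omega_sq : ω ^ 2 + ω + 1 = 0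
  res_α : ∀ i, v.res (α i) = ![ω, ω, ω + 1, ω + 1, 1] i

section

variable {F M : Type*} [Field F] [Field M] [Algebra F M]
  {α : Fin 5 → M} {β : Fin 6 → M} {v : Valuation M ℤᵐ⁰}

theorem IsRootData.exists_perm_β (H : IsRootData F α β) {e : ℤ} (he : 0 < e)
    (h2 : v 2 = exp (-e)) (h5 : v 5 = 1) : ∃ (σ : Equiv.Perm (Fin 6)) (n : ℤ), e = 4 * n ∧
      ∀ i, v (β (σ i)) = exp (-(![1, 1, 1, 1, 2, 2] i * n)) := by
  choose a ha ha' using fun i ↦ map_root_sextic he h2 h5 (H.aeval_β i)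
  have hsum : ∑ i, a i = 2 * e := by
    have h := congrArg v (aeval_eq_prod H.map_sextic 0)
    rw [aeval_sextic, map_prod, show ((0 : M) ^ 6 - 2 * 0 ^ 5 + 4 * 0 ^ 4 - 8 * 0 ^ 3 + 2 * 0 ^ 2 +
      24 * 0 - 20) = -(2 ^ 2 * 5) by norm_num, Valuation.map_neg,
      map_mul_eq_exp (map_pow_eq_exp h2 2) (map_eq_exp_zero h5)] at h
    simp only [zero_sub, Valuation.map_neg, ha, Fin.prod_univ_six, ← exp_add, exp_inj] at h
    rw [Fin.sum_univ_six]
    push_cast at h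
    omega
  have h4 : ∀ i, 4 * a i = if 4 * a i = e then e else 2 * e := by
    intro i
    have := ha' i
    split_ifs <;> omega
  have hcard : (Finset.univ.filter fun i ↦ 4 * a i = e).card = 4 := by
    have h : ∑ i, 4 * a i = 8 * e := by rw [← Finset.mul_sum, hsum]; ring
    rw [Finset.sum_congr rfl fun i _ ↦ h4 i, Finset.sum_ite, Finset.sum_const, Finset.sum_const,
      nsmul_eq_mul, nsmul_eq_mul] at h
    have h6 := Finset.card_filter_add_card_filter_not (s := Finset.univ) (fun i : Fin 6 ↦ 4 * a i = e)
    rw [Finset.card_univ, Fintype.card_fin] at h6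
    have h6' : ((Finset.univ.filter fun i : Fin 6 ↦ ¬4 * a i = e).card : ℤ) =
      6 - (Finset.univ.filter fun i ↦ 4 * a i = e).card := by omega
    rw [h6'] at h
    have h7 : (((Finset.univ.filter fun i ↦ 4 * a i = e).card : ℤ) - 4) * e = 0 := by
      linear_combination -h
    have := (mul_eq_zero.1 h7).resolve_right he.ne'
    omega
  obtain ⟨σ, hσ⟩ := Equiv.Perm.exists_map_finset_eq ({0, 1, 2, 3} : Finset (Fin 6))
    (Finset.univ.filter fun i ↦ 4 * a i = e) (by rw [hcard]; rfl)
  have hmem : ∀ i, i ∈ ({0, 1, 2, 3} : Finset (Fin 6)) ↔ 4 * a (σ i) = e := by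
    intro i
    rw [← Finset.mem_map' σ.toEmbedding, hσ]
    simp
  have h0 := (hmem 0).1 (by decide)
  refine ⟨σ, a (σ 0), by omega, fun i ↦ ?_⟩
  rw [ha, exp_inj]
  have h1 := hmem i
  have h2 := ha' (σ i)
  fin_cases i <;> simp at h1 h2 ⊢ <;> omega

theorem IsRootData.exists_isDyadic (H : IsRootData F α β) {e : ℤ} (he : 0 < e)
    (h2 : v 2 = exp (-e)) (h3 : v 3 = 1) (h5 : v 5 = 1) (h7 : v 7 = 1) :
    ∃ (σ : Equiv.Perm (Fin 5)) (τ : Equiv.Perm (Fin 6)) (n : ℤ)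
      (ω : ResidueField v.valuationSubring), e = 4 * n ∧ IsDyadic F v (α ∘ σ) (β ∘ τ) n ω := by
  have h2' : v 2 < 1 := by
    rw [h2, ← exp_zero, exp_lt_exp]
    omega
  obtain ⟨τ, n, rfl, hτ⟩ := H.exists_perm_β he h2 h5
  obtain ⟨ω, σ, hω, hσ⟩ := exists_perm_of_map_quintic
    (k := ResidueField v.valuationSubring) (g := fun i ↦ v.res (α i))
    (by
      rw [← res_eq_zero_iff h2'.le] at h2'
      rw [← h2', show (2 : M) = ((2 : ℤ) : M) by norm_num, res_intCast]
      norm_num) (map_res_eq_prod H.map_quintic monic_quintic)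
  exact ⟨σ, τ, n, ω, rfl,
    { toIsRootData := H.comp σ τ
      pos := by omega
      map_two := h2
      map_three := h3
      map_five := h5
      map_seven := h7
      map_β := hτ
      omega_sq := hω
      res_α := fun i ↦ congrFun hσ i }⟩

end

namespace IsDyadic

variable {F M : Type*} [Field F] [Field M] [Algebra F M] {α : Fin 5 → M} {β : Fin 6 → M}
  {v : Valuation M ℤᵐ⁰} {n : ℤ} {ω : ResidueField v.valuationSubring}

section

variable (D : IsDyadic F v α β n ω)
include D

theorem map_two_lt_one : v 2 < 1 := by
  rw [D.map_two, ← exp_zero, exp_lt_exp]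
  have := D.pos
  omega

theorem two_eq_zero : (2 : ResidueField v.valuationSubring) = 0 := by
  have h2' := D.map_two_lt_one
  rw [← res_eq_zero_iff h2'.le] at h2'
  rw [← h2', show (2 : M) = ((2 : ℤ) : M) by norm_num, res_intCast]
  norm_num

theorem omega_ne_zero : ω ≠ 0 := by
  rintro rfl
  exact one_ne_zero (α := ResidueField v.valuationSubring) (by linear_combination D.omega_sq)

theorem omega_ne_one : ω ≠ 1 := by
  rintro rfl
  exact one_ne_zero (α := ResidueField v.valuationSubring)
    (by linear_combination D.omega_sq - D.two_eq_zero)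

theorem map_sub_α_eq_one {i j : Fin 5} (h : ![ω, ω, ω + 1, ω + 1, 1] i ≠ ![ω, ω, ω + 1, ω + 1, 1] j) :
    v (α i - α j) = 1 := by
  have hi := D.map_α_le_one v i
  have hj := D.map_α_le_one v j
  refine le_antisymm (v.map_sub_le hi hj) (not_lt.1 fun hlt ↦ h ?_)
  rw [← D.res_α, ← D.res_α, res_eq_res_iff hi hj]
  exact hlt

theorem map_sub_four_five : v (β 4 - β 5) = exp (-(6 * n)) := by
  have hpos := D.pos
  have h2 := D.map_two
  have h4 : v (β 4) = exp (-(2 * n)) := D.map_β 4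
  have h2' := OrdGE.of_eq h2
  have h4' := OrdGE.of_eq h4
  have h1 : v.OrdGE 0 (1 : M) := by simp [OrdGE]
  have hd : v (aeval (β 4) (derivative sextic)) = exp (-(10 * n)) := by
    have hmain := map_mul_eq_exp (map_pow_eq_exp h2 2) h4
    have := map_add_eq_exp hmain (OrdGE.sum_monomials (N := 10 * n + 1) h2' h4' h1 h1
      [(3, 1, 5, 0, 0), (-5, 1, 4, 0, 0), (1, 4, 3, 0, 0), (-3, 3, 2, 0, 0), (3, 3, 0, 0, 0)]
      (by simp; omega)) (by push_cast; omega)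
    rw [aeval_derivative_sextic]
    convert this using 2
    · simp
      ring
    · push_cast
      ring
  rw [aeval_derivative_eq_prod D.map_sextic, show (Finset.univ.erase (4 : Fin 6)) =
    {0, 1, 2, 3, 5} by decide] at hd
  have hb : ∀ i : Fin 6, v (β i) = exp (-(1 * n)) → v (β 4 - β i) = exp (-n) := by
    intro i hi
    have := map_add_eq_exp hi h4'.neg (by omega)
    rw [← neg_sub, Valuation.map_neg, sub_eq_add_neg, this, one_mul]
  rw [map_prod] at hd
  simp only [Finset.prod_insert (show (0 : Fin 6) ∉ ({1, 2, 3, 5} : Finset (Fin 6)) by decide),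
    Finset.prod_insert (show (1 : Fin 6) ∉ ({2, 3, 5} : Finset (Fin 6)) by decide),
    Finset.prod_insert (show (2 : Fin 6) ∉ ({3, 5} : Finset (Fin 6)) by decide),
    Finset.prod_insert (show (3 : Fin 6) ∉ ({5} : Finset (Fin 6)) by decide),
    Finset.prod_singleton, hb 0 (D.map_β 0), hb 1 (D.map_β 1), hb 2 (D.map_β 2),
    hb 3 (D.map_β 3)] at hd
  have h0 : β 4 - β 5 ≠ 0 := by
    intro h0
    rw [h0] at hd
    simp at hd
    exact exp_ne_zero hd.symm
  obtain ⟨d, hd'⟩ := exists_map_eq_exp (v := v) h0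
  rw [hd', ← exp_add, ← exp_add, ← exp_add, ← exp_add, exp_inj] at hd
  rw [hd', exp_inj]
  omega

end

end IsDyadic

end

section

open WithZero Valuation IsLocalRing

/-- `φ` preserves `v` and induces the squaring map on the residue field. -/
structure IsSqFrobenius {F M : Type*} [Field F] [Field M] [Algebra F M] (v : Valuation M ℤᵐ⁰)
    (φ : Gal(M/F)) : Prop where
  map_apply : ∀ x, v (φ x) = v x
  map_apply_sub_sq_lt : ∀ x, v x ≤ 1 → v (φ x - x ^ 2) < 1

section

variable {F M : Type*} [Field F] [Field M] [Algebra F M] {v : Valuation M ℤᵐ⁰}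
  {I : Subgroup Gal(M/F)} {φ : Gal(M/F)}

theorem IsTotallyRamified.res_apply (h : IsTotallyRamified v I) {σ : Gal(M/F)} (hσ : σ ∈ I) {x : M}
    (hx : v x ≤ 1) : v.res (σ x) = v.res x := by
  rw [res_eq_res_iff (by rwa [h.map_apply σ hσ]) hx]
  exact h.map_apply_sub_lt σ hσ x hx

theorem IsSqFrobenius.res_apply (hφ : IsSqFrobenius v φ) {x : M} (hx : v x ≤ 1) :
    v.res (φ x) = v.res x ^ 2 := by
  rw [← res_pow hx, res_eq_res_iff (by rwa [hφ.map_apply]) (map_pow_le_one hx 2)]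
  exact hφ.map_apply_sub_sq_lt x hx

end

namespace IsDyadic

variable {F M : Type*} [Field F] [Field M] [Algebra F M] {α : Fin 5 → M} {β : Fin 6 → M}
  {v : Valuation M ℤᵐ⁰} {n : ℤ} {ω : ResidueField v.valuationSubring} {I : Subgroup Gal(M/F)}
  {φ : Gal(M/F)}

theorem prod_sub_α_eq (α : Fin 5 → M) : ∏ i, ∏ j > i, (α j - α i) = (α 0 - α 1) * (α 2 - α 3) *
    ((α 2 - α 0) * (α 3 - α 0) * (α 2 - α 1) * (α 3 - α 1) * (α 4 - α 0) * (α 4 - α 1) *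
      (α 4 - α 2) * (α 4 - α 3)) := by
  have e0 : Finset.Ioi (0 : Fin 5) = {1, 2, 3, 4} := by decide
  have e1 : Finset.Ioi (1 : Fin 5) = {2, 3, 4} := by decide
  have e2 : Finset.Ioi (2 : Fin 5) = {3, 4} := by decide
  have e3 : Finset.Ioi (3 : Fin 5) = {4} := by decide
  have e4 : Finset.Ioi (4 : Fin 5) = ∅ := by decide
  rw [Fin.prod_univ_five, e0, e1, e2, e3, e4]
  simp [Finset.prod_insert]
  ring

section

variable (D : IsDyadic F v α β n ω)
include D

theorem eq_zero_or_eq_one {j : Fin 5} (h : v.res (α j) = ω) : j = 0 ∨ j = 1 := by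
  rw [D.res_α] at h
  have h1 := D.omega_ne_one
  fin_cases j <;> simp_all

theorem eq_two_or_eq_three {j : Fin 5} (h : v.res (α j) = ω + 1) : j = 2 ∨ j = 3 := by
  rw [D.res_α] at h
  have h0 := D.omega_ne_zero
  fin_cases j <;> simp_all

theorem eq_four {j : Fin 5} (h : v.res (α j) = 1) : j = 4 := by
  rw [D.res_α] at h
  have h0 := D.omega_ne_zero
  have h1 := D.omega_ne_one
  fin_cases j <;> simp_all

theorem exists_apply_α (σ : Gal(M/F)) (i : Fin 5) : ∃ j, σ (α i) = α j :=
  exists_apply_root_eq D.map_quintic σ i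

theorem exists_apply_β (σ : Gal(M/F)) (i : Fin 6) : ∃ j, σ (β i) = β j :=
  exists_apply_root_eq D.map_sextic σ i

theorem apply_α_of_mem [CharZero M] (h : IsTotallyRamified v I) {σ : Gal(M/F)} (hσ : σ ∈ I) :
    (σ (α 0) = α 0 ∧ σ (α 1) = α 1 ∨ σ (α 0) = α 1 ∧ σ (α 1) = α 0) ∧
    (σ (α 2) = α 2 ∧ σ (α 3) = α 3 ∨ σ (α 2) = α 3 ∧ σ (α 3) = α 2) ∧ σ (α 4) = α 4 := by
  have key : ∀ i, ∃ j, σ (α i) = α j ∧ v.res (α j) = v.res (α i) := by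
    intro i
    obtain ⟨j, hj⟩ := D.exists_apply_α σ i
    exact ⟨j, hj, by rw [← hj, h.res_apply hσ (D.map_α_le_one v i)]⟩
  have hinj : ∀ {i j k : Fin 5}, σ (α i) = α k → σ (α j) = α k → i = j := fun hi hj ↦
    D.injective_α (σ.injective (hi.trans hj.symm))
  obtain ⟨j0, h0, r0⟩ := key 0
  obtain ⟨j1, h1, r1⟩ := key 1
  obtain ⟨j2, h2, r2⟩ := key 2
  obtain ⟨j3, h3, r3⟩ := key 3
  obtain ⟨j4, h4, r4⟩ := key 4
  rw [D.res_α 0] at r0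
  rw [D.res_α 1] at r1
  rw [D.res_α 2] at r2
  rw [D.res_α 3] at r3
  rw [D.res_α 4] at r4
  obtain rfl := D.eq_four r4
  refine ⟨?_, ?_, h4⟩
  · rcases D.eq_zero_or_eq_one r0 with rfl | rfl <;> rcases D.eq_zero_or_eq_one r1 with rfl | rfl
    · exact absurd (hinj h0 h1) (by decide)
    · exact Or.inl ⟨h0, h1⟩
    · exact Or.inr ⟨h0, h1⟩
    · exact absurd (hinj h0 h1) (by decide)
  · rcases D.eq_two_or_eq_three r2 with rfl | rfl <;>
      rcases D.eq_two_or_eq_three r3 with rfl | rfl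
    · exact absurd (hinj h2 h3) (by decide)
    · exact Or.inl ⟨h2, h3⟩
    · exact Or.inr ⟨h2, h3⟩
    · exact absurd (hinj h2 h3) (by decide)

theorem apply_sub_α [CharZero M] (hφ : IsSqFrobenius v φ) :
    (φ (α 0 - α 1) = α 2 - α 3 ∨ φ (α 0 - α 1) = -(α 2 - α 3)) ∧
    (φ (α 2 - α 3) = α 0 - α 1 ∨ φ (α 2 - α 3) = -(α 0 - α 1)) := by
  have key : ∀ i, ∃ j, φ (α i) = α j ∧ v.res (α j) = v.res (α i) ^ 2 := by
    intro i
    obtain ⟨j, hj⟩ := D.exists_apply_α φ i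
    exact ⟨j, hj, by rw [← hj, hφ.res_apply (D.map_α_le_one v i)]⟩
  have hinj : ∀ {i j k : Fin 5}, φ (α i) = α k → φ (α j) = α k → i = j := fun hi hj ↦
    D.injective_α (φ.injective (hi.trans hj.symm))
  obtain ⟨j0, h0, r0⟩ := key 0
  obtain ⟨j1, h1, r1⟩ := key 1
  obtain ⟨j2, h2, r2⟩ := key 2
  obtain ⟨j3, h3, r3⟩ := key 3
  have e1 : ω ^ 2 = ω + 1 := by linear_combination D.omega_sq - (ω + 1) * D.two_eq_zero
  have e2 : (ω + 1) ^ 2 = ω := by linear_combination D.omega_sq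
  rw [D.res_α 0] at r0
  rw [D.res_α 1] at r1
  rw [D.res_α 2] at r2
  rw [D.res_α 3] at r3
  simp only [Matrix.cons_val] at r0 r1 r2 r3
  rw [e1] at r0 r1
  rw [e2] at r2 r3
  rw [_root_.map_sub, _root_.map_sub, h0, h1, h2, h3]
  constructor
  · rcases D.eq_two_or_eq_three r0 with rfl | rfl <;> rcases D.eq_two_or_eq_three r1 with rfl | rfl
    · exact absurd (hinj h0 h1) (by decide)
    · exact Or.inl rfl
    · exact Or.inr (neg_sub _ _).symm
    · exact absurd (hinj h0 h1) (by decide)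
  · rcases D.eq_zero_or_eq_one r2 with rfl | rfl <;> rcases D.eq_zero_or_eq_one r3 with rfl | rfl
    · exact absurd (hinj h2 h3) (by decide)
    · exact Or.inl rfl
    · exact Or.inr (neg_sub _ _).symm
    · exact absurd (hinj h2 h3) (by decide)

theorem eq_four_or_eq_five {j : Fin 6} (h : v (β j) = exp (-(2 * n))) : j = 4 ∨ j = 5 := by
  have := D.pos
  rw [D.map_β, exp_inj] at h
  fin_cases j <;> simp at h ⊢ <;> omega

theorem lt_four {j : Fin 6} (h : v (β j) = exp (-n)) : j < 4 := by
  have := D.pos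
  rw [D.map_β, exp_inj] at h
  fin_cases j <;> simp at h ⊢
  all_goals omega

theorem map_β_of_lt {j : Fin 6} (h : j < 4) : v (β j) = exp (-n) := by
  rw [D.map_β, exp_inj]
  fin_cases j <;> simp at h ⊢

theorem apply_β_four_five [CharZero M] {σ : Gal(M/F)} (hσ : ∀ x, v (σ x) = v x) :
    σ (β 4) = β 4 ∧ σ (β 5) = β 5 ∨ σ (β 4) = β 5 ∧ σ (β 5) = β 4 := by
  obtain ⟨j4, h4⟩ := D.exists_apply_β σ 4
  obtain ⟨j5, h5⟩ := D.exists_apply_β σ 5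
  have hinj : ∀ {i j k : Fin 6}, σ (β i) = β k → σ (β j) = β k → i = j := fun hi hj ↦
    D.injective_β (σ.injective (hi.trans hj.symm))
  have r4 := hσ (β 4)
  have r5 := hσ (β 5)
  rw [h4, D.map_β 4] at r4
  rw [h5, D.map_β 5] at r5
  rcases D.eq_four_or_eq_five r4 with rfl | rfl <;> rcases D.eq_four_or_eq_five r5 with rfl | rfl
  · exact absurd (hinj h4 h5) (by decide)
  · exact Or.inl ⟨h4, h5⟩
  · exact Or.inr ⟨h4, h5⟩
  · exact absurd (hinj h4 h5) (by decide)

theorem exists_lt_four {σ : Gal(M/F)} (hσ : ∀ x, v (σ x) = v x) {i : Fin 6} (hi : i < 4) :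
    ∃ j < 4, σ (β i) = β j := by
  obtain ⟨j, hj⟩ := D.exists_apply_β σ i
  refine ⟨j, D.lt_four ?_, hj⟩
  rw [← hj, hσ, D.map_β_of_lt hi]

theorem map_sub_α [CharZero M] (hφ : IsSqFrobenius v φ) :
    v (α 0 - α 1) = exp (-(6 * n)) ∧ v (α 2 - α 3) = exp (-(6 * n)) := by
  have h1 : v (α 2 - α 3) = v (α 0 - α 1) := by
    rw [← hφ.map_apply (α 0 - α 1)]
    rcases (D.apply_sub_α hφ).1 with h | h
    · rw [h]
    · rw [h, Valuation.map_neg]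
  have h := congrArg v D.sq_prod_sub_α
  have h0 := D.omega_ne_zero
  have hω1 := D.omega_ne_one
  rw [prod_sub_α_eq, map_pow, map_mul, map_mul, h1, map_mul, map_mul, map_mul, map_mul, map_mul,
    map_mul, map_mul, D.map_sub_α_eq_one (i := 2) (j := 0) (by simp),
    D.map_sub_α_eq_one (i := 3) (j := 0) (by simp), D.map_sub_α_eq_one (i := 2) (j := 1) (by simp),
    D.map_sub_α_eq_one (i := 3) (j := 1) (by simp),
    D.map_sub_α_eq_one (i := 4) (j := 0) (by simpa using hω1.symm),
    D.map_sub_α_eq_one (i := 4) (j := 1) (by simpa using hω1.symm),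
    D.map_sub_α_eq_one (i := 4) (j := 2) (by simpa using h0),
    D.map_sub_α_eq_one (i := 4) (j := 3) (by simpa using h0),
    show (336063168 : M) = 2 ^ 6 * 3 ^ 7 * 7 ^ 4 by norm_num, map_mul, map_mul, map_pow v 3,
    map_pow v 7, D.map_three, D.map_seven, map_pow_eq_exp D.map_two] at h
  simp only [mul_one, one_pow] at h
  have hne : α 0 - α 1 ≠ 0 := sub_ne_zero.2 fun h ↦ absurd (D.injective_α h) (by decide)
  obtain ⟨d, hd⟩ := exists_map_eq_exp (v := v) hne
  rw [h1, and_self, hd, exp_inj]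
  rw [hd, ← exp_add, ← exp_nsmul, exp_inj, nsmul_eq_mul] at h
  push_cast at h
  omega

/-- `√3`, up to sign, expressed through the discriminant of `f₁`. -/
theorem exists_sqrt_three [CharZero M] : ∃ s : M, s ^ 2 = 3 ∧
    (α 0 - α 1) * (α 2 - α 3) * ((α 2 - α 0) * (α 3 - α 0) * (α 2 - α 1) * (α 3 - α 1) *
      (α 4 - α 0) * (α 4 - α 1) * (α 4 - α 2) * (α 4 - α 3)) = 10584 * s := by
  refine ⟨(∏ i, ∏ j > i, (α j - α i)) / 10584, ?_, ?_⟩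
  · rw [div_pow, D.sq_prod_sub_α]
    norm_num
  · rw [← prod_sub_α_eq]
    field_simp

/-- `√3 - 1` is not fixed by inertia above `2`. -/
theorem apply_ne_of_sq_eq_three [CharZero M] (h : IsTotallyRamified v I)
    (hcard : (Nat.card I : ℤ) = 4 * n) {s : M} (hs : s ^ 2 = 3) : ∃ σ ∈ I, σ s ≠ s := by
  by_contra! hfix
  have hpos := D.pos
  have hprod : (s - 1) * (s + 1) = 2 := by linear_combination hs
  have h0 : s - 1 ≠ 0 := by
    intro h0
    rw [h0] at hprod
    norm_num at hprod
  obtain ⟨k, hk⟩ := h.exists_eq_exp (s - 1) h0 fun σ hσ ↦ by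
    rw [_root_.map_sub, hfix σ hσ, map_one]
  rw [hcard] at hk
  obtain ⟨a, ha⟩ : ∃ a : ℤ, v (s - 1) = exp (-a) := ⟨_, by rw [hk, neg_neg]⟩
  have hka : k * (4 * n) = -a := by rwa [hk, exp_inj] at ha
  rcases lt_or_ge a (4 * n) with hlt | hge
  · have h1 := map_add_eq_exp ha (OrdGE.of_eq D.map_two) hlt
    rw [show s - 1 + 2 = s + 1 by ring] at h1
    have h2 := map_mul_eq_exp ha h1
    rw [hprod, D.map_two, exp_inj] at h2
    have : n * (2 * k + 1) = 0 := by linarith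
    rcases mul_eq_zero.1 this with h3 | h3 <;> omega
  · have h1 := ((OrdGE.of_eq ha).mono hge).add (OrdGE.of_eq D.map_two)
    rw [show s - 1 + 2 = s + 1 by ring] at h1
    have h2 := (OrdGE.of_eq ha).mul h1
    rw [hprod, ordGE_iff_of_eq D.map_two] at h2
    omega

/-- A nonzero element of valuation not divisible by `4 * n` is moved by inertia. -/
theorem exists_apply_ne (h : IsTotallyRamified v I) (hcard : (Nat.card I : ℤ) = 4 * n) {x : M}
    {a : ℤ} (hx : v x = exp (-(a * n))) (ha : ¬4 ∣ a) : ∃ σ ∈ I, σ x ≠ x := by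
  by_contra! hfix
  obtain ⟨k, hk⟩ := h.exists_eq_exp x (ne_zero_of_map_eq_exp hx) hfix
  rw [hcard, hx, exp_inj] at hk
  have : n * (4 * k + a) = 0 := by linarith
  rcases mul_eq_zero.1 this with h3 | h3
  · exact D.pos.ne' h3
  · exact ha (by omega)

end

end IsDyadic

end

section

open WithZero Valuation IsLocalRing

theorem IsTotallyRamified.exists_signHom {F M : Type*} [Field F] [Field M] [CharZero M]
    [Algebra F M] (I : Subgroup Gal(M/F)) {y : M} (hy : y ≠ 0)
    (h : ∀ σ ∈ I, σ y = y ∨ σ y = -y) :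
    ∃ χ : I →* ℤˣ, ∀ σ : I, σ.1 y = ((χ σ : ℤ) : M) * y := by
  have hex : ∀ σ : I, ∃ u : ℤˣ, σ.1 y = ((u : ℤ) : M) * y := by
    intro σ
    rcases h σ.1 σ.2 with h | h
    · exact ⟨1, by simpa using h⟩
    · exact ⟨-1, by simpa using h⟩
  have hinj : ∀ u u' : ℤˣ, ((u : ℤ) : M) * y = ((u' : ℤ) : M) * y → u = u' := fun u u' huu ↦
    Units.ext (Int.cast_injective (mul_right_cancel₀ hy huu))
  choose χ hχ using hex
  refine ⟨⟨⟨χ, ?_⟩, fun σ τ ↦ ?_⟩, hχ⟩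
  · refine hinj _ _ ?_
    rw [← hχ]
    simp
  · refine hinj _ _ ?_
    rw [← hχ, Subgroup.coe_mul, AlgEquiv.mul_apply, hχ τ, map_mul, map_intCast, hχ σ]
    push_cast
    ring

theorem Subgroup.eq_top_of_swap_mem {S : Subgroup (ℤˣ × ℤˣ × ℤˣ)}
    (hswap : ∀ a b c, (a, b, c) ∈ S → (b, a, c) ∈ S)
    (h1 : ∃ x ∈ S, x.1 ≠ x.2.1) (h2 : ∃ x ∈ S, x.2.2 ≠ 1)
    (h3 : ∃ x ∈ S, x.1 * x.2.1 * x.2.2 ≠ 1) : S = ⊤ := by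
  obtain ⟨⟨b0, b1, b2⟩, hb, hb2⟩ := h2
  obtain ⟨⟨c0, c1, c2⟩, hc, hc2⟩ := h3
  obtain ⟨s, hp⟩ : ∃ s, (-1, 1, s) ∈ S := by
    obtain ⟨⟨a0, a1, s⟩, ha, hne⟩ := h1
    rcases Int.units_eq_one_or a0 with rfl | rfl <;> rcases Int.units_eq_one_or a1 with rfl | rfl
    · exact absurd rfl hne
    · exact ⟨s, hswap _ _ _ ha⟩
    · exact ⟨s, ha⟩
    · exact absurd rfl hne
  have hp' := hswap _ _ _ hp
  have he3 : ((1, 1, -1) : ℤˣ × ℤˣ × ℤˣ) ∈ S := by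
    rcases Int.units_eq_one_or s with rfl | rfl
    · have hb2' := (Int.units_eq_one_or b2).resolve_left hb2
      subst hb2'
      rcases Int.units_eq_one_or b0 with rfl | rfl <;>
        rcases Int.units_eq_one_or b1 with rfl | rfl
      · exact hb
      · simpa using S.mul_mem hb hp'
      · simpa using S.mul_mem hb hp
      · simpa using S.mul_mem (S.mul_mem hb hp) hp'
    · rcases Int.units_eq_one_or c0 with rfl | rfl <;>
        rcases Int.units_eq_one_or c1 with rfl | rfl <;>
        rcases Int.units_eq_one_or c2 with rfl | rfl <;> simp at hc2
      · exact hc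
      · simpa using S.mul_mem hc hp'
      · simpa using S.mul_mem hc hp
      · simpa using S.mul_mem (S.mul_mem hc hp) hp'
  have he1 : ((-1, 1, 1) : ℤˣ × ℤˣ × ℤˣ) ∈ S := by
    rcases Int.units_eq_one_or s with rfl | rfl
    · exact hp
    · simpa using S.mul_mem hp he3
  have he2 := hswap _ _ _ he1
  rw [eq_top_iff]
  rintro ⟨x, y, z⟩ -
  have hx : (x, 1, 1) ∈ S := by
    rcases Int.units_eq_one_or x with rfl | rfl
    exacts [S.one_mem, he1]
  have hy : (1, y, 1) ∈ S := by
    rcases Int.units_eq_one_or y with rfl | rfl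
    exacts [S.one_mem, he2]
  have hz : (1, 1, z) ∈ S := by
    rcases Int.units_eq_one_or z with rfl | rfl
    exacts [S.one_mem, he3]
  simpa using S.mul_mem (S.mul_mem hx hy) hz

theorem Valuation.OrdGE.of_lt {M : Type*} [Field M] {v : Valuation M ℤᵐ⁰} {x : M} {a : ℤ}
    (h : v x < exp (-a)) : v.OrdGE (a + 1) x := by
  have := le_exp_sub_one_of_lt h
  rwa [OrdGE, neg_add]

theorem Valuation.OrdGE.map_le_one {M : Type*} [Field M] {v : Valuation M ℤᵐ⁰} {x : M} {a : ℤ}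
    (h : v.OrdGE a x) (ha : 0 ≤ a) : v x ≤ 1 := by
  have := h.mono ha
  rwa [OrdGE, neg_zero, exp_zero] at this

theorem Valuation.OrdGE.div {M : Type*} [Field M] {v : Valuation M ℤᵐ⁰} {x y : M} {a b : ℤ}
    (h : v.OrdGE a x) (hy : v y = exp (-b)) : v.OrdGE (a - b) (x / y) := by
  rw [OrdGE, map_div₀, hy, div_le_iff₀ (zero_lt_iff.2 exp_ne_zero), ← exp_add,
    show -(a - b) + -b = -a by ring]
  exact h

theorem Valuation.res_add_of_lt {M : Type*} [Field M] {v : Valuation M ℤᵐ⁰} {x y : M}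
    (hx : v x ≤ 1) (hy : v y < 1) : v.res (x + y) = v.res x := by
  rw [res_add hx hy.le, (res_eq_zero_iff hy.le).2 hy, add_zero]

namespace IsDyadic

variable {F M : Type*} [Field F] [Field M] [Algebra F M] {α : Fin 5 → M} {β : Fin 6 → M}
  {v : Valuation M ℤᵐ⁰} {n : ℤ} {ω : ResidueField v.valuationSubring} {I : Subgroup Gal(M/F)}
  {φ : Gal(M/F)}

/-- The additive character of inertia given by its action on a root of `f₂` of minimal positive
valuation. -/
noncomputable def kappa (v : Valuation M ℤᵐ⁰) (β : Fin 6 → M) (σ : Gal(M/F)) :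
    ResidueField v.valuationSubring :=
  v.res ((σ (β 0) - β 0) / β 0 ^ 2)

section

variable (D : IsDyadic F v α β n ω)
include D

theorem map_β_zero : v (β 0) = exp (-n) := D.map_β_of_lt (by decide)

theorem map_β_zero_sq : v (β 0 ^ 2) = exp (-(2 * n)) := by
  simpa using map_pow_eq_exp D.map_β_zero 2

theorem β_zero_ne_zero : β 0 ≠ 0 := ne_zero_of_map_eq_exp D.map_β_zero

theorem map_sub_β {i j : Fin 6} (hi : i < 4) (hj : j < 4) (hne : β j ≠ β i) :
    v (β j - β i) = exp (-(2 * n)) ∧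
      v (((β j - β i) / β i ^ 2) ^ 3 + (β j - β i) / β i ^ 2 + 1) < 1 :=
  map_sub_root_sextic D.pos D.map_two D.map_three D.map_five (D.aeval_β i) (D.aeval_β j)
    (D.map_β_of_lt hi) (D.map_β_of_lt hj) hne

theorem ordGE_sub_β {i j : Fin 6} (hi : i < 4) (hj : j < 4) : v.OrdGE (2 * n) (β j - β i) := by
  by_cases hne : β j = β i
  · rw [hne, sub_self]
    exact OrdGE.zero
  · exact OrdGE.of_eq (D.map_sub_β hi hj hne).1

theorem β_eq_of_ordGE {i j : Fin 6} (hi : i < 4) (hj : j < 4)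
    (h : v.OrdGE (2 * n + 1) (β j - β i)) : β j = β i := by
  by_contra hne
  rw [ordGE_iff_of_eq (D.map_sub_β hi hj hne).1] at h
  omega

theorem ordGE_apply_sub_β {σ : Gal(M/F)} (hσ : ∀ x, v (σ x) = v x) {i : Fin 6} (hi : i < 4) :
    v.OrdGE (2 * n) (σ (β i) - β i) := by
  obtain ⟨j, hj, h⟩ := D.exists_lt_four hσ hi
  rw [h]
  exact D.ordGE_sub_β hi hj

theorem map_kappa_le_one {σ : Gal(M/F)} (hσ : ∀ x, v (σ x) = v x) :
    v ((σ (β 0) - β 0) / β 0 ^ 2) ≤ 1 :=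
  ((D.ordGE_apply_sub_β hσ (by decide)).div D.map_β_zero_sq).map_le_one (by omega)

theorem ordGE_apply_sub (h : IsTotallyRamified v I) {σ : Gal(M/F)} (hσ : σ ∈ I) {x : M}
    (hx : v.OrdGE (2 * n) x) : v.OrdGE (2 * n + 1) (σ x - x) := by
  have hpos := D.pos
  have hc := hx.div D.map_β_zero_sq
  rw [sub_self] at hc
  have hb := D.ordGE_apply_sub_β (h.map_apply σ hσ) (i := 0) (by decide)
  have hb0 : v.OrdGE n (β 0) := OrdGE.of_eq D.map_β_zero
  have hσb0 : v.OrdGE n (σ (β 0)) := by rwa [OrdGE, h.map_apply σ hσ]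
  have h0 := D.β_zero_ne_zero
  generalize hcx : x / β 0 ^ 2 = c at hc
  have hxc : x = c * β 0 ^ 2 := by rw [← hcx]; field_simp
  have h1 : v.OrdGE (0 + 1) (σ c - c) := OrdGE.of_lt (by
    rw [neg_zero, exp_zero]
    exact h.map_apply_sub_lt σ hσ c (hc.map_le_one le_rfl))
  have h2 : σ x - x = (σ c - c) * σ (β 0) ^ 2 + c * ((σ (β 0) - β 0) * (σ (β 0) + β 0)) := by
    rw [hxc, map_mul, map_pow]
    ring
  rw [h2]
  refine ((h1.mul (hσb0.pow 2)).mono ?_).add ((hc.mul (hb.mul (hσb0.add hb0))).mono ?_)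
  · push_cast
    omega
  · omega

theorem ordGE_of_kappa_eq_zero {σ : Gal(M/F)} (hσ : ∀ x, v (σ x) = v x)
    (h0 : kappa v β σ = 0) : v.OrdGE (2 * n + 1) (σ (β 0) - β 0) := by
  rw [kappa, res_eq_zero_iff (D.map_kappa_le_one hσ)] at h0
  have h1 : v.OrdGE (0 + 1) ((σ (β 0) - β 0) / β 0 ^ 2) := OrdGE.of_lt (by simpa using h0)
  have h2 := h1.mul (OrdGE.of_eq D.map_β_zero_sq)
  rw [div_mul_cancel₀ _ (pow_ne_zero 2 D.β_zero_ne_zero)] at h2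
  exact h2.mono (by omega)

theorem apply_eq_of_kappa_eq_zero (h : IsTotallyRamified v I) {σ : Gal(M/F)} (hσ : σ ∈ I)
    (h0 : kappa v β σ = 0) {i : Fin 6} (hi : i < 4) : σ (β i) = β i := by
  obtain ⟨j, hj, hij⟩ := D.exists_lt_four (h.map_apply σ hσ) hi
  rw [hij]
  refine D.β_eq_of_ordGE hi hj ?_
  rw [← hij]
  convert (D.ordGE_of_kappa_eq_zero (h.map_apply σ hσ) h0).add
    (D.ordGE_apply_sub h hσ (D.ordGE_sub_β (i := 0) (by decide) hi)) using 1
  rw [_root_.map_sub]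
  ring

theorem kappa_mul (h : IsTotallyRamified v I) {σ τ : Gal(M/F)} (hσ : σ ∈ I) (hτ : τ ∈ I) :
    kappa v β (σ * τ) = kappa v β σ + kappa v β τ := by
  have h1 := D.map_kappa_le_one (h.map_apply σ hσ)
  have h2 := D.map_kappa_le_one (h.map_apply τ hτ)
  have h3 := (D.ordGE_apply_sub h hσ
    (D.ordGE_apply_sub_β (h.map_apply τ hτ) (i := 0) (by decide))).div D.map_β_zero_sq
  rw [kappa, kappa, kappa, ← res_add h1 h2, ← res_add_of_lt (v.map_add_le h1 h2)
    (h3.lt_one (by omega))]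
  congr 1
  rw [AlgEquiv.mul_apply, _root_.map_sub]
  ring

theorem map_apply_sub_of_kappa_ne_zero {σ : Gal(M/F)} (hσ : ∀ x, v (σ x) = v x)
    (h0 : kappa v β σ ≠ 0) :
    v (σ (β 0) - β 0) = exp (-(2 * n)) ∧ kappa v β σ ^ 3 + kappa v β σ + 1 = 0 := by
  obtain ⟨j, hj, hij⟩ := D.exists_lt_four hσ (i := 0) (by decide)
  have hne : β j ≠ β 0 := by
    intro hj0
    apply h0
    rw [kappa, hij, hj0, sub_self, zero_div]
    exact (res_eq_zero_iff (by simp)).2 (by simp)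
  obtain ⟨h1, h2⟩ := D.map_sub_β (i := 0) (by decide) hj hne
  rw [hij]
  refine ⟨h1, ?_⟩
  have h3 := D.map_kappa_le_one hσ
  rw [← hij] at h2
  have h4 := map_pow_le_one h3 3
  rw [kappa, ← res_pow h3, ← res_add h4 h3, ← res_one, ← res_add (v.map_add_le h4 h3)
    (map_one v).le]
  exact (res_eq_zero_iff h2.le).2 h2

theorem kappa_conj (h : IsTotallyRamified v I) (hφ : IsSqFrobenius v φ) {σ : Gal(M/F)}
    (hσ : σ ∈ I) : kappa v β (φ * σ * φ⁻¹) = kappa v β σ ^ 2 := by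
  have hpos := D.pos
  have hφ' : ∀ x, v (φ⁻¹ x) = v x := fun x ↦ by
    rw [← hφ.map_apply (φ⁻¹ x)]
    exact congrArg v (φ.apply_symm_apply x)
  obtain ⟨j, hj, hj0⟩ := D.exists_lt_four hφ' (i := 0) (by decide)
  have hφj : φ (β j) = β 0 := by
    rw [← hj0]
    exact φ.apply_symm_apply _
  have h1 := D.map_kappa_le_one (h.map_apply σ hσ)
  have h2 := (D.ordGE_apply_sub h hσ (D.ordGE_sub_β (i := 0) (by decide) hj))
  have h2' : v.OrdGE (2 * n + 1) (φ (σ (β j - β 0) - (β j - β 0))) := by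
    rwa [OrdGE, hφ.map_apply]
  have h3 := h2'.div D.map_β_zero_sq
  have hb := D.ordGE_apply_sub_β hφ.map_apply (i := 0) (by decide)
  have hb0 : v.OrdGE n (β 0) := OrdGE.of_eq D.map_β_zero
  have hφb0 : v.OrdGE n (φ (β 0)) := by rwa [OrdGE, hφ.map_apply]
  have h4 := (hb.mul (hφb0.add hb0)).div D.map_β_zero_sq
  have h0 := D.β_zero_ne_zero
  rw [kappa, kappa, ← hφ.res_apply h1]
  generalize hq : (σ (β 0) - β 0) / β 0 ^ 2 = q at h1 ⊢
  have hxq : σ (β 0) - β 0 = q * β 0 ^ 2 := by rw [← hq]; field_simp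
  have h1' : v (φ q) ≤ 1 := by rwa [hφ.map_apply]
  have h5 : v (φ q * ((φ (β 0) - β 0) * (φ (β 0) + β 0) / β 0 ^ 2)) < 1 := by
    rw [map_mul]
    exact mul_lt_one_of_nonneg_of_lt_one_right h1' zero_le (h4.lt_one (by omega))
  rw [← res_add_of_lt h1' h5, ← res_add_of_lt (v.map_add_le h1' h5.le) (h3.lt_one (by omega))]
  congr 1
  have h6 : (φ * σ * φ⁻¹) (β 0) = φ (σ (β j)) := by
    rw [AlgEquiv.mul_apply, AlgEquiv.mul_apply, hj0]
  have h7 : φ (σ (β 0)) = φ (β 0) + φ q * φ (β 0) ^ 2 := by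
    rw [← map_pow, ← map_mul, ← map_add, ← hxq]
    congr 1
    ring
  rw [h6, _root_.map_sub, _root_.map_sub, _root_.map_sub, _root_.map_sub, h7, hφj]
  field_simp
  ring

end

end IsDyadic

end

section

open WithZero Valuation IsLocalRing

open Classical in
theorem IsTotallyRamified.card_filter_mul_ncard_orbit {F M : Type*} [Field F] [Field M]
    [Algebra F M] [FiniteDimensional F M] (I : Subgroup Gal(M/F)) (y : M) (σ : I) :
    (Finset.univ.filter fun τ : I ↦ τ.1 y = σ.1 y).card * (MulAction.orbit I y).ncard =
      Nat.card I := by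
  have hstab : (Finset.univ.filter fun τ : I ↦ τ.1 y = σ.1 y).card =
      Nat.card (MulAction.stabilizer I y) := by
    rw [Nat.card_eq_fintype_card, Fintype.card_subtype]
    refine Finset.card_bij (fun τ _ ↦ σ⁻¹ * τ) ?_ ?_ ?_
    · intro τ hτ
      rw [Finset.mem_filter] at hτ ⊢
      refine ⟨Finset.mem_univ _, ?_⟩
      rw [MulAction.mem_stabilizer_iff, mul_smul, inv_smul_eq_iff]
      exact hτ.2
    · intro a _ b _ hab
      exact mul_left_cancel hab
    · intro τ hτ
      rw [Finset.mem_filter, MulAction.mem_stabilizer_iff] at hτ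
      refine ⟨σ * τ, ?_, by simp⟩
      rw [Finset.mem_filter]
      refine ⟨Finset.mem_univ _, ?_⟩
      change (σ * τ) • y = σ • y
      rw [mul_smul, hτ.2]
  have hmul := (MulAction.stabilizer I y).card_mul_index
  rwa [MulAction.index_stabilizer, ← hstab] at hmul

theorem IsTotallyRamified.map_apply_sub_eq_of_orbit {F M : Type*} [Field F] [Field M]
    [Algebra F M] [FiniteDimensional F M] {v : Valuation M ℤᵐ⁰} {I : Subgroup Gal(M/F)} {π : M}
    (h : IsTotallyRamified v I) (hπ : v π = exp (-1)) {y : M} (hy : v y ≤ 1) {s : Finset M}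
    (hs : ∀ τ ∈ I, τ y ∈ s) {k : ℕ} (hk : s.card * k ≤ Nat.card I) (σ : I)
    (hσ : v (σ.1 y - y) = exp (-(2 * k : ℤ)))
    (hwild : ∀ τ ∈ I, τ ≠ 1 → v (τ π - π) ≤ exp (-2)) :
    v (σ.1 π - π) = exp (-2) := by
  classical
  have hσ1 : ∀ τ : I, τ.1 y = σ.1 y → τ.1 ≠ 1 := by
    intro τ hτ h1
    rw [h1, AlgEquiv.one_apply] at hτ
    rw [← hτ, sub_self, map_zero] at hσ
    exact exp_ne_zero hσ.symm
  have hcard : k ≤ (Finset.univ.filter fun τ : I ↦ τ.1 y = σ.1 y).card := by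
    have horb : (MulAction.orbit I y).ncard ≤ s.card := by
      rw [← Set.ncard_coe_finset]
      refine Set.ncard_le_ncard ?_ s.finite_toSet
      rintro _ ⟨τ, rfl⟩
      exact hs τ.1 τ.2
    have hmul := card_filter_mul_ncard_orbit I y σ
    have hpos : 0 < s.card := Finset.card_pos.2 ⟨_, hs 1 I.one_mem⟩
    refine Nat.le_of_mul_le_mul_left ?_ hpos
    rw [mul_comm s.card (Finset.card _)]
    exact hk.trans (hmul.ge.trans (Nat.mul_le_mul_left _ horb))
  refine le_antisymm (hwild _ σ.2 (hσ1 σ rfl)) ?_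
  have hle := h.le_prod_coset hπ hy σ
  have hmem : σ ∈ Finset.univ.filter fun τ : I ↦ τ.1 y = σ.1 y := by simp
  rw [hσ, ← Finset.mul_prod_erase _ _ hmem] at hle
  have hrest : ∏ τ ∈ (Finset.univ.filter fun τ : I ↦ τ.1 y = σ.1 y).erase σ, v (τ.1 π - π) ≤
      exp (-(2 * k : ℤ) + 2) := by
    refine (Finset.prod_le_pow_card _ _ (exp (-2)) fun τ hτ ↦ ?_).trans ?_
    · rw [Finset.mem_erase, Finset.mem_filter] at hτ
      exact hwild _ τ.2 (hσ1 τ hτ.2.2)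
    · rw [Finset.card_erase_of_mem hmem, ← exp_nsmul, exp_le_exp, nsmul_eq_mul]
      push_cast [show 1 ≤ (Finset.univ.filter fun τ : I ↦ τ.1 y = σ.1 y).card from
        Finset.card_pos.2 ⟨σ, hmem⟩]
      have : (k : ℤ) ≤ (Finset.univ.filter fun τ : I ↦ τ.1 y = σ.1 y).card := by
        exact_mod_cast hcard
      linarith
  have h2 := hle.trans (mul_le_mul_right hrest _)
  rw [← div_le_iff₀ (zero_lt_iff.2 exp_ne_zero), ← exp_sub] at h2
  convert h2 using 2
  ring

namespace IsDyadic

variable {F M : Type*} [Field F] [Field M] [CharZero M] [Algebra F M] {α : Fin 5 → M}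
  {β : Fin 6 → M} {v : Valuation M ℤᵐ⁰} {n : ℤ} {ω : ResidueField v.valuationSubring}
  {I : Subgroup Gal(M/F)} {φ : Gal(M/F)}

/-- `X` records the signs by which inertia acts on `α 0 - α 1`, `α 2 - α 3`, `β 4 - β 5`. -/
structure IsSignChar (α : Fin 5 → M) (β : Fin 6 → M) (X : I →* ℤˣ × ℤˣ × ℤˣ) : Prop where
  fst : ∀ σ, σ.1 (α 0 - α 1) = (((X σ).1 : ℤ) : M) * (α 0 - α 1)
  snd : ∀ σ, σ.1 (α 2 - α 3) = (((X σ).2.1 : ℤ) : M) * (α 2 - α 3)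
  trd : ∀ σ, σ.1 (β 4 - β 5) = (((X σ).2.2 : ℤ) : M) * (β 4 - β 5)

section

variable (D : IsDyadic F v α β n ω)
include D

theorem sub_α_ne_zero {i j : Fin 5} (h : i ≠ j) : α i - α j ≠ 0 :=
  sub_ne_zero.2 fun h0 ↦ h (D.injective_α h0)

theorem sub_β_ne_zero {i j : Fin 6} (h : i ≠ j) : β i - β j ≠ 0 :=
  sub_ne_zero.2 fun h0 ↦ h (D.injective_β h0)

theorem exists_isSignChar (h : IsTotallyRamified v I) :
    ∃ X : I →* ℤˣ × ℤˣ × ℤˣ, IsSignChar α β X := by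
  obtain ⟨χ0, h0⟩ := IsTotallyRamified.exists_signHom I (D.sub_α_ne_zero (i := 0) (j := 1)
    (by decide)) fun σ hσ ↦ by
      rcases (D.apply_α_of_mem h hσ).1 with ⟨e, e'⟩ | ⟨e, e'⟩ <;> simp [e, e']
  obtain ⟨χ1, h1⟩ := IsTotallyRamified.exists_signHom I (D.sub_α_ne_zero (i := 2) (j := 3)
    (by decide)) fun σ hσ ↦ by
      rcases (D.apply_α_of_mem h hσ).2.1 with ⟨e, e'⟩ | ⟨e, e'⟩ <;> simp [e, e']
  obtain ⟨χ2, h2⟩ := IsTotallyRamified.exists_signHom I (D.sub_β_ne_zero (i := 4) (j := 5)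
    (by decide)) fun σ hσ ↦ by
      rcases D.apply_β_four_five (h.map_apply σ hσ) with ⟨e, e'⟩ | ⟨e, e'⟩ <;> simp [e, e']
  exact ⟨χ0.prod (χ1.prod χ2), ⟨h0, h1, h2⟩⟩

variable {X : I →* ℤˣ × ℤˣ × ℤˣ} (hX : IsSignChar α β X)
include hX

theorem apply_α_zero_one (h : IsTotallyRamified v I) (σ : I) (h1 : (X σ).1 = 1) :
    σ.1 (α 0) = α 0 ∧ σ.1 (α 1) = α 1 := by
  refine (D.apply_α_of_mem h σ.2).1.resolve_right fun ⟨e, e'⟩ ↦ ?_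
  have := hX.fst σ
  rw [h1, _root_.map_sub, e, e'] at this
  refine D.sub_α_ne_zero (i := 0) (j := 1) (by decide) ?_
  have h2 : (2 : M) * (α 0 - α 1) = 0 := by
    simp at this
    linear_combination -this
  simpa using h2

theorem apply_α_two_three (h : IsTotallyRamified v I) (σ : I) (h1 : (X σ).2.1 = 1) :
    σ.1 (α 2) = α 2 ∧ σ.1 (α 3) = α 3 := by
  refine (D.apply_α_of_mem h σ.2).2.1.resolve_right fun ⟨e, e'⟩ ↦ ?_
  have := hX.snd σ
  rw [h1, _root_.map_sub, e, e'] at this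
  refine D.sub_α_ne_zero (i := 2) (j := 3) (by decide) ?_
  have h2 : (2 : M) * (α 2 - α 3) = 0 := by
    simp at this
    linear_combination -this
  simpa using h2

theorem apply_β_eq_iff (h : IsTotallyRamified v I) (σ : I) :
    (σ.1 (β 4) = β 4 ∧ σ.1 (β 5) = β 5) ∧ (X σ).2.2 = 1 ∨
      (σ.1 (β 4) = β 5 ∧ σ.1 (β 5) = β 4) ∧ (X σ).2.2 = -1 := by
  have hne := D.sub_β_ne_zero (i := 4) (j := 5) (by decide)
  have := hX.trd σ
  rcases D.apply_β_four_five (h.map_apply σ.1 σ.2) with ⟨e, e'⟩ | ⟨e, e'⟩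
  · refine Or.inl ⟨⟨e, e'⟩, (Int.units_eq_one_or _).resolve_right fun h1 ↦ ?_⟩
    rw [h1, _root_.map_sub, e, e'] at this
    have h2 : (2 : M) * (β 4 - β 5) = 0 := by
      simp at this
      linear_combination this
    exact hne (by simpa using h2)
  · refine Or.inr ⟨⟨e, e'⟩, (Int.units_eq_one_or _).resolve_left fun h1 ↦ ?_⟩
    rw [h1, _root_.map_sub, e, e'] at this
    have h2 : (2 : M) * (β 4 - β 5) = 0 := by
      simp at this
      linear_combination -this
    exact hne (by simpa using h2)

theorem eq_one_of_kappa (h : IsTotallyRamified v I) (σ : I) (h0 : kappa v β σ.1 = 0)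
    (h1 : X σ = 1) : σ = 1 := by
  refine Subtype.ext (D.eq_one σ.1 (fun i ↦ ?_) (fun i ↦ ?_) (fun x hx ↦ ?_))
  · obtain ⟨e0, e1⟩ := D.apply_α_zero_one hX h σ (by rw [h1]; rfl)
    obtain ⟨e2, e3⟩ := D.apply_α_two_three hX h σ (by rw [h1]; rfl)
    have e4 := (D.apply_α_of_mem h σ.2).2.2
    fin_cases i <;> assumption
  · have e : ∀ i < 4, σ.1 (β i) = β i := fun i hi ↦ D.apply_eq_of_kappa_eq_zero h σ.2 h0 hi
    rcases D.apply_β_eq_iff hX h σ with ⟨⟨e4, e5⟩, -⟩ | ⟨-, h2⟩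
    · have e0 := e 0 (by decide)
      have e1 := e 1 (by decide)
      have e2 := e 2 (by decide)
      have e3 := e 3 (by decide)
      fin_cases i <;> assumption
    · rw [h1] at h2
      exact absurd h2 (by decide)
  · have h1 : (σ.1 x - x) * (σ.1 x + x) = 0 := by
      have : σ.1 x ^ 2 = -3 := by rw [← map_pow, hx]; simp [map_ofNat]
      linear_combination this - hx
    rcases mul_eq_zero.1 h1 with h1 | h1
    · exact sub_eq_zero.1 h1
    exfalso
    have hvx : v x = 1 := by
      have : v x ^ 2 = 1 := by rw [← map_pow, hx, Valuation.map_neg, D.map_three]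
      exact (pow_eq_one_iff_of_nonneg zero_le two_ne_zero).1 this
    have hu : v ((1 + x) / 2) ≤ 1 := by
      have h2 : ((1 + x) / 2) * ((1 + x) / 2) = (1 + x) / 2 - 1 := by linear_combination hx / 4
      by_contra! hlt
      have h3 := congrArg v h2
      rw [v.map_sub_eq_of_lt_left (by rwa [map_one]), map_mul] at h3
      have h4 : v ((1 + x) / 2) ≠ 0 := (zero_lt_one.trans hlt).ne'
      exact hlt.ne' (mul_right_cancel₀ h4 (by rw [h3, one_mul]))
    have h2 := h.map_apply_sub_lt σ.1 σ.2 _ hu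
    rw [map_div₀ σ.1, map_add, map_one, map_ofNat, eq_neg_of_add_eq_zero_left h1,
      show (1 + -x) / 2 - (1 + x) / 2 = -x by ring, Valuation.map_neg, hvx] at h2
    exact lt_irrefl _ h2

theorem signChar_conj (hφ : IsSqFrobenius v φ) (σ τ : I) (hτ : τ.1 = φ * σ.1 * φ⁻¹) :
    X τ = ((X σ).2.1, (X σ).1, (X σ).2.2) := by
  have key : ∀ (c : ℤˣ) (y u : M), (φ y = u ∨ φ y = -u) → σ.1 y = ((c : ℤ) : M) * y →
      τ.1 u = ((c : ℤ) : M) * u := by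
    intro c y u hu hy
    have h1 : τ.1 (φ y) = ((c : ℤ) : M) * φ y := by
      rw [hτ, AlgEquiv.mul_apply, AlgEquiv.mul_apply, show φ⁻¹ (φ y) = y from φ.symm_apply_apply y,
        hy, map_mul, map_intCast]
    rcases hu with hu | hu
    · rwa [hu] at h1
    · rw [hu, _root_.map_neg, mul_neg] at h1
      exact neg_injective h1
  have hinj : ∀ (u u' : ℤˣ) (y : M), y ≠ 0 → ((u : ℤ) : M) * y = ((u' : ℤ) : M) * y → u = u' :=
    fun u u' y hy huu ↦ Units.ext (Int.cast_injective (mul_right_cancel₀ hy huu))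
  obtain ⟨e0, e1⟩ := D.apply_sub_α hφ
  have e2 : φ (β 4 - β 5) = β 4 - β 5 ∨ φ (β 4 - β 5) = -(β 4 - β 5) := by
    rcases D.apply_β_four_five hφ.map_apply with ⟨e, e'⟩ | ⟨e, e'⟩ <;> simp [e, e']
  refine Prod.ext ?_ (Prod.ext ?_ ?_)
  · exact hinj _ _ _ (D.sub_α_ne_zero (by decide))
      ((hX.fst τ).symm.trans (key _ _ _ e1 (hX.snd σ)))
  · exact hinj _ _ _ (D.sub_α_ne_zero (by decide))
      ((hX.snd τ).symm.trans (key _ _ _ e0 (hX.fst σ)))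
  · exact hinj _ _ _ (D.sub_β_ne_zero (by decide))
      ((hX.trd τ).symm.trans (key _ _ _ e2 (hX.trd σ)))

theorem range_signChar (h : IsTotallyRamified v I) (hφ : IsSqFrobenius v φ)
    (hI : ∀ σ ∈ I, φ * σ * φ⁻¹ ∈ I) (hcard : (Nat.card I : ℤ) = 4 * n) : X.range = ⊤ := by
  obtain ⟨v0, v1⟩ := D.map_sub_α hφ
  refine Subgroup.eq_top_of_swap_mem ?_ ?_ ?_ ?_
  · rintro a b c ⟨σ, hσ⟩
    refine ⟨⟨_, hI σ.1 σ.2⟩, ?_⟩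
    rw [D.signChar_conj hX hφ σ _ rfl, hσ]
  · obtain ⟨s, hs, hs'⟩ := D.exists_sqrt_three
    obtain ⟨σ, hσ, hσs⟩ := D.apply_ne_of_sq_eq_three h hcard hs
    refine ⟨X ⟨σ, hσ⟩, ⟨_, rfl⟩, fun heq ↦ hσs ?_⟩
    have h0 := hX.fst ⟨σ, hσ⟩
    have h1 := hX.snd ⟨σ, hσ⟩
    rw [← heq] at h1
    have hy : σ ((α 0 - α 1) * (α 2 - α 3)) = (α 0 - α 1) * (α 2 - α 3) := by
      rw [map_mul]
      rcases Int.units_eq_one_or (X ⟨σ, hσ⟩).1 with h2 | h2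
      · rw [h2] at h0 h1
        simp only [h0, h1]
        simp
      · rw [h2] at h0 h1
        simp only [h0, h1]
        simp
        ring
    have hR : σ ((α 2 - α 0) * (α 3 - α 0) * (α 2 - α 1) * (α 3 - α 1) *
      (α 4 - α 0) * (α 4 - α 1) * (α 4 - α 2) * (α 4 - α 3)) =
      (α 2 - α 0) * (α 3 - α 0) * (α 2 - α 1) * (α 3 - α 1) *
      (α 4 - α 0) * (α 4 - α 1) * (α 4 - α 2) * (α 4 - α 3) := by
      obtain ⟨ha, hb, e4⟩ := D.apply_α_of_mem h hσ
      simp only [map_mul, _root_.map_sub, e4]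
      rcases ha with ⟨e0, e1⟩ | ⟨e0, e1⟩ <;> rcases hb with ⟨e2, e3⟩ | ⟨e2, e3⟩ <;>
        rw [e0, e1, e2, e3] <;> ring
    have h3 := congrArg σ hs'
    rw [map_mul, hy, hR, hs', map_mul, map_ofNat] at h3
    exact (mul_left_cancel₀ (by norm_num) h3).symm
  · obtain ⟨σ, hσ, hne⟩ := D.exists_apply_ne h hcard (a := 2) (D.map_β 4) (by decide)
    refine ⟨X ⟨σ, hσ⟩, ⟨_, rfl⟩, fun h1 ↦ ?_⟩
    rcases D.apply_β_eq_iff hX h ⟨σ, hσ⟩ with ⟨⟨e, -⟩, -⟩ | ⟨-, e⟩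
    · exact hne e
    · rw [h1] at e
      exact absurd e (by decide)
  · obtain ⟨σ, hσ, hne⟩ := D.exists_apply_ne h hcard (a := 18)
      (x := (α 0 - α 1) * (α 2 - α 3) * (β 4 - β 5)) (by
        rw [map_mul_eq_exp (map_mul_eq_exp v0 v1) D.map_sub_four_five]
        congr 2
        ring) (by decide)
    refine ⟨X ⟨σ, hσ⟩, ⟨_, rfl⟩, fun h1 ↦ hne ?_⟩
    have e0 := hX.fst ⟨σ, hσ⟩
    have e1 := hX.snd ⟨σ, hσ⟩
    have e2 := hX.trd ⟨σ, hσ⟩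
    simp only at e0 e1 e2
    have h1' : ((((X ⟨σ, hσ⟩).1 * (X ⟨σ, hσ⟩).2.1 * (X ⟨σ, hσ⟩).2.2 : ℤˣ) : ℤ) : M) = 1 := by
      rw [h1]
      simp
    push_cast at h1'
    rw [map_mul, map_mul, e0, e1, e2]
    linear_combination (α 0 - α 1) * (α 2 - α 3) * (β 4 - β 5) * h1'

end

end IsDyadic

end

section

open WithZero Valuation IsLocalRing

namespace IsDyadic

variable {F M : Type*} [Field F] [Field M] [CharZero M] [Algebra F M] {α : Fin 5 → M}
  {β : Fin 6 → M} {v : Valuation M ℤᵐ⁰} {n : ℤ} {ω : ResidueField v.valuationSubring}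
  {I : Subgroup Gal(M/F)} {φ : Gal(M/F)} {X : I →* ℤˣ × ℤˣ × ℤˣ}

section

variable (D : IsDyadic F v α β n ω) (hX : IsSignChar α β X) (h : IsTotallyRamified v I)
include D hX h

theorem mul_self_eq_one (σ : I) : σ * σ = 1 := by
  refine D.eq_one_of_kappa hX h _ ?_ ?_
  · rw [Subgroup.coe_mul, D.kappa_mul h σ.2 σ.2, ← two_mul, D.two_eq_zero, zero_mul]
  · rw [map_mul, Prod.ext_iff, Prod.ext_iff]
    exact ⟨Int.units_mul_self _, Int.units_mul_self _, Int.units_mul_self _⟩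

theorem eq_of_kappa_eq {σ τ : I} (h1 : kappa v β σ.1 = kappa v β τ.1) (h2 : X σ = X τ) :
    σ = τ := by
  have h3 : σ * τ = 1 := by
    refine D.eq_one_of_kappa hX h _ ?_ ?_
    · rw [Subgroup.coe_mul, D.kappa_mul h σ.2 τ.2, h1, ← two_mul, D.two_eq_zero, zero_mul]
    · rw [map_mul, h2, ← map_mul, D.mul_self_eq_one hX h, map_one]
  rw [mul_eq_one_iff_eq_inv.1 h3]
  exact (mul_eq_one_iff_eq_inv.1 (D.mul_self_eq_one hX h τ)).symm

theorem map_apply_sub_le {π : M} (hπ : v π = exp (-1)) (σ : I) : v (σ.1 π - π) ≤ exp (-2) := by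
  refine h.map_apply_sub_le_of_sq hπ σ.2 D.map_two_lt_one ?_
  exact congrArg (fun τ : I ↦ τ.1 π) (D.mul_self_eq_one hX h σ)

variable (hφ : IsSqFrobenius v φ) (hI : ∀ σ ∈ I, φ * σ * φ⁻¹ ∈ I)
  (hcard : (Nat.card I : ℤ) = 4 * n)
include hφ hI hcard

theorem exists_mem_ker : ∃ ν : I, X ν = 1 ∧ kappa v β ν.1 ≠ 0 := by
  obtain ⟨σ, hσ, hne⟩ := D.exists_apply_ne h hcard (x := β 0) (a := 1)
    (by rw [D.map_β_zero, one_mul]) (by decide)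
  have h0 : kappa v β σ ≠ 0 := fun h0 ↦ hne (D.apply_eq_of_kappa_eq_zero h hσ h0 (by decide))
  have hc := (D.map_apply_sub_of_kappa_ne_zero (h.map_apply σ hσ) h0).2
  let σ1 : I := ⟨_, hI σ hσ⟩
  let σ2 : I := ⟨_, hI σ1.1 σ1.2⟩
  refine ⟨⟨σ, hσ⟩ * σ2, ?_, ?_⟩
  · rw [map_mul, D.signChar_conj hX hφ σ1 σ2 rfl, D.signChar_conj hX hφ ⟨σ, hσ⟩ σ1 rfl,
      Prod.ext_iff, Prod.ext_iff]
    exact ⟨Int.units_mul_self _, Int.units_mul_self _, Int.units_mul_self _⟩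
  · rw [Subgroup.coe_mul, D.kappa_mul h hσ σ2.2, D.kappa_conj h hφ σ1.2, D.kappa_conj h hφ hσ]
    intro h1
    refine h0 (pow_eq_zero_iff two_ne_zero |>.1 ?_)
    linear_combination h1 - kappa v β σ * hc + kappa v β σ ^ 2 * D.two_eq_zero

/-- `ker X` has order four and `kappa` takes all its values on it. -/
theorem card_ker : Nat.card X.ker = 4 ∧ ∀ σ : I, ∃ τ : I, X τ = 1 ∧ kappa v β τ.1 = kappa v β σ.1 := by
  classical
  obtain ⟨ν, hν, hν0⟩ := D.exists_mem_ker hX h hφ hI hcard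
  have h2 := D.two_eq_zero
  have hc := (D.map_apply_sub_of_kappa_ne_zero (h.map_apply ν.1 ν.2) hν0).2
  let ν' : I := ⟨_, hI ν.1 ν.2⟩
  have hν' : X ν' = 1 := by rw [D.signChar_conj hX hφ ν ν' rfl, hν]; rfl
  have hκ' : kappa v β ν'.1 = kappa v β ν.1 ^ 2 := D.kappa_conj h hφ ν.2
  have hνν' : X (ν * ν') = 1 := by rw [map_mul, hν, hν', one_mul]
  have hκκ' : kappa v β (ν * ν').1 = kappa v β ν.1 + kappa v β ν.1 ^ 2 := by
    rw [Subgroup.coe_mul, D.kappa_mul h ν.2 ν'.2, hκ']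
  have hκ1 : kappa v β (1 : I).1 = 0 := by
    have := D.kappa_mul h I.one_mem I.one_mem
    rw [mul_one] at this
    exact left_eq_add.1 this
  generalize hθ : kappa v β ν.1 = θ at *
  have hvals : ∀ σ : I, kappa v β σ.1 ∈ ({0, θ, θ ^ 2, θ + θ ^ 2} : Finset _) := by
    intro σ
    by_cases h0 : kappa v β σ.1 = 0
    · simp [h0]
    have hσ := (D.map_apply_sub_of_kappa_ne_zero (h.map_apply σ.1 σ.2) h0).2
    have hprod : (kappa v β σ.1 - θ) * ((kappa v β σ.1 - θ ^ 2) *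
        (kappa v β σ.1 - (θ + θ ^ 2))) = 0 := by
      generalize kappa v β σ.1 = x at *
      linear_combination hσ + (x * (θ + 3) - (θ + θ ^ 2 - 1)) * hc +
        (-(θ + θ ^ 2) * x ^ 2 - x * (2 * θ + 2) + θ ^ 2 - 1) * h2
    rcases mul_eq_zero.1 hprod with h1 | h1
    · simp [sub_eq_zero.1 h1]
    · rcases mul_eq_zero.1 h1 with h1 | h1
      · simp [sub_eq_zero.1 h1]
      · simp [sub_eq_zero.1 h1]
  have hsurj : ∀ x ∈ ({0, θ, θ ^ 2, θ + θ ^ 2} : Finset _), ∃ τ : I, X τ = 1 ∧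
      kappa v β τ.1 = x := by
    intro x hx
    simp only [Finset.mem_insert, Finset.mem_singleton] at hx
    rcases hx with rfl | rfl | rfl | rfl
    · exact ⟨1, map_one X, hκ1⟩
    · exact ⟨ν, hν, hθ⟩
    · exact ⟨ν', hν', hκ'⟩
    · exact ⟨ν * ν', hνν', hκκ'⟩
  have hθ1 : θ ≠ 1 := by
    rintro rfl
    exact one_ne_zero (α := ResidueField v.valuationSubring) (by linear_combination hc - h2)
  have hθ2 : θ + θ ^ 2 ≠ 0 := by
    intro h0
    have : θ * (1 + θ) = 0 := by linear_combination h0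
    rcases mul_eq_zero.1 this with h1 | h1
    · exact hν0 h1
    · exact hθ1 (by linear_combination h1 - h2)
  have hθ3 : θ ≠ θ ^ 2 := by
    intro h0
    exact hθ2 (by linear_combination -h0 + θ * h2)
  have hcardZ : ({0, θ, θ ^ 2, θ + θ ^ 2} : Finset (ResidueField v.valuationSubring)).card = 4 := by
    rw [Finset.card_insert_of_notMem, Finset.card_insert_of_notMem, Finset.card_insert_of_notMem,
      Finset.card_singleton]
    · simpa using hν0
    · simpa using ⟨hθ3, hν0⟩
    · simp only [Finset.mem_insert, Finset.mem_singleton, not_or]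
      exact ⟨hν0.symm, (pow_ne_zero 2 hν0).symm, hθ2.symm⟩
  refine ⟨?_, fun σ ↦ hsurj _ (hvals σ)⟩
  have hbij : Function.Bijective (fun σ : X.ker ↦ (⟨kappa v β σ.1.1, hvals σ.1⟩ :
      ({0, θ, θ ^ 2, θ + θ ^ 2} : Finset (ResidueField v.valuationSubring)))) := by
    constructor
    · intro σ τ hστ
      have h1 := congrArg Subtype.val hστ
      refine Subtype.ext (D.eq_of_kappa_eq hX h h1 ?_)
      rw [MonoidHom.mem_ker.1 σ.2, MonoidHom.mem_ker.1 τ.2]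
    · rintro ⟨x, hx⟩
      obtain ⟨τ, hτ, rfl⟩ := hsurj x hx
      exact ⟨⟨τ, hτ⟩, rfl⟩
  rw [Nat.card_congr (Equiv.ofBijective _ hbij), Nat.card_eq_fintype_card, Fintype.card_coe, hcardZ]

theorem card_inertia : Nat.card I = 32 := by
  have h1 := X.ker.card_mul_index
  rw [Subgroup.index_ker, D.range_signChar hX h hφ hI hcard, Subgroup.card_top,
    (D.card_ker hX h hφ hI hcard).1, Nat.card_prod, Nat.card_prod, Nat.card_eq_fintype_card,
    Fintype.card_units_int] at h1
  exact h1.symm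

theorem exists_special : ∃ σ : I, X σ = (-1, -1, -1) ∧ kappa v β σ.1 = 0 := by
  obtain ⟨τ, hτ⟩ : ((-1, -1, -1) : ℤˣ × ℤˣ × ℤˣ) ∈ X.range := by
    rw [D.range_signChar hX h hφ hI hcard]
    exact Subgroup.mem_top _
  obtain ⟨ν, hν, hκ⟩ := (D.card_ker hX h hφ hI hcard).2 τ
  refine ⟨τ * ν, by rw [map_mul, hτ, hν, mul_one], ?_⟩
  rw [Subgroup.coe_mul, D.kappa_mul h τ.2 ν.2, hκ, ← two_mul, D.two_eq_zero, zero_mul]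

variable [FiniteDimensional F M] {π : M} (hπ : v π = exp (-1))
include hπ

theorem map_apply_sub_eq_of_ratio (σ : I) {y z : M} {a b : ℤˣ} (hy : v y = exp (-(6 * n)))
    (hz : v z = exp (-(6 * n))) (hσy : ∀ τ : I, ∃ a : ℤˣ, τ.1 y = ((a : ℤ) : M) * y)
    (hσz : ∀ τ : I, ∃ a : ℤˣ, τ.1 z = ((a : ℤ) : M) * z) (ha : σ.1 y = ((a : ℤ) : M) * y)
    (hb : σ.1 z = ((b : ℤ) : M) * z) (hab : a ≠ b) : v (σ.1 π - π) = exp (-2) := by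
  classical
  have hc := D.card_inertia hX h hφ hI hcard
  have hvyz : v (y / z) = 1 := by
    rw [map_div₀, hy, hz, div_self exp_ne_zero]
  refine h.map_apply_sub_eq_of_orbit hπ (y := y / z) hvyz.le (s := {y / z, -(y / z)}) ?_
    (k := 16) (by rw [hc]; exact Nat.mul_le_mul_right 16 Finset.card_le_two) σ ?_
    fun τ hτ _ ↦ D.map_apply_sub_le hX h hπ ⟨τ, hτ⟩
  · intro τ hτ
    obtain ⟨a', ha'⟩ := hσy ⟨τ, hτ⟩
    obtain ⟨b', hb'⟩ := hσz ⟨τ, hτ⟩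
    simp only at ha' hb'
    rw [map_div₀, ha', hb', Finset.mem_insert, Finset.mem_singleton]
    rcases Int.units_eq_one_or a' with rfl | rfl <;> rcases Int.units_eq_one_or b' with rfl | rfl <;>
      simp [neg_div, div_neg]
  · have : σ.1 (y / z) - y / z = -(2 * (y / z)) := by
      rw [map_div₀, ha, hb]
      rcases Int.units_eq_one_or a with rfl | rfl <;> rcases Int.units_eq_one_or b with rfl | rfl
      · exact absurd rfl hab
      · simp [div_neg]
        ring
      · simp [neg_div]
        ring
      · exact absurd rfl hab
    rw [this, Valuation.map_neg, map_mul, hvyz, mul_one, D.map_two, exp_inj]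
    rw [hc] at hcard
    push_cast at hcard ⊢
    omega

theorem map_apply_sub_eq_exp_neg_two {σ : I} (hσ1 : σ ≠ 1)
    (hσ : ¬(X σ = (-1, -1, -1) ∧ kappa v β σ.1 = 0)) : v (σ.1 π - π) = exp (-2) := by
  classical
  have hc := D.card_inertia hX h hφ hI hcard
  obtain ⟨v0, v1⟩ := D.map_sub_α hφ
  by_cases h0 : kappa v β σ.1 = 0
  · have e0 := hX.fst σ
    have e1 := hX.snd σ
    have e2 := hX.trd σ
    by_cases h01 : (X σ).1 = (X σ).2.1
    · by_cases h12 : (X σ).2.1 = (X σ).2.2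
      · exfalso
        rcases Int.units_eq_one_or (X σ).2.2 with h3 | h3
        · refine hσ1 (D.eq_one_of_kappa hX h σ h0 ?_)
          exact Prod.ext (by rw [h01, h12, h3]; rfl) (Prod.ext (by rw [h12, h3]; rfl) h3)
        · exact hσ ⟨Prod.ext (by rw [h01, h12, h3]) (Prod.ext (by rw [h12, h3]) h3), h0⟩
      · exact D.map_apply_sub_eq_of_ratio hX h hφ hI hcard hπ σ v1 D.map_sub_four_five
          (fun τ ↦ ⟨_, hX.snd τ⟩) (fun τ ↦ ⟨_, hX.trd τ⟩) e1 e2 h12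
    · exact D.map_apply_sub_eq_of_ratio hX h hφ hI hcard hπ σ v0 v1
        (fun τ ↦ ⟨_, hX.fst τ⟩) (fun τ ↦ ⟨_, hX.snd τ⟩) e0 e1 h01
  · have hpos := D.pos
    refine h.map_apply_sub_eq_of_orbit hπ (D.map_β_le_one v 0) (s := {β 0, β 1, β 2, β 3}) ?_
      (k := 8) (by rw [hc]; exact Nat.mul_le_mul_right 8 Finset.card_le_four) σ ?_
      fun τ hτ _ ↦ D.map_apply_sub_le hX h hπ ⟨τ, hτ⟩
    · intro τ hτ
      obtain ⟨j, hj, hij⟩ := D.exists_lt_four (h.map_apply τ hτ) (i := 0) (by decide)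
      rw [hij]
      fin_cases j <;> simp at hj ⊢
    · rw [(D.map_apply_sub_of_kappa_ne_zero (h.map_apply σ.1 σ.2) h0).1, exp_inj]
      rw [hc] at hcard
      push_cast at hcard ⊢
      omega

theorem map_apply_sub_of_special {σ : I} (h1 : X σ = (-1, -1, -1)) (h0 : kappa v β σ.1 = 0) :
    v (σ.1 π - π) = exp (-18) := by
  classical
  have hc := D.card_inertia hX h hφ hI hcard
  have hn : n = 8 := by
    rw [hc] at hcard
    push_cast at hcard
    omega
  have hsq : ∀ (τ : I) (x : M), τ.1 (τ.1 x) = x := fun τ x ↦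
    congrArg (fun τ : I ↦ τ.1 x) (D.mul_self_eq_one hX h τ)
  have hcomm : ∀ (τ τ' : I) (x : M), τ.1 (τ'.1 x) = τ'.1 (τ.1 x) := by
    intro τ τ' x
    rw [← hsq τ' (τ.1 (τ'.1 x))]
    congr 1
    rw [← hsq τ (τ'.1 (τ.1 (τ'.1 x)))]
    exact congrArg τ.1 (hsq (τ * τ') x)
  obtain ⟨e4, e5⟩ : σ.1 (β 4) = β 5 ∧ σ.1 (β 5) = β 4 := by
    rcases D.apply_β_eq_iff hX h σ with ⟨-, h2⟩ | ⟨h2, -⟩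
    · rw [h1] at h2
      exact absurd h2 (by decide)
    · exact h2
  have hne := D.sub_β_ne_zero (i := 5) (j := 4) (by decide)
  have hv : v (σ.1 (β 4) - β 4) = exp (-48) := by
    rw [e4, v.map_sub_swap, D.map_sub_four_five, hn]
    rfl
  have hle := h.le_prod_coset hπ (D.map_β_le_one v 4) σ
  have hge := h.prod_coset_le hπ (y := β 4) σ (by
    intro c hc1 hfix
    obtain ⟨a1, ha1⟩ : ∃ a1, a1 = (σ.1 c - c) / (β 5 - β 4) := ⟨_, rfl⟩
    have hσc : σ.1 c - c = a1 * (β 5 - β 4) := by rw [ha1, div_mul_cancel₀ _ hne]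
    have hinv : ∀ τ ∈ I, τ a1 = a1 ∧ τ (c - a1 * β 4) = c - a1 * β 4 := by
      intro τ hτ
      rcases D.apply_β_eq_iff hX h ⟨τ, hτ⟩ with ⟨⟨e, e'⟩, -⟩ | ⟨⟨e, e'⟩, -⟩
      · simp only at e e'
        have hτc := hfix τ hτ e
        have hτa : τ a1 = a1 := by
          rw [ha1, map_div₀, _root_.map_sub, _root_.map_sub, e, e', hcomm ⟨τ, hτ⟩ σ c]
          simp only [hτc]
        exact ⟨hτa, by rw [_root_.map_sub, map_mul, hτa, hτc, e]⟩
      · simp only at e e'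
        have h2 : σ.1 (τ c) = c :=
          hfix (σ.1 * τ) (I.mul_mem σ.2 hτ) (by rw [AlgEquiv.mul_apply, e, e5])
        have hτc : τ c = σ.1 c := by rw [← h2, hsq σ, h2]
        have hτa : τ a1 = a1 := by
          rw [ha1, map_div₀, _root_.map_sub, _root_.map_sub, e, e', hcomm ⟨τ, hτ⟩ σ c]
          simp only [hτc, hsq σ]
          rw [← neg_sub, ← neg_sub (β 5), neg_div_neg_eq]
        refine ⟨hτa, ?_⟩
        rw [_root_.map_sub, map_mul, hτa, hτc, e]
        linear_combination hσc
    rw [hσc, e4, map_mul]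
    refine mul_le_of_le_one_left' ?_
    by_cases ha0 : a1 = 0
    · simp [ha0]
    obtain ⟨k, hk⟩ := h.exists_eq_exp a1 ha0 fun τ hτ ↦ (hinv τ hτ).1
    rw [hc] at hk
    by_contra! hlt
    have hk0 : 0 < k := by
      rw [hk, ← exp_zero, exp_lt_exp] at hlt
      push_cast at hlt
      omega
    have h4 : v (a1 * β 4) = exp (32 * k - 16) := by
      rw [map_mul, hk, D.map_β 4, ← exp_add, exp_inj, hn]
      push_cast
      ring
    have h5 : v (c - a1 * β 4) = exp (32 * k - 16) := by
      rw [v.map_sub_swap, v.map_sub_eq_of_lt_left, h4]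
      rw [h4]
      refine hc1.trans_lt ?_
      rw [← exp_zero, exp_lt_exp]
      omega
    obtain ⟨k', hk'⟩ := h.exists_eq_exp (c - a1 * β 4)
      (fun h0 ↦ by rw [h0, map_zero] at h5; exact exp_ne_zero h5.symm) fun τ hτ ↦ (hinv τ hτ).2
    rw [hc, h5, exp_inj] at hk'
    push_cast at hk'
    omega)
  have heq := le_antisymm hge hle
  have horb : (MulAction.orbit I (β 4)) = {β 4, β 5} := by
    ext x
    constructor
    · rintro ⟨τ, rfl⟩
      rcases D.apply_β_eq_iff hX h τ with ⟨⟨e, -⟩, -⟩ | ⟨⟨e, -⟩, -⟩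
      · exact Or.inl e
      · exact Or.inr e
    · rintro (rfl | rfl)
      · exact MulAction.mem_orbit_self _
      · exact ⟨σ, e4⟩
  have hcardT := IsTotallyRamified.card_filter_mul_ncard_orbit I (β 4) σ
  rw [horb, Set.ncard_pair (sub_ne_zero.1 hne).symm, hc] at hcardT
  have hmem : σ ∈ Finset.univ.filter fun τ : I ↦ τ.1 (β 4) = σ.1 (β 4) := by simp
  rw [← Finset.mul_prod_erase _ _ hmem, Finset.prod_congr rfl (g := fun _ ↦ (exp (-2) : ℤᵐ⁰)),
    Finset.prod_const, Finset.card_erase_of_mem hmem, hv,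
    show (Finset.univ.filter fun τ : I ↦ τ.1 (β 4) = σ.1 (β 4)).card = 16 by omega] at heq
  · rw [← exp_nsmul, ← eq_div_iff exp_ne_zero, ← exp_sub] at heq
    rw [heq]
    rfl
  · intro τ hτ
    rw [Finset.mem_erase, Finset.mem_filter] at hτ
    refine D.map_apply_sub_eq_exp_neg_two hX h hφ hI hcard hπ ?_ ?_
    · rintro rfl
      refine hne (sub_eq_zero.2 ?_)
      rw [← e4, ← hτ.2.2]
      rfl
    · rintro ⟨h2, h3⟩
      exact hτ.1 (D.eq_of_kappa_eq hX h (by rw [h3, h0]) (by rw [h1, h2]))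

open Classical in
theorem prod_map_apply_sub : ∏ σ : I with σ ≠ 1, v (σ.1 π - π) = exp (-78) := by
  obtain ⟨σ, h1, h0⟩ := D.exists_special hX h hφ hI hcard
  have hc := D.card_inertia hX h hφ hI hcard
  have hσ1 : σ ≠ 1 := by
    rintro rfl
    rw [map_one] at h1
    exact absurd h1 (by decide)
  rw [Finset.filter_ne' Finset.univ (1 : I), ← Finset.mul_prod_erase _ _
    (Finset.mem_erase.2 ⟨hσ1, Finset.mem_univ σ⟩),
    D.map_apply_sub_of_special hX h hφ hI hcard hπ h1 h0, Finset.prod_congr rfl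
      (g := fun _ ↦ (exp (-2) : ℤᵐ⁰)), Finset.prod_const,
    Finset.card_erase_of_mem (Finset.mem_erase.2 ⟨hσ1, Finset.mem_univ σ⟩),
    Finset.card_erase_of_mem (Finset.mem_univ _), Finset.card_univ, ← Nat.card_eq_fintype_card, hc,
    ← exp_nsmul, ← exp_add]
  · rfl
  · intro τ hτ
    rw [Finset.mem_erase, Finset.mem_erase] at hτ
    refine D.map_apply_sub_eq_exp_neg_two hX h hφ hI hcard hπ hτ.2.1 ?_
    rintro ⟨h2, h3⟩
    exact hτ.1 (D.eq_of_kappa_eq hX h (by rw [h3, h0]) (by rw [h1, h2]))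

end

end IsDyadic

end

namespace IsDedekindDomain.HeightOneSpectrum

open NumberField WithZero Pointwise Valuation

variable {M : Type*} [Field M] [NumberField M] (w : HeightOneSpectrum (𝓞 M))

theorem exists_prime_valuation_lt_one : ∃ p : ℕ, p.Prime ∧ w.valuation M p < 1 := by
  have hbot : w.asIdeal.under ℤ ≠ ⊥ := mt Ideal.eq_bot_of_comap_eq_bot w.ne_bot
  obtain ⟨p, hp⟩ := IsPrincipalIdealRing.principal (w.asIdeal.under ℤ)
  rw [← Ideal.span] at hp
  have hp0 : p ≠ 0 := by
    rintro rfl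
    exact hbot (by simpa using hp)
  have hprime : Prime p := by
    rw [← Ideal.span_singleton_prime hp0, ← hp]
    infer_instance
  refine ⟨p.natAbs, Int.prime_iff_natAbs_prime.1 hprime, ?_⟩
  have hmem : (p : 𝓞 M) ∈ w.asIdeal := by
    have : p ∈ w.asIdeal.under ℤ := by
      rw [hp]
      exact Ideal.mem_span_singleton_self p
    simpa using this
  rw [← w.valuation_lt_one_iff_mem (K := M)] at hmem
  have h1 : w.valuation M (p : M) < 1 := by simpa using hmem
  rcases Int.natAbs_eq p with h | h
  · rwa [h, Int.cast_natCast] at h1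
  · rwa [h, Int.cast_neg, Valuation.map_neg, Int.cast_natCast] at h1

theorem exists_valuation_lt_one (M : Type*) [Field M] [NumberField M] {p : ℕ} (hp : p.Prime) :
    ∃ w : HeightOneSpectrum (𝓞 M), w.valuation M p < 1 := by
  have hnu : ¬IsUnit (p : 𝓞 M) := by
    intro h
    have := NumberField.isUnit_iff_norm.1 h
    simp only [map_natCast, RingOfIntegers.coe_norm] at this
    rw [← map_natCast (algebraMap ℚ M), Algebra.norm_algebraMap, abs_pow, Nat.abs_cast] at this
    have h1 : (1 : ℚ) < p := by exact_mod_cast hp.one_lt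
    exact (one_lt_pow₀ h1 Module.finrank_pos.ne').ne' this
  obtain ⟨P, hP, hle⟩ := Ideal.exists_le_maximal (Ideal.span {(p : 𝓞 M)})
    (by rwa [Ne, Ideal.span_singleton_eq_top])
  have hmem : (p : 𝓞 M) ∈ P := hle (Ideal.mem_span_singleton_self _)
  refine ⟨⟨P, hP.isPrime, ?_⟩, ?_⟩
  · rintro rfl
    rw [Ideal.mem_bot] at hmem
    exact hp.ne_zero (by exact_mod_cast hmem)
  · have := (valuation_lt_one_iff_mem (K := M) ⟨P, hP.isPrime, by
      rintro rfl
      rw [Ideal.mem_bot] at hmem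
      exact hp.ne_zero (by exact_mod_cast hmem)⟩ (p : 𝓞 M)).2 hmem
    simpa using this

theorem under_int_eq_span {p : ℕ} (hp : p.Prime) (hpw : w.valuation M p < 1) :
    w.asIdeal.under ℤ = Ideal.span {(p : ℤ)} := by
  have hpM : (p : 𝓞 M) ∈ w.asIdeal := by
    rw [← w.valuation_lt_one_iff_mem (K := M)]
    simpa using hpw
  have hmax : (Ideal.span {(p : ℤ)}).IsMaximal :=
    PrincipalIdealRing.isMaximal_of_irreducible (Nat.prime_iff_prime_int.1 hp).irreducible
  have hprime : (w.asIdeal.under ℤ).IsPrime := inferInstance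
  refine (hmax.eq_of_le hprime.ne_top ?_).symm
  rw [Ideal.span_singleton_le_iff_mem]
  change algebraMap ℤ (𝓞 M) p ∈ w.asIdeal
  simpa using hpM

theorem conj_mem_inertia {φ σ : Gal(M/ℚ)} (hφ : φ ∈ MulAction.stabilizer Gal(M/ℚ) w.asIdeal)
    (hσ : σ ∈ w.asIdeal.inertia Gal(M/ℚ)) : φ * σ * φ⁻¹ ∈ w.asIdeal.inertia Gal(M/ℚ) := by
  rw [Ideal.inertia, AddSubgroup.mem_inertia] at hσ ⊢
  intro x
  have h1 := hσ (φ⁻¹ • x)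
  have h2 : φ • (σ • φ⁻¹ • x - φ⁻¹ • x) ∈ w.asIdeal := by
    have h3 := Ideal.smul_mem_pointwise_smul φ _ _ h1
    rwa [MulAction.mem_stabilizer_iff.1 hφ] at h3
  rw [smul_sub, smul_inv_smul] at h2
  rwa [mul_smul, mul_smul]

theorem emultiplicity_span_natCast {c m : ℕ} (h : w.valuation M (c : M) = exp (-(m : ℤ))) :
    emultiplicity w.asIdeal (Ideal.span {(c : 𝓞 M)}) = m := by
  have h1 : w.intValuation (c : 𝓞 M) = exp (-(m : ℤ)) := by
    rw [← h, ← w.valuation_of_algebraMap (K := M)]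
    simp
  rw [emultiplicity_eq_coe, ← w.intValuation_le_pow_iff_dvd, ← w.intValuation_le_pow_iff_dvd, h1,
    exp_le_exp, exp_le_exp]
  push_cast
  omega

variable [IsGalois ℚ M]

theorem exists_frobenius {p : ℕ} (hp : p.Prime) (hpw : w.valuation M p < 1) :
    ∃ φ : Gal(M/ℚ), φ ∈ MulAction.stabilizer Gal(M/ℚ) w.asIdeal ∧
      ∀ y : 𝓞 M, φ • y - y ^ p ∈ w.asIdeal := by
  have : Finite (𝓞 M ⧸ w.asIdeal) := Ideal.finiteQuotientOfFreeOfNeBot _ w.ne_bot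
  obtain ⟨φ, hφ⟩ := IsArithFrobAt.exists_of_isInvariant ℤ Gal(M/ℚ) w.asIdeal
  refine ⟨φ, hφ.mem_stabilizer, fun y ↦ ?_⟩
  have h1 := hφ y
  rw [w.under_int_eq_span hp hpw, Int.card_ideal_quot] at h1
  exact h1

open Classical in
theorem emultiplicity_differentIdeal {π : 𝓞 M} (hπ : w.valuation M (π : M) = exp (-1)) {d : ℕ}
    (h : ∏ σ : w.asIdeal.inertia Gal(M/ℚ) with σ ≠ 1, w.valuation M (σ.1 π - π) =
      exp (-(d : ℤ))) : emultiplicity w.asIdeal (differentIdeal ℤ (𝓞 M)) = d := by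
  rw [emultiplicity_eq_coe, w.pow_dvd_differentIdeal_iff hπ, w.pow_dvd_differentIdeal_iff hπ]
  rw [h, exp_le_exp, exp_le_exp]
  push_cast
  omega

end IsDedekindDomain.HeightOneSpectrum

namespace IsRootData

open WithZero Valuation NumberField IsDedekindDomain.HeightOneSpectrum

variable {M : Type*} [Field M] [NumberField M] [IsGalois ℚ M] {α : Fin 5 → M} {β : Fin 6 → M}

open Classical in
/-- Order of inertia and exponent of the different at the primes above `2`. -/
theorem inertia_two (H : IsRootData ℚ α β) (w : IsDedekindDomain.HeightOneSpectrum (𝓞 M))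
    {π : 𝓞 M} (hπ : w.valuation M (π : M) = exp (-1)) (hw : w.valuation M 2 < 1) :
    Nat.card (w.asIdeal.inertia Gal(M/ℚ)) = 32 ∧
      ∏ σ : w.asIdeal.inertia Gal(M/ℚ) with σ ≠ 1, w.valuation M (σ.1 π - π) = exp (-78) := by
  have hw' : w.valuation M ((2 : ℕ) : M) < 1 := by exact_mod_cast hw
  have h := w.isTotallyRamified
  have h2 : w.valuation M 2 = exp (-(Nat.card (w.asIdeal.inertia Gal(M/ℚ)) : ℤ)) := by
    exact_mod_cast w.valuation_natCast_eq_exp Nat.prime_two hw'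
  have hpos : 0 < Nat.card (w.asIdeal.inertia Gal(M/ℚ)) := Nat.card_pos
  have hcop : ∀ n : ℕ, Nat.Coprime 2 n → w.valuation M (n : M) = 1 := fun n hn ↦
    map_natCast_eq_one_of_coprime hw' hn
  obtain ⟨φ, hφ, hφ'⟩ := w.exists_frobenius Nat.prime_two hw'
  obtain ⟨σ, τ, n, ω, hn, D⟩ := H.exists_isDyadic (v := w.valuation M) (by exact_mod_cast hpos) h2
    (by exact_mod_cast hcop 3 (by norm_num)) (by exact_mod_cast hcop 5 (by norm_num))
    (by exact_mod_cast hcop 7 (by norm_num))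
  obtain ⟨X, hX⟩ := D.exists_isSignChar h
  have hφ2 : IsSqFrobenius (w.valuation M) φ :=
    ⟨w.valuation_apply_of_mem_stabilizer hφ, w.valuation_apply_sub_pow_lt hφ hφ'⟩
  have hI := fun σ hσ ↦ w.conj_mem_inertia hφ (σ := σ) hσ
  exact ⟨D.card_inertia hX h hφ2 hI hn, D.prod_map_apply_sub hX h hφ2 hI hn hπ⟩

theorem emultiplicity_eq (H : IsRootData ℚ α β) (w : IsDedekindDomain.HeightOneSpectrum (𝓞 M)) :
    emultiplicity w.asIdeal (differentIdeal ℤ (𝓞 M) ^ 80) =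
      emultiplicity w.asIdeal (Ideal.span {((2 ^ 195 * 3 ^ 40 * 7 ^ 64 : ℕ) : 𝓞 M)}) := by
  classical
  obtain ⟨π, hπ'⟩ := w.intValuation_exists_uniformizer
  have hπ : w.valuation M (algebraMap (𝓞 M) M π) = exp (-1) := by
    have h := w.valuation_of_algebraMap (K := M) π
    exact h.trans hπ'
  obtain ⟨p, hp, hw⟩ := w.exists_prime_valuation_lt_one
  have h := w.isTotallyRamified
  have hcop : ∀ n : ℕ, p.Coprime n → w.valuation M (n : M) = 1 := fun n hn ↦
    map_natCast_eq_one_of_coprime hw hn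
  have hvp := w.valuation_natCast_eq_exp hp hw
  -- it suffices to know the order of inertia and the exponent of the different
  have key : ∀ d m : ℕ, ∏ σ : w.asIdeal.inertia Gal(M/ℚ) with σ ≠ 1,
      w.valuation M (σ.1 π - π) = exp (-(d : ℤ)) →
      w.valuation M (2 ^ 195 * 3 ^ 40 * 7 ^ 64 : M) = exp (-(m : ℤ)) → 80 * d = m →
      emultiplicity w.asIdeal (differentIdeal ℤ (𝓞 M) ^ 80) =
        emultiplicity w.asIdeal (Ideal.span {((2 ^ 195 * 3 ^ 40 * 7 ^ 64 : ℕ) : 𝓞 M)}) := by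
    intro d m hd hm hdm
    rw [emultiplicity_pow w.prime, w.emultiplicity_differentIdeal hπ hd,
      w.emultiplicity_span_natCast (m := m) (by
        simpa only [Nat.cast_mul, Nat.cast_pow, Nat.cast_ofNat] using hm), ← hdm]
    push_cast
    rfl
  have hpos : 0 < Nat.card (w.asIdeal.inertia Gal(M/ℚ)) := Nat.card_pos
  by_cases hp2 : p = 2
  · subst hp2
    obtain ⟨h1, h2⟩ := H.inertia_two w hπ (by exact_mod_cast hw)
    rw [h1] at hvp
    refine key 78 (195 * 32) h2 ?_ rfl
    have h3 := hcop 3 (by norm_num)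
    have h7 := hcop 7 (by norm_num)
    push_cast at hvp h3 h7
    rw [map_mul, map_mul, map_pow, map_pow, map_pow, h3, h7, hvp, one_pow, one_pow, mul_one,
      mul_one, ← exp_nsmul]
    rfl
  by_cases hp3 : p = 3
  · subst hp3
    have h2 := hcop 2 (by norm_num)
    have h7 := hcop 7 (by norm_num)
    push_cast at hvp h2 h7 hw
    have h1 := H.card_eq_two_of_three h hπ h2 h7 hvp
    have hd := IsTotallyRamified.prod_eq_of_tame (v := w.valuation M)
      (I := w.asIdeal.inertia Gal(M/ℚ)) (π := algebraMap (𝓞 M) M π) fun σ hσ hσ1 ↦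
      (H.map_apply_sub_eq_of_three h hπ h2 hw hσ hσ1).2
    rw [h1] at hvp hd
    refine key 1 (40 * 2) hd ?_ rfl
    rw [map_mul, map_mul, map_pow, map_pow, map_pow, h2, h7, hvp, one_pow, one_pow, mul_one,
      one_mul, ← exp_nsmul]
    rfl
  by_cases hp7 : p = 7
  · subst hp7
    have h2 := hcop 2 (by norm_num)
    have h3 := hcop 3 (by norm_num)
    have h5 := hcop 5 (by norm_num)
    push_cast at hvp h2 h3 h5 hw
    have h1 := H.card_eq_five_of_seven h hπ h2 h3 h5 hvp
    have hd := IsTotallyRamified.prod_eq_of_tame (v := w.valuation M)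
      (I := w.asIdeal.inertia Gal(M/ℚ)) (π := algebraMap (𝓞 M) M π) fun σ hσ hσ1 ↦
      (H.map_apply_sub_eq_of_seven h hπ h2 h3 h5 hσ hσ1)
    rw [h1] at hvp hd
    refine key 4 (64 * 5) hd ?_ rfl
    rw [map_mul, map_mul, map_pow, map_pow, map_pow, h2, h3, hvp, one_pow, one_pow, mul_one,
      one_mul, ← exp_nsmul]
    rfl
  · have h2 := hcop 2 ((Nat.coprime_primes hp Nat.prime_two).2 hp2)
    have h3 := hcop 3 ((Nat.coprime_primes hp Nat.prime_three).2 hp3)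
    have h7 := hcop 7 ((Nat.coprime_primes hp (by norm_num)).2 hp7)
    push_cast at h2 h3 h7
    refine key 0 0 ?_ ?_ rfl
    · rw [Finset.filter_false_of_mem]
      · rfl
      · intro σ _
        simpa using Subtype.ext (H.eq_one_of_unramified h h2 h3 h7 σ.2)
    · simp [h2, h3, h7]

theorem differentIdeal_pow (H : IsRootData ℚ α β) :
    differentIdeal ℤ (𝓞 M) ^ 80 = Ideal.span {((2 ^ 195 * 3 ^ 40 * 7 ^ 64 : ℕ) : 𝓞 M)} := by
  have hD : differentIdeal ℤ (𝓞 M) ≠ 0 := differentIdeal_ne_bot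
  have hs : Ideal.span {((2 ^ 195 * 3 ^ 40 * 7 ^ 64 : ℕ) : 𝓞 M)} ≠ 0 := by
    rw [Ideal.zero_eq_bot, Ne, Ideal.span_singleton_eq_bot, Nat.cast_eq_zero]
    positivity
  refine dvd_antisymm ?_ ?_
  · rw [UniqueFactorizationMonoid.dvd_iff_emultiplicity_le (pow_ne_zero _ hD)]
    exact fun P hP ↦ (H.emultiplicity_eq (ofPrime hP)).le
  · rw [UniqueFactorizationMonoid.dvd_iff_emultiplicity_le hs]
    exact fun P hP ↦ (H.emultiplicity_eq (ofPrime hP)).ge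

theorem rootDiscr_pow (H : IsRootData ℚ α β) :
    rootDiscr M ^ 80 = 2 ^ 195 * 3 ^ 40 * 7 ^ 64 := by
  have h1 := congrArg Ideal.absNorm H.differentIdeal_pow
  rw [map_pow, absNorm_differentIdeal M, Ideal.absNorm_span_natCast,
    RingOfIntegers.rank] at h1
  have h2 : ((|discr M| : ℤ) : ℝ) ^ 80 =
      (2 ^ 195 * 3 ^ 40 * 7 ^ 64 : ℝ) ^ Module.finrank ℚ M := by
    rw [← Nat.cast_natAbs]
    exact_mod_cast h1
  have hpos : 0 < Module.finrank ℚ M := Module.finrank_pos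
  have h3 : (0 : ℝ) ≤ (|discr M| : ℤ) := by positivity
  rw [rootDiscr, ← Real.rpow_natCast (_ ^ _), ← Real.rpow_mul h3, mul_comm,
    Real.rpow_mul h3, Real.rpow_natCast]
  rw [h2, ← Real.rpow_natCast, ← Real.rpow_mul (by positivity), mul_inv_cancel₀ (by positivity),
    Real.rpow_one]

theorem rootDiscr_eq (H : IsRootData ℚ α β) :
    rootDiscr M = (2 : ℝ) ^ (39 / 16 : ℝ) * (3 : ℝ) ^ (1 / 2 : ℝ) * (7 : ℝ) ^ (4 / 5 : ℝ) := by
  have h0 : 0 ≤ rootDiscr M := by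
    rw [rootDiscr]
    positivity
  rw [← pow_left_inj₀ h0 (by positivity) (n := 80) (by norm_num), H.rootDiscr_pow, mul_pow, mul_pow,
    ← Real.rpow_mul_natCast (by norm_num), ← Real.rpow_mul_natCast (by norm_num),
    ← Real.rpow_mul_natCast (by norm_num)]
  norm_num

end IsRootData

section

open WithZero Valuation IsLocalRing

/-- `φ` preserves `v` and induces the `p`-th power map on the residue field. -/
structure IsFrobenius {F M : Type*} [Field F] [Field M] [Algebra F M] (v : Valuation M ℤᵐ⁰)
    (p : ℕ) (φ : Gal(M/F)) : Prop where
  map_apply : ∀ x, v (φ x) = v x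
  map_apply_sub_pow_lt : ∀ x, v x ≤ 1 → v (φ x - x ^ p) < 1

theorem exists_isFrobenius (M : Type*) [Field M] [NumberField M] [IsGalois ℚ M] {p : ℕ}
    (hp : p.Prime) : ∃ v : Valuation M ℤᵐ⁰, v p < 1 ∧ ∃ φ : Gal(M/ℚ), IsFrobenius v p φ := by
  obtain ⟨w, hw⟩ := IsDedekindDomain.HeightOneSpectrum.exists_valuation_lt_one M hp
  obtain ⟨φ, hφ, hφ'⟩ := w.exists_frobenius hp hw
  exact ⟨w.valuation M, hw, φ, w.valuation_apply_of_mem_stabilizer hφ,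
    w.valuation_apply_sub_pow_lt hφ hφ'⟩

namespace Valuation

variable {M : Type*} [Field M] {v : Valuation M ℤᵐ⁰} {p : ℕ}

theorem res_natCast (n : ℕ) : v.res (n : M) = n := by
  simpa using res_intCast (v := v) n

theorem natCast_residueField_eq_zero (hv : v (p : M) < 1) :
    (p : IsLocalRing.ResidueField v.valuationSubring) = 0 := by
  rw [← res_natCast, res_eq_zero_iff (map_natCast_le_one p)]
  exact hv

theorem charP_residueField (hp : p.Prime) (hv : v (p : M) < 1) :
    CharP (IsLocalRing.ResidueField v.valuationSubring) p :=
  (CharP.charP_iff_prime_eq_zero hp).2 (natCast_residueField_eq_zero hv)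

end Valuation

theorem intCast_pow_char {k : Type*} [Field k] {p : ℕ} (hp : p.Prime) [CharP k p] (a : ℤ) :
    (a : k) ^ p = a := by
  have : Fact p.Prime := ⟨hp⟩
  exact map_intCast (frobenius k p) a

theorem pow_char_ne_of_sq_eq {k : Type*} [Field k] {p : ℕ} (hp : p.Prime) [CharP k p]
    (hp2 : p ≠ 2) {D : ℤ} (hD : jacobiSym D p = -1) {u : k} (hu : u ^ 2 = D) : u ^ p ≠ u := by
  intro h
  have : Fact p.Prime := ⟨hp⟩
  have h1 : (D : ZMod p) ^ (p / 2) = -1 := by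
    rw [← legendreSym.eq_pow, jacobiSym.legendreSym.to_jacobiSym, hD]
    norm_num
  have h2 : (D : k) ^ (p / 2) = -1 := by
    have := congrArg (ZMod.castHom (dvd_refl p) k) h1
    simpa using this
  rw [← hu, ← pow_mul] at h2
  have hodd : 2 * (p / 2) + 1 = p := by
    have := hp.eq_two_or_odd
    omega
  have h3 : u * (-1) = u := by
    rw [← h2, ← pow_succ', hodd, h]
  have h4 : (2 : k) ≠ 0 := by
    intro h0
    have := (CharP.cast_eq_zero_iff k p 2).1 (by exact_mod_cast h0)
    exact hp2 ((Nat.prime_dvd_prime_iff_eq hp Nat.prime_two).1 this)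
  have h5 : u = 0 := by
    have : 2 * u = 0 := by linear_combination -h3
    simpa [h4] using this
  rw [h5, zero_pow (by have := hp.two_le; omega)] at h2
  norm_num at h2

namespace IsFrobenius

open Valuation

variable {F M : Type*} [Field F] [Field M] [Algebra F M] {v : Valuation M ℤᵐ⁰} {p : ℕ}
  {φ : Gal(M/F)} {f : ℤ[X]} {n : ℕ} {r : Fin n → M}

theorem res_apply (h : IsFrobenius v p φ) {x : M} (hx : v x ≤ 1) :
    v.res (φ x) = v.res x ^ p := by
  rw [← res_pow hx, res_eq_res_iff (by rwa [h.map_apply]) (map_pow_le_one hx p)]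
  exact h.map_apply_sub_pow_lt x hx

theorem injective_res (hr : f.map (Int.castRingHom M) = ∏ i, (X - C (r i))) (hf : f.Monic)
    (hsep : ∀ i, v (aeval (r i) (derivative f)) = 1) :
    Function.Injective fun i ↦ v.res (r i) := by
  intro i j hij
  by_contra hne
  have := map_aeval_derivative_lt_one hr hf hne ((res_eq_res_iff (map_root_le_one' hr hf i)
    (map_root_le_one' hr hf j)).1 hij)
  exact this.ne (hsep i)

theorem rootPerm_apply_eq_iff (h : IsFrobenius v p φ)
    (hr : f.map (Int.castRingHom M) = ∏ i, (X - C (r i))) (hinj : Function.Injective r)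
    (hf : f.Monic) (hsep : ∀ i, v (aeval (r i) (derivative f)) = 1) (i : Fin n) :
    rootPerm hr hinj φ i = i ↔ v.res (r i) ^ p = v.res (r i) := by
  rw [← h.res_apply (map_root_le_one' hr hf i), ← apply_rootPerm hr hinj]
  exact (injective_res hr hf hsep).eq_iff.symm

theorem aeval_res_eq_zero (hr : f.map (Int.castRingHom M) = ∏ i, (X - C (r i))) (hf : f.Monic)
    (i : Fin n) : aeval (v.res (r i)) f = 0 := by
  rw [← res_aeval (map_root_le_one' hr hf i), aeval_eq_zero_of_eq_prod hr,
    res_eq_zero_iff (by simp)]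
  simp

/-- A Frobenius acts trivially on the roots of a polynomial which splits modulo `p`. -/
theorem rootPerm_eq_one (h : IsFrobenius v p φ) (hp : p.Prime) (hv : v (p : M) < 1)
    (hr : f.map (Int.castRingHom M) = ∏ i, (X - C (r i))) (hinj : Function.Injective r)
    (hf : f.Monic) (hsep : ∀ i, v (aeval (r i) (derivative f)) = 1)
    (hfac : ∀ x : IsLocalRing.ResidueField v.valuationSubring, aeval x f = 0 → ∃ a : ℤ, x = a) :
    rootPerm hr hinj φ = 1 := by
  have := charP_residueField hp hv
  ext i : 1
  rw [Equiv.Perm.one_apply, h.rootPerm_apply_eq_iff hr hinj hf hsep]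
  obtain ⟨a, ha⟩ := hfac _ (aeval_res_eq_zero hr hf i)
  rw [ha, intCast_pow_char hp]

/-- A Frobenius acts as a transposition on the roots of a polynomial which splits modulo `p` up to
an irreducible quadratic factor. -/
theorem isSwap_rootPerm (h : IsFrobenius v p φ) (hp : p.Prime) (hp2 : p ≠ 2) (hv : v (p : M) < 1)
    (hr : f.map (Int.castRingHom M) = ∏ i, (X - C (r i))) (hinj : Function.Injective r)
    (hf : f.Monic) (hsep : ∀ i, v (aeval (r i) (derivative f)) = 1) {S : Finset ℤ}
    (hS : S.card < n) {b c : ℤ} (hD : jacobiSym (b ^ 2 - 4 * c) p = -1)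
    (hfac : ∀ x : IsLocalRing.ResidueField v.valuationSubring, aeval x f = 0 →
      (∃ a ∈ S, x = (a : ℤ)) ∨ x ^ 2 + b * x + c = 0) :
    (rootPerm hr hinj φ).IsSwap := by
  classical
  have := charP_residueField hp hv
  have hres := injective_res hr hf hsep
  have hfix : ∀ i, (∃ a ∈ S, v.res (r i) = (a : ℤ)) → rootPerm hr hinj φ i = i := by
    rintro i ⟨a, -, ha⟩
    rw [h.rootPerm_apply_eq_iff hr hinj hf hsep, ha, intCast_pow_char hp]
  have hquad : ∀ i, ¬(∃ a ∈ S, v.res (r i) = (a : ℤ)) →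
      v.res (r i) ^ 2 + b * v.res (r i) + c = 0 := fun i hi ↦
    (hfac _ (aeval_res_eq_zero hr hf i)).resolve_left hi
  have hmove : ∀ i, v.res (r i) ^ 2 + b * v.res (r i) + c = 0 → rootPerm hr hinj φ i ≠ i := by
    intro i hi hfi
    rw [h.rootPerm_apply_eq_iff hr hinj hf hsep] at hfi
    refine pow_char_ne_of_sq_eq hp hp2 hD (u := 2 * v.res (r i) + b) ?_ ?_
    · push_cast
      linear_combination 4 * hi
    · have : Fact p.Prime := ⟨hp⟩
      rw [add_pow_char, mul_pow, hfi, intCast_pow_char hp]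
      have := intCast_pow_char (k := IsLocalRing.ResidueField v.valuationSubring) hp 2
      push_cast at this
      rw [this]
  obtain ⟨i, hi⟩ : ∃ i, ¬(∃ a ∈ S, v.res (r i) = (a : ℤ)) := by
    by_contra! hall
    choose a ha hra using hall
    have hcard := Finset.card_le_card_of_injOn a (s := Finset.univ) (t := S) (fun i _ ↦ ha i)
      (fun i _ j _ hij ↦ hres (by simp only [hra, hij]))
    simp only [Finset.card_univ, Fintype.card_fin] at hcard
    omega
  have hi' := hmove i (hquad i hi)
  set j := rootPerm hr hinj φ i with hj
  have hj' : rootPerm hr hinj φ j ≠ j := fun he ↦ hi' ((rootPerm hr hinj φ).injective (by rw [← hj, he]))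
  refine Equiv.Perm.card_support_eq_two.1 ?_
  rw [show (rootPerm hr hinj φ).support = {i, j} from ?_, Finset.card_pair hi'.symm]
  ext l
  rw [Equiv.Perm.mem_support, Finset.mem_insert, Finset.mem_singleton]
  constructor
  · intro hl
    have h1 := hquad i hi
    have h2 := hquad j (fun hS ↦ hj' (hfix j hS))
    have h3 := hquad l (fun hS ↦ hl (hfix l hS))
    have hij : v.res (r i) - v.res (r j) ≠ 0 := sub_ne_zero.2 fun he ↦ hi' (hres he).symm
    have h4 : v.res (r i) + v.res (r j) + b = 0 := by
      refine (mul_eq_zero.1 (?_ : (v.res (r i) - v.res (r j)) * _ = 0)).resolve_left hij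
      linear_combination h1 - h2
    have h5 : (v.res (r l) - v.res (r i)) * (v.res (r l) - v.res (r j)) = 0 := by
      linear_combination h3 - h1 + (v.res (r i) - v.res (r l)) * h4
    rcases mul_eq_zero.1 h5 with h5 | h5
    · exact Or.inl (hres (sub_eq_zero.1 h5))
    · exact Or.inr (hres (sub_eq_zero.1 h5))
  · rintro (rfl | rfl)
    · exact hi'
    · exact hj'

theorem apply_ne_of_sq_eq (h : IsFrobenius v p φ) (hp : p.Prime) (hp2 : p ≠ 2)
    (hv : v (p : M) < 1) {D : ℤ} (hD : jacobiSym D p = -1) {x : M} (hx : x ^ 2 = D) :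
    φ x ≠ x := by
  have := charP_residueField hp hv
  have hx1 : v x ≤ 1 := by
    rw [← pow_le_one_iff two_ne_zero, ← map_pow, hx]
    exact map_intCast_le_one D
  intro he
  refine pow_char_ne_of_sq_eq hp hp2 hD (u := v.res x) ?_ ?_
  · rw [← res_pow hx1, hx, res_intCast]
  · rw [← h.res_apply hx1, he]

end IsFrobenius

end

section

open WithZero Valuation IsLocalRing

section

variable {k : Type*} [Field k] {x : k}

theorem roots_quintic_41659 (hp : (41659 : k) = 0) (hx : aeval x quintic = 0) :
    (∃ a ∈ ({10835, 16325, -15145} : Finset ℤ), x = (a : ℤ)) ∨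
      x ^ 2 + (12014 : ℤ) * x + (-253 : ℤ) = 0 := by
  have h : (x - 10835) * (x - 16325) * (x + 15145) * (x ^ 2 + 12014 * x - 253) = 0 := by
    rw [aeval_quintic] at hx
    linear_combination hx - (16269082584 - 772557780264 * x + 3310037 * x ^ 2 + 9093 * x ^ 3) * hp
  simp only [mul_eq_zero, sub_eq_zero, add_eq_zero_iff_eq_neg, or_assoc] at h
  rcases h with h | h | h | h
  · exact Or.inl ⟨10835, by simp, by simp [h]⟩
  · exact Or.inl ⟨16325, by simp, by simp [h]⟩
  · exact Or.inl ⟨-15145, by simp, by simp [h]⟩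
  · exact Or.inr (by push_cast; linear_combination h)

theorem roots_sextic_41659 (hp : (41659 : k) = 0) (hx : aeval x sextic = 0) :
    ∃ a : ℤ, x = a := by
  have h : (x - 4203) * (x + 17137) * (x + 13447) * (x + 13278) * (x + 1429) * (x + 569) = 0 := by
    rw [aeval_sextic] at hx
    linear_combination hx - (251008200579161134 + 609288737464017 * x + 281441052579 * x ^ 2 -
      31689414 * x ^ 3 - 12776 * x ^ 4 - 1 * x ^ 5) * hp
  simp only [mul_eq_zero, sub_eq_zero, add_eq_zero_iff_eq_neg, or_assoc] at h
  rcases h with h | h | h | h | h | h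
  exacts [⟨4203, by simp [h]⟩, ⟨-17137, by simp [h]⟩, ⟨-13447, by simp [h]⟩,
    ⟨-13278, by simp [h]⟩, ⟨-1429, by simp [h]⟩, ⟨-569, by simp [h]⟩]

theorem roots_quintic_202693 (hp : (202693 : k) = 0) (hx : aeval x quintic = 0) :
    ∃ a : ℤ, x = a := by
  have h : (x - 36634) * (x - 36873) * (x - 90439) * (x - 92403) * (x + 53655) = 0 := by
    rw [aeval_quintic] at hx
    linear_combination hx - (-2988175400337520573 + 172294923144890 * x - 1878336993 * x ^ 2 -
      46343 * x ^ 3 + 1 * x ^ 4) * hp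
  simp only [mul_eq_zero, sub_eq_zero, add_eq_zero_iff_eq_neg, or_assoc] at h
  rcases h with h | h | h | h | h
  exacts [⟨36634, by simp [h]⟩, ⟨36873, by simp [h]⟩, ⟨90439, by simp [h]⟩,
    ⟨92403, by simp [h]⟩, ⟨-53655, by simp [h]⟩]

theorem roots_sextic_202693 (hp : (202693 : k) = 0) (hx : aeval x sextic = 0) :
    (∃ a ∈ ({75510, 82731, 97900, -1631} : Finset ℤ), x = (a : ℤ)) ∨
      x ^ 2 + (51815 : ℤ) * x + (54619 : ℤ) = 0 := by
  have h : (x - 75510) * (x - 82731) * (x - 97900) * (x + 1631) *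
      (x ^ 2 + 51815 * x + 54619) = 0 := by
    rw [aeval_sextic] at hx
    linear_combination hx - (268790794429715860 + 255147008367080538 * x +
      152192478652927 * x ^ 2 - 2607929441 * x ^ 3 - 40128 * x ^ 4 + 1 * x ^ 5) * hp
  simp only [mul_eq_zero, sub_eq_zero, add_eq_zero_iff_eq_neg, or_assoc] at h
  rcases h with h | h | h | h | h
  · exact Or.inl ⟨75510, by simp, by simp [h]⟩
  · exact Or.inl ⟨82731, by simp, by simp [h]⟩
  · exact Or.inl ⟨97900, by simp, by simp [h]⟩
  · exact Or.inl ⟨-1631, by simp, by simp [h]⟩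
  · exact Or.inr (by push_cast; linear_combination h)

theorem roots_quintic_1240319 (hp : (1240319 : k) = 0) (hx : aeval x quintic = 0) :
    ∃ a : ℤ, x = a := by
  have h : (x - 385119) * (x - 547734) * (x - 566391) * (x + 150506) * (x + 108418) = 0 := by
    rw [aeval_quintic] at hx
    linear_combination hx - (1571819953992093889051 + 15215131555646269 * x -
      38282911485 * x ^ 2 - 296238 * x ^ 3 + 1 * x ^ 4) * hp
  simp only [mul_eq_zero, sub_eq_zero, add_eq_zero_iff_eq_neg, or_assoc] at h
  rcases h with h | h | h | h | h
  exacts [⟨385119, by simp [h]⟩, ⟨547734, by simp [h]⟩, ⟨566391, by simp [h]⟩,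
    ⟨-150506, by simp [h]⟩, ⟨-108418, by simp [h]⟩]

theorem roots_sextic_1240319 (hp : (1240319 : k) = 0) (hx : aeval x sextic = 0) :
    ∃ a : ℤ, x = a := by
  have h : (x - 221167) * (x - 368776) * (x - 522842) * (x + 591333) * (x + 325179) *
      (x + 196271) = 0 := by
    rw [aeval_sextic] at hx
    linear_combination hx - (1297569980299215953280862052 + 928480034422955635926 * x -
      44908118638166217 * x ^ 2 - 12047002340 * x ^ 3 + 383858 * x ^ 4) * hp
  simp only [mul_eq_zero, sub_eq_zero, add_eq_zero_iff_eq_neg, or_assoc] at h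
  rcases h with h | h | h | h | h | h
  exacts [⟨221167, by simp [h]⟩, ⟨368776, by simp [h]⟩, ⟨522842, by simp [h]⟩,
    ⟨-591333, by simp [h]⟩, ⟨-325179, by simp [h]⟩, ⟨-196271, by simp [h]⟩]

end

namespace IsRootData

variable {M : Type*} [Field M] [NumberField M] {α : Fin 5 → M} {β : Fin 6 → M}

theorem map_aeval_derivative_eq_one (H : IsRootData ℚ α β) {v : Valuation M ℤᵐ⁰} {p : ℕ}
    (hv : v (p : M) < 1) (hp : p.Coprime 42) :
    (∀ i, v (aeval (α i) (derivative quintic)) = 1) ∧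
      ∀ i, v (aeval (β i) (derivative sextic)) = 1 := by
  have hp' : p.Coprime (2 * 3 * 7) := hp
  rw [Nat.coprime_mul_iff_right, Nat.coprime_mul_iff_right] at hp'
  obtain ⟨⟨h2, h3⟩, h7⟩ := hp'
  have e2 : v 2 = 1 := by exact_mod_cast map_natCast_eq_one_of_coprime hv h2
  have e3 : v 3 = 1 := by exact_mod_cast map_natCast_eq_one_of_coprime hv h3
  have e7 : v 7 = 1 := by exact_mod_cast map_natCast_eq_one_of_coprime hv h7
  refine ⟨H.map_aeval_derivative_quintic_eq_one ?_, H.map_aeval_derivative_sextic_eq_one ?_⟩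
  · rw [show (61236 : M) = 2 ^ 2 * 3 ^ 7 * 7 by norm_num]; simp [e2, e3, e7]
  · rw [show (21168 : M) = 2 ^ 4 * 3 ^ 3 * 7 ^ 2 by norm_num]; simp [e2, e3, e7]

variable [IsGalois ℚ M]

theorem exists_isSwap_α (H : IsRootData ℚ α β) : ∃ σ : Gal(M/ℚ),
    (rootPerm H.map_quintic H.injective_α σ).IsSwap ∧
    rootPerm H.map_sextic H.injective_β σ = 1 := by
  have hp : Nat.Prime 41659 := by norm_num
  obtain ⟨v, hv, φ, hφ⟩ := exists_isFrobenius M hp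
  have hk := natCast_residueField_eq_zero hv
  obtain ⟨h1, h2⟩ := H.map_aeval_derivative_eq_one hv (by norm_num)
  refine ⟨φ, ?_, ?_⟩
  · exact hφ.isSwap_rootPerm hp (by norm_num) hv _ _ monic_quintic h1 (by decide)
      (by norm_num) fun x hx ↦ roots_quintic_41659 (by exact_mod_cast hk) hx
  · exact hφ.rootPerm_eq_one hp hv _ _ monic_sextic h2
      fun x hx ↦ roots_sextic_41659 (by exact_mod_cast hk) hx

theorem exists_isSwap_β (H : IsRootData ℚ α β) : ∃ σ : Gal(M/ℚ),
    rootPerm H.map_quintic H.injective_α σ = 1 ∧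
    (rootPerm H.map_sextic H.injective_β σ).IsSwap := by
  have hp : Nat.Prime 202693 := by norm_num
  obtain ⟨v, hv, φ, hφ⟩ := exists_isFrobenius M hp
  have hk := natCast_residueField_eq_zero hv
  obtain ⟨h1, h2⟩ := H.map_aeval_derivative_eq_one hv (by norm_num)
  refine ⟨φ, ?_, ?_⟩
  · exact hφ.rootPerm_eq_one hp hv _ _ monic_quintic h1
      fun x hx ↦ roots_quintic_202693 (by exact_mod_cast hk) hx
  · exact hφ.isSwap_rootPerm hp (by norm_num) hv _ _ monic_sextic h2 (by decide)
      (by norm_num) fun x hx ↦ roots_sextic_202693 (by exact_mod_cast hk) hx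

theorem exists_forall_sq_eq_apply_ne (H : IsRootData ℚ α β) : ∃ σ : Gal(M/ℚ),
    rootPerm H.map_quintic H.injective_α σ = 1 ∧
    rootPerm H.map_sextic H.injective_β σ = 1 ∧ ∀ x : M, x ^ 2 = -3 → σ x ≠ x := by
  have hp : Nat.Prime 1240319 := by norm_num
  obtain ⟨v, hv, φ, hφ⟩ := exists_isFrobenius M hp
  have hk := natCast_residueField_eq_zero hv
  obtain ⟨h1, h2⟩ := H.map_aeval_derivative_eq_one hv (by norm_num)
  refine ⟨φ, ?_, ?_, fun x hx ↦ ?_⟩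
  · exact hφ.rootPerm_eq_one hp hv _ _ monic_quintic h1
      fun x hx ↦ roots_quintic_1240319 (by exact_mod_cast hk) hx
  · exact hφ.rootPerm_eq_one hp hv _ _ monic_sextic h2
      fun x hx ↦ roots_sextic_1240319 (by exact_mod_cast hk) hx
  · exact hφ.apply_ne_of_sq_eq hp (by norm_num) hv (D := -3)
      (by norm_num) (by rw [hx]; norm_num)

end IsRootData

end

namespace Equiv.Perm

theorem eq_top_of_normal_of_isSwap_mem {X : Type*} [Finite X] [DecidableEq X]
    {N : Subgroup (Equiv.Perm X)} [hN : N.Normal] {s : Equiv.Perm X} (hs : s.IsSwap) (h : s ∈ N) :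
    N = ⊤ := by
  rw [eq_top_iff, ← closure_isSwap, Subgroup.closure_le]
  rintro _ ⟨x, y, hxy, rfl⟩
  obtain ⟨a, b, hab, rfl⟩ := hs
  obtain ⟨c, hc⟩ := isConj_iff.1 (isConj_swap hab hxy)
  rw [← hc]
  exact hN.conj_mem _ h c

/-- A subgroup of `S₆` without fixed points which contains a transposition and an element of order
`5` is everything. -/
theorem eq_top_of_isSwap_mem_of_orderOf_eq_five {G : Subgroup (Equiv.Perm (Fin 6))}
    {g s : Equiv.Perm (Fin 6)} (hg : g ∈ G) (hg5 : orderOf g = 5) (hs : s ∈ G) (hsw : s.IsSwap)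
    (hG : ∀ c, ∃ h ∈ G, h c ≠ c) : G = ⊤ := by
  have hcyc : g.IsCycle := isCycle_of_prime_order' (by rw [hg5]; norm_num) (by rw [hg5]; simp)
  have hcard : g.supportᶜ.card = 1 := by
    rw [Finset.card_compl, ← hcyc.orderOf, hg5, Fintype.card_fin]
  obtain ⟨c, hc⟩ := Finset.card_eq_one.1 hcard
  have hmove : ∀ x, x ≠ c → g x ≠ x := by
    intro x hx hgx
    have : x ∈ g.supportᶜ := by simpa using hgx
    rw [hc] at this
    exact hx (by simpa using this)
  have hgc : g c = c := by
    have : c ∈ g.supportᶜ := by simp [hc]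
    simpa using this
  have hpow : ∀ x y, x ≠ c → y ≠ c → ∃ k ∈ G, k c = c ∧ k x = y := by
    intro x y hx hy
    obtain ⟨i, hi⟩ := hcyc.exists_pow_eq (hmove x hx) (hmove y hy)
    exact ⟨g ^ i, pow_mem hg i, pow_apply_eq_self_of_apply_eq_self hgc i, hi⟩
  have hconj : ∀ {k x y}, k ∈ G → Equiv.swap x y ∈ G → Equiv.swap (k x) (k y) ∈ G := by
    intro k x y hk hxy
    rw [Equiv.swap_apply_apply]
    exact mul_mem (mul_mem hk hxy) (inv_mem hk)
  obtain ⟨a, b, hab, rfl⟩ := hsw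
  obtain ⟨k, hk, hka⟩ : ∃ k ∈ G, k a = c := by
    by_cases hac : a = c
    · exact ⟨1, one_mem G, hac⟩
    · obtain ⟨h, hh, hhc⟩ := hG c
      obtain ⟨k, hk, -, hk'⟩ := hpow (h c) a hhc hac
      exact ⟨(k * h)⁻¹, inv_mem (mul_mem hk hh), by rw [inv_eq_iff_eq, mul_apply, hk']⟩
  have h1 := hconj hk hs
  rw [hka] at h1
  have hkb : k b ≠ c := by
    rw [← hka]
    exact fun h ↦ hab (k.injective h).symm
  have h2 : ∀ x, x ≠ c → Equiv.swap c x ∈ G := by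
    intro x hx
    obtain ⟨l, hl, hlc, hlx⟩ := hpow _ x hkb hx
    have := hconj hl h1
    rwa [hlc, hlx] at this
  rw [eq_top_iff, ← closure_isSwap, Subgroup.closure_le]
  rintro _ ⟨x, y, hxy, rfl⟩
  by_cases hx : x = c
  · rw [hx]
    exact h2 y (hx ▸ hxy.symm)
  by_cases hy : y = c
  · rw [hy, Equiv.swap_comm]
    exact h2 x hx
  · have := hconj (h2 x hx) (h2 y hy)
    rwa [Equiv.swap_apply_left, Equiv.swap_apply_of_ne_of_ne hy hxy.symm] at this

/-- A proper quotient of `Sₙ` is solvable for `n ≥ 5`. -/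
theorem isSolvable_of_surjective_of_not_injective {X G : Type*} [Finite X] [Group G]
    (hX : 5 ≤ Nat.card X) {f : Equiv.Perm X →* G} (hf : Function.Surjective f)
    (hf' : ¬Function.Injective f) : Group.IsSolvable G := by
  classical
  have := Fintype.ofFinite X
  have hle := alternatingGroup_le_of_normal hX (N := f.ker) (by
    rw [Subgroup.nontrivial_iff_ne_bot, Ne, f.ker_eq_bot_iff]
    exact hf')
  refine Group.isSolvable_of_comm fun a b ↦ ?_
  obtain ⟨a, rfl⟩ := hf a
  obtain ⟨b, rfl⟩ := hf b
  have hmem : a * b * a⁻¹ * b⁻¹ ∈ alternatingGroup X := by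
    rw [mem_alternatingGroup]
    simp only [map_mul, map_inv]
    rw [mul_right_comm (sign a), mul_inv_cancel, one_mul, mul_inv_cancel]
  have h1 := MonoidHom.mem_ker.1 (hle hmem)
  simp only [map_mul, map_inv] at h1
  rwa [mul_inv_eq_one, mul_inv_eq_iff_eq_mul] at h1

end Equiv.Perm

theorem aeval_intCast_sextic_ne_zero {M : Type*} [Field M] [CharZero M] (n : ℤ) :
    aeval (n : M) sextic ≠ 0 := by
  rw [aeval_sextic]
  norm_cast
  intro h
  obtain ⟨m, rfl | rfl⟩ := Int.even_or_odd' n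
  all_goals
    ring_nf at h
    omega

namespace IsRootData

open WithZero Valuation IsDedekindDomain.HeightOneSpectrum

variable {M : Type*} [Field M] [NumberField M] [IsGalois ℚ M] {α : Fin 5 → M} {β : Fin 6 → M}

theorem exists_orderOf_eq_five (H : IsRootData ℚ α β) : ∃ σ : Gal(M/ℚ),
    orderOf (rootPerm H.map_quintic H.injective_α σ) = 5 ∧
    orderOf (rootPerm H.map_sextic H.injective_β σ) = 5 := by
  obtain ⟨w, hw⟩ := IsDedekindDomain.HeightOneSpectrum.exists_valuation_lt_one M
    (p := 7) (by norm_num)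
  have h := w.isTotallyRamified
  set I := w.asIdeal.inertia Gal(M/ℚ)
  obtain ⟨π, hπ'⟩ := w.intValuation_exists_uniformizer
  have hπ : w.valuation M (algebraMap _ M π) = exp (-1) := by
    have h := w.valuation_of_algebraMap (K := M) π
    exact h.trans hπ'
  have hcop : ∀ n : ℕ, Nat.Coprime 7 n → w.valuation M (n : M) = 1 := fun n hn ↦
    map_natCast_eq_one_of_coprime hw hn
  have h2 := hcop 2 (by norm_num)
  have h3 := hcop 3 (by norm_num)
  have h5 := hcop 5 (by norm_num)
  have hvp := w.valuation_natCast_eq_exp (by norm_num) hw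
  push_cast at hvp h2 h3 h5 hw
  have hcard := H.card_eq_five_of_seven h hπ h2 h3 h5 hvp
  rw [hcard] at hvp
  have : Fact (Nat.Prime 5) := ⟨by norm_num⟩
  have : Nontrivial I := Finite.one_lt_card_iff_nontrivial.1 (by rw [hcard]; norm_num)
  obtain ⟨σ, hσ1⟩ := exists_ne (1 : I)
  have hσ5 : σ.1 ^ 5 = 1 := by
    have := pow_card_eq_one' (x := σ)
    rw [hcard] at this
    exact congrArg Subtype.val this
  have hgen : ∀ x : M, σ.1 x = x → ∀ τ ∈ I, τ x = x := by
    intro x hx τ hτ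
    have hle : Subgroup.zpowers σ.1 ≤ MulAction.stabilizer Gal(M/ℚ) x := by
      rw [Subgroup.zpowers_le]
      exact hx
    have hmem : (⟨τ, hτ⟩ : I) ∈ Subgroup.zpowers σ := mem_zpowers_of_prime_card hcard hσ1
    obtain ⟨k, hk⟩ := Subgroup.mem_zpowers_iff.1 hmem
    exact hle (Subgroup.mem_zpowers_iff.2 ⟨k, by simpa using congrArg Subtype.val hk⟩)
  have hmove : ∀ x : M, w.valuation M x ^ 5 = w.valuation M 7 → σ.1 x ≠ x := by
    intro x hx hfix
    have hx0 : x ≠ 0 := by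
      rintro rfl
      rw [map_zero, zero_pow (by norm_num), hvp] at hx
      exact exp_ne_zero hx.symm
    obtain ⟨k, hk⟩ := h.exists_eq_exp x hx0 (hgen x hfix)
    rw [hk, hvp, hcard, ← exp_nsmul, exp_inj] at hx
    simp only [nsmul_eq_mul] at hx
    push_cast at hx
    omega
  refine ⟨σ.1, orderOf_eq_prime ?_ fun h1 ↦ ?_, orderOf_eq_prime ?_ fun h1 ↦ ?_⟩
  · rw [← map_pow, hσ5, map_one]
  · refine hmove _ (H.map_α_sub_three_pow hw 0) ?_
    rw [_root_.map_sub, map_ofNat, apply_eq_of_rootPerm_eq_one H.map_quintic H.injective_α h1]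
  · rw [← map_pow, hσ5, map_one]
  · obtain ⟨i, hi⟩ : ∃ i, w.valuation M (β i - 5) ^ 5 = w.valuation M 7 := by
      by_contra! hne
      have hall : ∀ i, w.valuation M (β i - 5) = w.valuation M 7 := fun i ↦
        (H.map_β_sub_five hw (by rw [hvp]; exact exp_ne_zero) i).resolve_left (hne i)
      have := congrArg (w.valuation M) (aeval_eq_prod H.map_sextic (5 : M))
      rw [aeval_sextic, show (5 ^ 6 - 2 * 5 ^ 5 + 4 * 5 ^ 4 - 8 * 5 ^ 3 + 2 * 5 ^ 2 + 24 * 5 - 20 : M)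
        = 3 ^ 2 * 5 ^ 2 * 7 ^ 2 by norm_num, map_mul, map_mul, map_pow, map_pow, h3, h5, one_pow,
        one_mul, one_mul, map_pow, map_prod, Finset.prod_congr rfl fun i _ ↦
          ((w.valuation M).map_sub_swap 5 (β i)).trans (hall i)] at this
      rw [Finset.prod_const, Finset.card_univ, Fintype.card_fin, hvp, ← exp_nsmul, ← exp_nsmul,
        exp_inj] at this
      norm_num at this
    refine hmove _ hi ?_
    rw [_root_.map_sub, map_ofNat, apply_eq_of_rootPerm_eq_one H.map_sextic H.injective_β h1]

theorem range_rootPerm_α (H : IsRootData ℚ α β) :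
    (rootPerm H.map_quintic H.injective_α (F := ℚ)).range = ⊤ := by
  classical
  obtain ⟨σ, h1, -⟩ := H.exists_orderOf_eq_five
  obtain ⟨τ, h2, -⟩ := H.exists_isSwap_α
  refine Equiv.Perm.subgroup_eq_top_of_swap_mem (by norm_num) ?_ ⟨τ, rfl⟩ h2
  rw [Fintype.card_eq_nat_card, Fintype.card_eq_nat_card, Nat.card_fin]
  nth_rw 1 [← h1]
  exact Subgroup.orderOf_dvd_natCard _ ⟨σ, rfl⟩

theorem range_rootPerm_β (H : IsRootData ℚ α β) :
    (rootPerm H.map_sextic H.injective_β (F := ℚ)).range = ⊤ := by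
  obtain ⟨σ, -, h1⟩ := H.exists_orderOf_eq_five
  obtain ⟨τ, -, h2⟩ := H.exists_isSwap_β
  refine Equiv.Perm.eq_top_of_isSwap_mem_of_orderOf_eq_five ⟨σ, rfl⟩ h1 ⟨τ, rfl⟩ h2 fun c ↦ ?_
  by_contra! hfix
  have h3 : β c ∈ (⊥ : IntermediateField ℚ M) := by
    rw [IsGalois.mem_bot_iff_fixed]
    intro τ
    rw [← apply_rootPerm H.map_sextic H.injective_β, hfix _ ⟨τ, rfl⟩]
  obtain ⟨q, hq⟩ := IntermediateField.mem_bot.1 h3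
  have hint : IsIntegral ℤ q := by
    rw [← isIntegral_algebraMap_iff (algebraMap ℚ M).injective, hq]
    exact ⟨sextic, monic_sextic, H.aeval_β c⟩
  obtain ⟨n, hn⟩ := IsIntegrallyClosed.isIntegral_iff.1 hint
  have := H.aeval_β c
  rw [← hq, ← hn] at this
  simp only [eq_intCast, map_intCast] at this
  exact aeval_intCast_sextic_ne_zero n this

end IsRootData

theorem MonoidHom.exists_mem_apply_eq_of_isSwap {G X : Type*} [Group G] [Finite X] [DecidableEq X]
    {f : G →* Equiv.Perm X} (hf : f.range = ⊤) {N : Subgroup G} (hN : N.Normal) {σ : G}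
    (hσ : σ ∈ N) (hsw : (f σ).IsSwap) (s : Equiv.Perm X) : ∃ τ ∈ N, f τ = s := by
  have : (N.map f).Normal := hN.map f (MonoidHom.range_eq_top.1 hf)
  have h := Equiv.Perm.eq_top_of_normal_of_isSwap_mem hsw (Subgroup.mem_map_of_mem f hσ)
  obtain ⟨τ, h1, h2⟩ := h.ge (Subgroup.mem_top s)
  exact ⟨τ, h1, h2⟩

namespace IsRootData

variable {M : Type*} [Field M] [NumberField M] {α : Fin 5 → M} {β : Fin 6 → M}

/-- The permutations of the roots of both polynomials induced by an automorphism. -/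
noncomputable def rootPerms (H : IsRootData ℚ α β) :
    Gal(M/ℚ) →* Equiv.Perm (Fin 5) × Equiv.Perm (Fin 6) :=
  (rootPerm H.map_quintic H.injective_α).prod (rootPerm H.map_sextic H.injective_β)

theorem rootPerms_eq_one_iff (H : IsRootData ℚ α β) {σ : Gal(M/ℚ)} :
    H.rootPerms σ = 1 ↔ (∀ i, σ (α i) = α i) ∧ ∀ i, σ (β i) = β i := by
  rw [rootPerms, MonoidHom.prod_apply, Prod.mk_eq_one]
  refine and_congr ⟨fun h i ↦ apply_eq_of_rootPerm_eq_one _ _ h i, fun h ↦ ?_⟩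
    ⟨fun h i ↦ apply_eq_of_rootPerm_eq_one _ _ h i, fun h ↦ ?_⟩
  · exact Equiv.ext fun i ↦ H.injective_α (by rw [apply_rootPerm H.map_quintic, h, Equiv.Perm.one_apply])
  · exact Equiv.ext fun i ↦ H.injective_β (by rw [apply_rootPerm H.map_sextic, h, Equiv.Perm.one_apply])

variable [IsGalois ℚ M]

theorem surjective_rootPerms (H : IsRootData ℚ α β) : Function.Surjective H.rootPerms := by
  rintro ⟨s, t⟩
  obtain ⟨σ₀, h1, h2⟩ := H.exists_isSwap_α
  obtain ⟨τ₀, h3, h4⟩ := H.exists_isSwap_β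
  obtain ⟨σ, hσ, rfl⟩ := MonoidHom.exists_mem_apply_eq_of_isSwap H.range_rootPerm_α
    (N := (rootPerm H.map_sextic H.injective_β).ker) inferInstance h2 h1 s
  obtain ⟨τ, hτ, rfl⟩ := MonoidHom.exists_mem_apply_eq_of_isSwap H.range_rootPerm_β
    (N := (rootPerm H.map_quintic H.injective_α).ker) inferInstance h3 h4 t
  refine ⟨σ * τ, ?_⟩
  rw [MonoidHom.mem_ker] at hσ hτ
  simp [rootPerms, hσ, hτ]

theorem card_gal (H : IsRootData ℚ α β) {x : M} (hx : x ^ 2 = -3) :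
    Nat.card Gal(M/ℚ) = 172800 := by
  obtain ⟨τ, h1, h2, h3⟩ := H.exists_forall_sq_eq_apply_ne
  have hτ : τ ∈ H.rootPerms.ker := by
    simp [MonoidHom.mem_ker, rootPerms, h1, h2]
  have hker : (H.rootPerms.ker : Set Gal(M/ℚ)) = {1, τ} := by
    ext σ
    simp only [SetLike.mem_coe, Set.mem_insert_iff, Set.mem_singleton_iff]
    constructor
    · intro hσ
      have hsq : ∀ (ρ : Gal(M/ℚ)) (y : M), y ^ 2 = -3 → ρ y = y ∨ ρ y = -y := by
        intro ρ y hy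
        refine sq_eq_sq_iff_eq_or_eq_neg.1 ?_
        rw [← map_pow, hy, map_neg, map_ofNat]
      have key : ∀ ρ ∈ H.rootPerms.ker, ρ x = x → ρ = 1 := by
        intro ρ hρ hρx
        obtain ⟨ha, hb⟩ := H.rootPerms_eq_one_iff.1 hρ
        refine H.eq_one ρ ha hb fun y hy ↦ ?_
        rcases sq_eq_sq_iff_eq_or_eq_neg.1 (hy.trans hx.symm) with rfl | rfl
        · exact hρx
        · rw [map_neg, hρx]
      by_cases hσx : σ x = x
      · exact Or.inl (key σ hσ hσx)
      · right
        have h4 := (hsq σ x hx).resolve_left hσx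
        have h5 := (hsq τ x hx).resolve_left (h3 x hx)
        refine (inv_mul_eq_one.1 (key (τ⁻¹ * σ) (mul_mem (inv_mem hτ) hσ) ?_)).symm
        rw [AlgEquiv.mul_apply, h4, ← h5, ← AlgEquiv.mul_apply, inv_mul_cancel, AlgEquiv.one_apply]
    · rintro (rfl | rfl)
      · exact one_mem _
      · exact hτ
  have hcard : Nat.card H.rootPerms.ker = 2 := by
    change Nat.card (H.rootPerms.ker : Set Gal(M/ℚ)) = 2
    rw [Nat.card_coe_set_eq, hker, Set.ncard_pair]
    rintro rfl
    exact h3 x hx rfl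
  rw [Subgroup.card_eq_card_quotient_mul_card_subgroup H.rootPerms.ker, hcard,
    Nat.card_congr (QuotientGroup.quotientKerEquivOfSurjective _ H.surjective_rootPerms).toEquiv,
    Nat.card_prod, Nat.card_perm, Nat.card_perm, Nat.card_fin, Nat.card_fin]
  decide

end IsRootData

theorem surjective_rootPerm_of_algHom {N M : Type*} [Field N] [Field M] [Algebra ℚ N] [Algebra ℚ M]
    [Normal ℚ N] (ι : N →ₐ[ℚ] M) {f : ℤ[X]} {n : ℕ} {r : Fin n → N}
    (hr : f.map (Int.castRingHom N) = ∏ i, (X - C (r i))) (hinj : Function.Injective r)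
    {r' : Fin n → M} (hr' : f.map (Int.castRingHom M) = ∏ i, (X - C (r' i)))
    (hinj' : Function.Injective r') (h : ∀ i, ι (r i) = r' i)
    (hsurj : Function.Surjective (rootPerm (F := ℚ) hr' hinj')) :
    Function.Surjective (rootPerm (F := ℚ) hr hinj) := by
  intro s
  obtain ⟨σ, rfl⟩ := hsurj s
  let : Algebra N M := ι.toRingHom.toAlgebra
  have : IsScalarTower ℚ N M := IsScalarTower.of_algebraMap_eq fun x ↦ (ι.commutes x).symm
  refine ⟨σ.restrictNormal N, Equiv.ext fun i ↦ hinj' ?_⟩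
  rw [apply_rootPerm hr', ← h, ← h, apply_rootPerm hr]
  exact σ.restrictNormal_commutes N (r i)

namespace NumberField

theorem rootDiscr_le_rootDiscr (K L : Type*) [Field K] [NumberField K] [Field L] [NumberField L]
    [Algebra K L] : rootDiscr K ≤ rootDiscr L := by
  have h := natAbs_discr_eq_absNorm_differentIdeal_mul_natAbs_discr_pow K (𝓞 K) L (𝓞 L)
  have hL : 0 < (discr L).natAbs := Int.natAbs_pos.2 (discr_ne_zero L)
  have hle : (discr K).natAbs ^ Module.finrank K L ≤ (discr L).natAbs := by
    rw [h]
    refine Nat.le_mul_of_pos_left _ (Nat.pos_of_ne_zero fun h0 ↦ ?_)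
    rw [h0, zero_mul] at h
    exact hL.ne' h
  have hle' : ((|discr K| : ℤ) : ℝ) ^ Module.finrank K L ≤ (|discr L| : ℤ) := by
    rw [← Nat.cast_natAbs, ← Nat.cast_natAbs]
    exact_mod_cast hle
  have h0 : (0 : ℝ) ≤ (|discr K| : ℤ) := by positivity
  have h1 : (0 : ℝ) ≤ (|discr L| : ℤ) := by positivity
  have hKL : (0 : ℝ) < Module.finrank K L := by exact_mod_cast Module.finrank_pos
  rw [rootDiscr_def, rootDiscr_def, ← Module.finrank_mul_finrank ℚ K L, Nat.cast_mul, mul_inv,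
    mul_comm, Real.rpow_mul (by positivity)]
  refine Real.rpow_le_rpow h0 ?_ (by positivity)
  rwa [Real.le_rpow_inv_iff_of_pos h0 h1 hKL, Real.rpow_natCast]

end NumberField

theorem exists_map_eq_prod_X_sub_C {K : Type*} [Field K] [IsAlgClosed K] {f : ℤ[X]}
    (hf : f.Monic) {n : ℕ} (hn : f.natDegree = n) : ∃ r : Fin n → K,
      f.map (Int.castRingHom K) = ∏ i, (X - C (r i)) := by
  have hs := IsAlgClosed.splits (f.map (Int.castRingHom K))
  have hm := hf.map (Int.castRingHom K)
  have hcard := hs.natDegree_eq_card_roots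
  rw [hf.natDegree_map, hn] at hcard
  have hprod := hs.eq_prod_roots
  rw [hm.leadingCoeff, C_1, one_mul] at hprod
  generalize (f.map (Int.castRingHom K)).roots = s at hcard hprod
  obtain ⟨l, rfl⟩ := Quot.exists_rep s
  change _ = l.length at hcard
  subst hcard
  rw [hprod]
  refine ⟨l.get, ?_⟩
  rw [← List.prod_ofFn]
  conv_lhs => rw [← List.ofFn_get l]
  change (List.map _ _).prod = _
  rw [List.map_ofFn]
  rfl

theorem rootSet_map_eq_range {K : Type*} [Field K] [CharZero K] {f : ℤ[X]} (hf : f.Monic) {n : ℕ}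
    {r : Fin n → K} (hr : f.map (Int.castRingHom K) = ∏ i, (X - C (r i))) :
    (f.map (Int.castRingHom ℚ)).rootSet K = Set.range r := by
  ext x
  rw [mem_rootSet_of_ne (hf.map _).ne_zero, ← algebraMap_int_eq, aeval_map_algebraMap]
  refine ⟨fun hx ↦ ?_, ?_⟩
  · obtain ⟨i, hi⟩ := Valuation.exists_eq_of_aeval_eq_zero hr hx
    exact ⟨i, hi.symm⟩
  · rintro ⟨i, rfl⟩
    exact Valuation.aeval_eq_zero_of_eq_prod hr i

theorem map_eq_prod_of_map_eq_prod {K L : Type*} [Field K] [Field L] (ι : K →+* L) {f : ℤ[X]}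
    {n : ℕ} {r : Fin n → K} (hr : f.map (Int.castRingHom L) = ∏ i, (X - C (ι (r i)))) :
    f.map (Int.castRingHom K) = ∏ i, (X - C (r i)) := by
  apply map_injective ι ι.injective
  rw [map_map, RingHom.ext_int (ι.comp (Int.castRingHom K)) (Int.castRingHom L), hr,
    Polynomial.map_prod]
  simp

theorem map_map_quintic : quintic.map (Int.castRingHom ℚ) =
    X ^ 5 - X ^ 4 - X ^ 3 + 3 * X ^ 2 - X - 19 := by
  simp [quintic]

theorem map_map_sextic : sextic.map (Int.castRingHom ℚ) =
    X ^ 6 - 2 * X ^ 5 + 4 * X ^ 4 - 8 * X ^ 3 + 2 * X ^ 2 + 24 * X - 20 := by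
  simp [sextic]

instance isGalois_splittingFieldInC (f : ℚ[X]) : IsGalois ℚ (splittingFieldInC f) :=
  have : IsSplittingField ℚ (splittingFieldInC f) f :=
    IntermediateField.adjoin_rootSet_isSplittingField (IsAlgClosed.splits _)
  have : Normal ℚ (splittingFieldInC f) := Normal.of_isSplittingField f
  ⟨⟩

instance isGalois_compositum (K L : IntermediateField ℚ ℂ) [IsGalois ℚ K] [IsGalois ℚ L] :
    IsGalois ℚ (K ⊔ L : IntermediateField ℚ ℂ) :=
  have h1 : Normal ℚ K := IsGalois.to_normal
  have h2 : Normal ℚ L := IsGalois.to_normal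
  have : Normal ℚ (K ⊔ L : IntermediateField ℚ ℂ) :=
    @IntermediateField.normal_sup ℚ ℂ _ _ _ K L h1 h2
  ⟨⟩

theorem exists_roots_quintic : ∃ r : Fin 5 → ℂ,
    quintic.map (Int.castRingHom ℂ) = ∏ i, (X - C (r i)) ∧
    fieldK₁ = IntermediateField.adjoin ℚ (Set.range r) := by
  have hd : quintic.natDegree = 5 := by unfold quintic; compute_degree!
  obtain ⟨r, hr⟩ := exists_map_eq_prod_X_sub_C (K := ℂ) monic_quintic hd
  exact ⟨r, hr, by rw [← rootSet_map_eq_range monic_quintic hr, map_map_quintic]; rfl⟩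

theorem exists_roots_sextic : ∃ r : Fin 6 → ℂ,
    sextic.map (Int.castRingHom ℂ) = ∏ i, (X - C (r i)) ∧
    fieldK₂ = IntermediateField.adjoin ℚ (Set.range r) := by
  have hd : sextic.natDegree = 6 := by unfold sextic; compute_degree!
  obtain ⟨r, hr⟩ := exists_map_eq_prod_X_sub_C (K := ℂ) monic_sextic hd
  exact ⟨r, hr, by rw [← rootSet_map_eq_range monic_sextic hr, map_map_sextic]; rfl⟩

theorem isRootData_of_le {M : IntermediateField ℚ ℂ} {r : Fin 5 → ℂ} {s : Fin 6 → ℂ}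
    (hr : quintic.map (Int.castRingHom ℂ) = ∏ i, (X - C (r i)))
    (hs : sextic.map (Int.castRingHom ℂ) = ∏ i, (X - C (s i))) (hrM : ∀ i, r i ∈ M)
    (hsM : ∀ i, s i ∈ M) {T : Set ℂ} (hT : ∀ x ∈ T, x ^ 2 = -3)
    (hM : M = IntermediateField.adjoin ℚ (Set.range r ∪ Set.range s ∪ T)) :
    IsRootData ℚ (fun i ↦ (⟨r i, hrM i⟩ : M)) (fun i ↦ (⟨s i, hsM i⟩ : M)) where
  map_quintic := map_eq_prod_of_map_eq_prod (algebraMap M ℂ) hr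
  map_sextic := map_eq_prod_of_map_eq_prod (algebraMap M ℂ) hs
  eq_one σ h1 h2 h3 := by
    have h := IntermediateField.algHom_ext_of_eq_adjoin ℚ hM (φ₁ := σ.toAlgHom)
      (φ₂ := AlgHom.id ℚ M) (by
        rintro x ((⟨i, rfl⟩ | ⟨i, rfl⟩) | hx)
        · exact h1 i
        · exact h2 i
        · exact h3 _ (Subtype.ext (hT x hx)))
    exact AlgEquiv.ext fun x ↦ DFunLike.congr_fun h x

theorem rootPerm_injective_of_eq_adjoin {M : IntermediateField ℚ ℂ} {f : ℤ[X]} {n : ℕ}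
    {r : Fin n → M} (hr : f.map (Int.castRingHom M) = ∏ i, (X - C (r i)))
    (hinj : Function.Injective r)
    (hM : M = IntermediateField.adjoin ℚ (Set.range fun i ↦ (r i : ℂ))) :
    Function.Injective (rootPerm (F := ℚ) hr hinj) := by
  rw [injective_iff_map_eq_one]
  intro σ hσ
  have h := IntermediateField.algHom_ext_of_eq_adjoin ℚ hM (φ₁ := σ.toAlgHom)
    (φ₂ := AlgHom.id ℚ M) (by
      rintro x ⟨i, rfl⟩
      exact apply_eq_of_rootPerm_eq_one hr hinj hσ i)
  exact AlgEquiv.ext fun x ↦ DFunLike.congr_fun h x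

/-- A Galois number field with symmetric Galois group is minimal among the nonsolvable ones. -/
theorem mem_minimalNonsolvableFields {K : IntermediateField ℚ ℂ} [IsGalois ℚ K] [NumberField K]
    {n : ℕ} (hn : 5 ≤ n) (e : Gal(K/ℚ) ≃* Equiv.Perm (Fin n)) {B : ℝ}
    (hB : NumberField.rootDiscr K ≤ B) : K ∈ minimalNonsolvableFields B := by
  refine ⟨⟨inferInstance, fun h ↦ ?_, inferInstance, hB⟩, fun L hL hLG hLs ↦ ?_⟩
  · exact Equiv.Perm.not_isSolvable (Fin n) (by simpa using hn)
      (Group.isSolvable_of_surjective (f := e.toMonoidHom) e.surjective)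
  · let : Algebra L K := (IntermediateField.inclusion hL).toRingHom.toAlgebra
    have : IsScalarTower ℚ L K := IsScalarTower.of_algebraMap_eq fun x ↦ rfl
    have : FiniteDimensional ℚ L := FiniteDimensional.left ℚ L K
    have hsurj := AlgEquiv.restrictNormalHom_surjective (F := ℚ) (K₁ := L) K
    have hinj : Function.Injective (AlgEquiv.restrictNormalHom (F := ℚ) (K₁ := K) L) := by
      by_contra hinj
      refine hLs (Equiv.Perm.isSolvable_of_surjective_of_not_injective (X := Fin n) (by simpa)
        (f := (AlgEquiv.restrictNormalHom (F := ℚ) (K₁ := K) L).comp e.symm.toMonoidHom)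
        (hsurj.comp e.symm.surjective) fun h ↦ hinj ?_)
      convert! h.comp e.injective using 1
      ext x : 1
      simp
    refine IntermediateField.eq_of_le_of_finrank_eq hL ?_
    rw [← IsGalois.card_aut_eq_finrank, ← IsGalois.card_aut_eq_finrank]
    exact (Nat.card_congr (Equiv.ofBijective _ ⟨hinj, hsurj⟩)).symm


theorem abs_prod_rpow_sub_lt :
    |(2 : ℝ) ^ (39 / 16 : ℝ) * (3 : ℝ) ^ (1 / 2 : ℝ) * (7 : ℝ) ^ (4 / 5 : ℝ) - 44.50| <
      0.005 := by
  have h : ((2 : ℝ) ^ (39 / 16 : ℝ) * (3 : ℝ) ^ (1 / 2 : ℝ) * (7 : ℝ) ^ (4 / 5 : ℝ)) ^ 80 =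
      2 ^ 195 * 3 ^ 40 * 7 ^ 64 := by
    rw [mul_pow, mul_pow, ← Real.rpow_mul_natCast (by norm_num),
      ← Real.rpow_mul_natCast (by norm_num), ← Real.rpow_mul_natCast (by norm_num)]
    norm_num
  have h0 : 0 ≤ (2 : ℝ) ^ (39 / 16 : ℝ) * (3 : ℝ) ^ (1 / 2 : ℝ) * (7 : ℝ) ^ (4 / 5 : ℝ) := by
    positivity
  generalize (2 : ℝ) ^ (39 / 16 : ℝ) * (3 : ℝ) ^ (1 / 2 : ℝ) * (7 : ℝ) ^ (4 / 5 : ℝ) = c at h h0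
  rw [abs_sub_lt_iff]
  constructor
  · rw [sub_lt_iff_lt_add, ← pow_lt_pow_iff_left₀ h0 (by norm_num) (n := 80) (by norm_num), h]
    norm_num
  · rw [sub_lt_comm, ← pow_lt_pow_iff_left₀ (by norm_num) h0 (n := 80) (by norm_num), h]
    norm_num

theorem lt_eulerMascheroniConstant : 0.573 < Real.eulerMascheroniConstant := by
  refine lt_trans ?_ (Real.eulerMascheroniSeq_lt_eulerMascheroniConstant 127)
  have hl : Real.log ((127 : ℕ) + 1 : ℝ) = 7 * Real.log 2 := by
    rw [← Real.log_rpow two_pos]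
    norm_num
  have hh : (5.4252 : ℚ) < harmonic 127 := by
    norm_num [harmonic, Finset.sum_range_succ]
  have hh' : ((5.4252 : ℚ) : ℝ) < (harmonic 127 : ℚ) := by exact_mod_cast hh
  rw [Real.eulerMascheroniSeq, hl]
  have := Real.log_two_lt_d9
  push_cast at hh'
  norm_num at hh' ⊢
  linarith

theorem lt_serreOdlyzko : 44.505 < serreOdlyzko := by
  have h1 : 1.773 < Real.exp Real.eulerMascheroniConstant := by
    refine lt_of_lt_of_le ?_ ((Real.sum_le_exp_of_nonneg (by norm_num : (0:ℝ) ≤ 0.573) 8).trans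
      (Real.exp_le_exp.2 lt_eulerMascheroniConstant.le))
    norm_num [Finset.sum_range_succ, Nat.factorial]
  rw [serreOdlyzko]
  have h2 := Real.pi_gt_d6
  nlinarith

theorem exists_isRootData_compositum : ∃ (r : Fin 5 → ℂ) (s : Fin 6 → ℂ),
    fieldK₁ = IntermediateField.adjoin ℚ (Set.range r) ∧
    fieldK₂ = IntermediateField.adjoin ℚ (Set.range s) ∧
    (∃ (hr : ∀ i, r i ∈ fieldK₁ ⊔ fieldK₂) (hs : ∀ i, s i ∈ fieldK₁ ⊔ fieldK₂),
      IsRootData ℚ (fun i ↦ (⟨r i, hr i⟩ : (fieldK₁ ⊔ fieldK₂ : IntermediateField ℚ ℂ)))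
        (fun i ↦ (⟨s i, hs i⟩ : (fieldK₁ ⊔ fieldK₂ : IntermediateField ℚ ℂ)))) ∧
    ∃ (α : Fin 5 → (fieldK₁ ⊔ fieldK₂ ⊔ fieldK₃ : IntermediateField ℚ ℂ))
      (β : Fin 6 → (fieldK₁ ⊔ fieldK₂ ⊔ fieldK₃ : IntermediateField ℚ ℂ)), IsRootData ℚ α β := by
  obtain ⟨r, hr, h1⟩ := exists_roots_quintic
  obtain ⟨s, hs, h2⟩ := exists_roots_sextic
  have hr1 : ∀ i, r i ∈ fieldK₁ := fun i ↦
    h1 ▸ IntermediateField.subset_adjoin ℚ _ (Set.mem_range_self i)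
  have hs2 : ∀ i, s i ∈ fieldK₂ := fun i ↦
    h2 ▸ IntermediateField.subset_adjoin ℚ _ (Set.mem_range_self i)
  have h12 : fieldK₁ ⊔ fieldK₂ = IntermediateField.adjoin ℚ (Set.range r ∪ Set.range s) := by
    rw [h1, h2, IntermediateField.adjoin_union]
  have hr12 : ∀ i, r i ∈ fieldK₁ ⊔ fieldK₂ := fun i ↦
    (le_sup_left : fieldK₁ ≤ fieldK₁ ⊔ fieldK₂) (hr1 i)
  have hs12 : ∀ i, s i ∈ fieldK₁ ⊔ fieldK₂ := fun i ↦
    (le_sup_right : fieldK₂ ≤ fieldK₁ ⊔ fieldK₂) (hs2 i)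
  have hle : fieldK₁ ⊔ fieldK₂ ≤ fieldK₁ ⊔ fieldK₂ ⊔ fieldK₃ := le_sup_left
  refine ⟨r, s, h1, h2, ⟨hr12, hs12, isRootData_of_le hr hs hr12 hs12 (T := ∅) (by simp)
    (by rw [Set.union_empty, h12])⟩, _, _, isRootData_of_le hr hs (fun i ↦ hle (hr12 i))
    (fun i ↦ hle (hs12 i)) (T := (X ^ 2 + 3 : ℚ[X]).rootSet ℂ) (fun x hx ↦ ?_) ?_⟩
  · have := aeval_eq_zero_of_mem_rootSet hx
    simp only [map_add, map_pow, aeval_X, map_ofNat] at this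
    linear_combination this
  · rw [IntermediateField.adjoin_union, ← h12]
    rfl

theorem exists_sq_eq_neg_three :
    ∃ x : (fieldK₁ ⊔ fieldK₂ ⊔ fieldK₃ : IntermediateField ℚ ℂ), x ^ 2 = -3 := by
  obtain ⟨z, hz⟩ := IsAlgClosed.exists_pow_nat_eq (-3 : ℂ) two_pos
  have hz3 : z ∈ fieldK₃ := by
    refine IntermediateField.subset_adjoin ℚ _ ?_
    have hm : (X ^ 2 + 3 : ℚ[X]).Monic := by monicity!
    rw [mem_rootSet_of_ne hm.ne_zero]
    simp [hz, map_ofNat]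
  exact ⟨⟨z, (le_sup_right : fieldK₃ ≤ fieldK₁ ⊔ fieldK₂ ⊔ fieldK₃) hz3⟩, Subtype.ext hz⟩

theorem nonempty_mulEquiv_perm {K M : IntermediateField ℚ ℂ} [IsGalois ℚ K] [IsGalois ℚ M]
    (hK : K ≤ M) {f : ℤ[X]} {n : ℕ} {r : Fin n → ℂ} (hrM : ∀ i, r i ∈ M)
    (hr : f.map (Int.castRingHom M) = ∏ i, (X - C (⟨r i, hrM i⟩ : M)))
    (hinj : Function.Injective fun i ↦ (⟨r i, hrM i⟩ : M))
    (hadj : K = IntermediateField.adjoin ℚ (Set.range r))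
    (hsurj : (rootPerm (F := ℚ) hr hinj).range = ⊤) :
    Nonempty (Gal(K/ℚ) ≃* Equiv.Perm (Fin n)) := by
  have hrK : ∀ i, r i ∈ K := fun i ↦
    hadj ▸ IntermediateField.subset_adjoin ℚ _ (Set.mem_range_self i)
  have hr' : f.map (Int.castRingHom K) = ∏ i, (X - C (⟨r i, hrK i⟩ : K)) :=
    map_eq_prod_of_map_eq_prod (IntermediateField.inclusion hK).toRingHom hr
  have hinj' : Function.Injective fun i ↦ (⟨r i, hrK i⟩ : K) := fun i j hij ↦
    hinj (Subtype.ext (congrArg (Subtype.val : K → ℂ) hij))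
  let ι : K →ₐ[ℚ] M := IntermediateField.inclusion hK
  exact ⟨MulEquiv.ofBijective (rootPerm (F := ℚ) hr' hinj')
    ⟨rootPerm_injective_of_eq_adjoin hr' hinj' hadj,
      surjective_rootPerm_of_algHom ι hr' hinj' hr hinj
        (fun i ↦ rfl) (MonoidHom.range_eq_top.1 hsurj)⟩⟩

theorem mainTheorem2 :
    -- Galois groups of the two polynomials
    (IsGalois ℚ fieldK₁ ∧ Nonempty (Gal(fieldK₁/ℚ) ≃* Equiv.Perm (Fin 5))) ∧
    (IsGalois ℚ fieldK₂ ∧ Nonempty (Gal(fieldK₂/ℚ) ≃* Equiv.Perm (Fin 6))) ∧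
    -- two distinct minimal nonsolvable fields, both with root discriminant at most `Ω`
    (fieldK₁ ∈ minimalNonsolvableFields serreOdlyzko ∧
      fieldK₂ ∈ minimalNonsolvableFields serreOdlyzko ∧ fieldK₁ ≠ fieldK₂) ∧
    -- the compositum `K₁ K₂`
    (IsGalois ℚ (fieldK₁ ⊔ fieldK₂ : IntermediateField ℚ ℂ) ∧
      Nonempty (Gal((fieldK₁ ⊔ fieldK₂ : IntermediateField ℚ ℂ)/ℚ) ≃*
        Equiv.Perm (Fin 5) × Equiv.Perm (Fin 6)) ∧
      Module.finrank ℚ (fieldK₁ ⊔ fieldK₂ : IntermediateField ℚ ℂ) = 86400 ∧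
      NumberField.rootDiscr (fieldK₁ ⊔ fieldK₂ : IntermediateField ℚ ℂ) =
        (2 : ℝ) ^ (39 / 16 : ℝ) * (3 : ℝ) ^ (1 / 2 : ℝ) * (7 : ℝ) ^ (4 / 5 : ℝ)) ∧
    -- the compositum `K₁ K₂ K₃`
    (IsGalois ℚ (fieldK₁ ⊔ fieldK₂ ⊔ fieldK₃ : IntermediateField ℚ ℂ) ∧
      ¬ Group.IsSolvable Gal((fieldK₁ ⊔ fieldK₂ ⊔ fieldK₃ : IntermediateField ℚ ℂ)/ℚ) ∧
      Module.finrank ℚ (fieldK₁ ⊔ fieldK₂ ⊔ fieldK₃ : IntermediateField ℚ ℂ) = 172800 ∧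
      NumberField.rootDiscr (fieldK₁ ⊔ fieldK₂ ⊔ fieldK₃ : IntermediateField ℚ ℂ) =
        (2 : ℝ) ^ (39 / 16 : ℝ) * (3 : ℝ) ^ (1 / 2 : ℝ) * (7 : ℝ) ^ (4 / 5 : ℝ)) ∧
    -- the numerical value, rounded to the nearest hundredth, and the comparison with `Ω`
    (|(2 : ℝ) ^ (39 / 16 : ℝ) * (3 : ℝ) ^ (1 / 2 : ℝ) * (7 : ℝ) ^ (4 / 5 : ℝ) - 44.50| < 0.005 ∧
      (2 : ℝ) ^ (39 / 16 : ℝ) * (3 : ℝ) ^ (1 / 2 : ℝ) * (7 : ℝ) ^ (4 / 5 : ℝ) < serreOdlyzko) := by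
  obtain ⟨r, s, h1, h2, ⟨hr, hs, H⟩, α, β, H'⟩ := exists_isRootData_compositum
  obtain ⟨e₁⟩ := nonempty_mulEquiv_perm (K := fieldK₁) le_sup_left hr H.map_quintic H.injective_α h1
    H.range_rootPerm_α
  obtain ⟨e₂⟩ := nonempty_mulEquiv_perm (K := fieldK₂) le_sup_right hs H.map_sextic H.injective_β h2
    H.range_rootPerm_β
  obtain ⟨z, hz⟩ := exists_sq_eq_neg_three
  have hM : fieldK₁ ⊔ fieldK₂ = IntermediateField.adjoin ℚ (Set.range r ∪ Set.range s) := by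
    rw [h1, h2, IntermediateField.adjoin_union]
  have hinj : Function.Injective H.rootPerms := by
    rw [injective_iff_map_eq_one]
    intro σ hσ
    rw [H.rootPerms_eq_one_iff] at hσ
    have h := IntermediateField.algHom_ext_of_eq_adjoin ℚ hM (φ₁ := σ.toAlgHom)
      (φ₂ := AlgHom.id ℚ (fieldK₁ ⊔ fieldK₂ : IntermediateField ℚ ℂ)) (by
        rintro x (⟨i, rfl⟩ | ⟨i, rfl⟩)
        · exact hσ.1 i
        · exact hσ.2 i)
    exact AlgEquiv.ext fun x ↦ DFunLike.congr_fun h x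
  let e := MulEquiv.ofBijective H.rootPerms ⟨hinj, H.surjective_rootPerms⟩
  have hΩ : (2 : ℝ) ^ (39 / 16 : ℝ) * (3 : ℝ) ^ (1 / 2 : ℝ) * (7 : ℝ) ^ (4 / 5 : ℝ) <
      serreOdlyzko := by
    have := (abs_sub_lt_iff.1 abs_prod_rpow_sub_lt).1
    have := lt_serreOdlyzko
    linarith
  have hle : ∀ K : IntermediateField ℚ ℂ, [NumberField K] → K ≤ fieldK₁ ⊔ fieldK₂ →
      NumberField.rootDiscr K ≤ serreOdlyzko := by
    intro K _ hK
    let : Algebra K (fieldK₁ ⊔ fieldK₂ : IntermediateField ℚ ℂ) :=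
      (IntermediateField.inclusion hK).toRingHom.toAlgebra
    exact (NumberField.rootDiscr_le_rootDiscr K _).trans (H.rootDiscr_eq.trans_lt hΩ).le
  refine ⟨⟨inferInstance, ⟨e₁⟩⟩, ⟨inferInstance, ⟨e₂⟩⟩,
    ⟨mem_minimalNonsolvableFields (by norm_num) e₁ (hle _ le_sup_left),
      mem_minimalNonsolvableFields (by norm_num) e₂ (hle _ le_sup_right), fun h ↦ ?_⟩,
    ⟨inferInstance, ⟨e⟩, ?_, H.rootDiscr_eq⟩,
    ⟨inferInstance, fun h ↦ ?_, ?_, H'.rootDiscr_eq⟩, abs_prod_rpow_sub_lt, hΩ⟩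
  · have h5 := Nat.card_congr e₁.toEquiv
    have h6 := Nat.card_congr e₂.toEquiv
    rw [← h, h5, Nat.card_perm, Nat.card_perm, Nat.card_fin, Nat.card_fin] at h6
    exact absurd h6 (by decide)
  · rw [← IsGalois.card_aut_eq_finrank, Nat.card_congr e.toEquiv, Nat.card_prod, Nat.card_perm,
      Nat.card_perm, Nat.card_fin, Nat.card_fin]
    decide
  · exact Equiv.Perm.not_isSolvable_fin_5 (Group.isSolvable_of_surjective
      (MonoidHom.range_eq_top.1 H'.range_rootPerm_α))
  · rw [← IsGalois.card_aut_eq_finrank, H'.card_gal hz]
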